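/- Let $\lambda\ge 0$ and let $\mathbb D$ be the open unit disk in $\mathbb C$. A function $f$ on $\mathbb D$ that is $C^2$ (in the real sense) is called $\lambda$-analytic if $D_{\bar z}f=0$ on $\mathbb D$, where $$D_{\bar z}f(z)=\partial_{\bar z}f(z)-\lambda\,\frac{f(z)-f(\bar z)}{z-\bar z},$$ and for real $z$ the quotient is understood as its limit $-i\,\partial_y f(z)$. Let $d\sigma_\lambda(z)=c_\lambda|y|^{2\lambda}\,dx\,dy$ ($z=x+iy\in\mathbb D$) with $c_\lambda=\dfrac{\Gamma(\lambda+2)}{\Gamma(\lambda+1/2)\Gamma(1/2)}$, and for $1\le p<\infty$ let $A^p_\lambda(\mathbb D)$ be the space of $\lambda$-analytic functions in $L^p(\mathbb D;d\sigma_\lambda)$, with the $L^p(\mathbb D;d\sigma_\lambda)$-norm, written $\|\cdot\|_{A^p_\lambda}$. Theorem. Let $1<p<\infty$ and $p^{-1}+p'^{-1}=1$. The dual space $A^p_\lambda(\mathbb D)^*$ is isomorphic to $A^{p'}_\lambda(\mathbb D)$ in the following sense. Every $g\in A^{p'}_\lambda(\mathbb D)$ defines a functional $L_g\in A^p_\lambda(\mathbb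 D)^*$ by $$L_g(f)=\int_{\mathbb D}f(z)\overline{g(z)}\,d\sigma_\lambda(z),\qquad f\in A^p_\lambda(\mathbb D),$$ the integral being absolutely convergent; every $L\in A^p_\lambda(\mathbb D)^*$ is $L_g$ for a unique $g\in A^{p'}_\lambda(\mathbb D)$; the conjugate-linear bijection $g\mapsto L_g$ is a homeomorphism for the norm topologies; and there is a constant $C_p>0$, depending only on $p$ and $\lambda$, such that $C_p\|g\|_{A^{p'}_\lambda}\le\|L_g\|\le\|g\|_{A^{p'}_\lambda}$ for all $g\in A^{p'}_\lambda(\mathbb D)$. -/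

import Mathlib

open MeasureTheory
open scoped ENNReal ComplexConjugate

/-- The Wirtinger derivative `∂_{z̄} f = (∂_x f + i ∂_y f) / 2` of a function of a complex variable
(differentiable in the real sense). -/
noncomputable def wirtingerBar (f : ℂ → ℂ) (z : ℂ) : ℂ :=
  (fderiv ℝ f z 1 + Complex.I * fderiv ℝ f z Complex.I) / 2

/-- The quotient `(f(z) - f(z̄)) / (z - z̄)`. On the real axis it stands for its limit:
`(f(x+iy) - f(x-iy)) / (2iy)` tends to `-i ∂_y f(x)` as `y → 0`. -/
noncomputable def reflectionQuotient (f : ℂ → ℂ) (z : ℂ) : ℂ :=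
  if z.im = 0 then -Complex.I * fderiv ℝ f z Complex.I
  else (f z - f (conj z)) / (z - conj z)

/-- The complex Dunkl operator `D_{z̄} f = ∂_{z̄} f - lam (f(z) - f(z̄)) / (z - z̄)`. -/
noncomputable def dunklBar (lam : ℝ) (f : ℂ → ℂ) (z : ℂ) : ℂ :=
  wirtingerBar f z - (lam : ℂ) * reflectionQuotient f z

/-- `f` is `lam`-analytic in the open unit disk: it is of class `C²` there (in the real sense) and
`D_{z̄} f = 0` there. The values of `f` outside the disk play no role. -/
def IsLambdaAnalytic (lam : ℝ) (f : ℂ → ℂ) : Prop :=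
  ContDiffOn ℝ 2 f (Metric.ball (0 : ℂ) 1) ∧ ∀ z ∈ Metric.ball (0 : ℂ) 1, dunklBar lam f z = 0

/-- The constant `c_lam = Γ(lam + 2) / (Γ(lam + 1/2) Γ(1/2))`. -/
noncomputable def diskConst (lam : ℝ) : ℝ :=
  Real.Gamma (lam + 2) / (Real.Gamma (lam + 1 / 2) * Real.Gamma (1 / 2))

/-- The measure `dσ_lam(z) = c_lam |y|^{2 lam} dx dy` on the open unit disk, as a measure on `ℂ`
that vanishes outside the disk. -/
noncomputable def diskMeasure (lam : ℝ) : Measure ℂ :=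
  ((volume : Measure ℂ).restrict (Metric.ball (0 : ℂ) 1)).withDensity
    fun z => ENNReal.ofReal (diskConst lam * |z.im| ^ (2 * lam))

theorem IsLambdaAnalytic.differentiableAt {lam : ℝ} {f : ℂ → ℂ} (hf : IsLambdaAnalytic lam f)
    {z : ℂ} (hz : z ∈ Metric.ball (0 : ℂ) 1) : DifferentiableAt ℝ f z :=
  (hf.1.differentiableOn (by norm_num)).differentiableAt (Metric.isOpen_ball.mem_nhds hz)

theorem IsLambdaAnalytic.zero (lam : ℝ) : IsLambdaAnalytic lam (0 : ℂ → ℂ) :=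
  ⟨contDiffOn_const (c := (0 : ℂ)), fun z _ => by
    simp [dunklBar, wirtingerBar, reflectionQuotient]⟩

theorem IsLambdaAnalytic.add {lam : ℝ} {f g : ℂ → ℂ} (hf : IsLambdaAnalytic lam f)
    (hg : IsLambdaAnalytic lam g) : IsLambdaAnalytic lam (f + g) := by
  refine ⟨hf.1.add hg.1, fun z hz => ?_⟩
  have h : dunklBar lam (f + g) z = dunklBar lam f z + dunklBar lam g z := by
    simp only [dunklBar, wirtingerBar, reflectionQuotient,
      fderiv_add (hf.differentiableAt hz) (hg.differentiableAt hz), add_apply,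
      Pi.add_apply]
    split_ifs <;> ring
  rw [h, hf.2 z hz, hg.2 z hz, add_zero]

theorem IsLambdaAnalytic.smul {lam : ℝ} {f : ℂ → ℂ} (c : ℂ) (hf : IsLambdaAnalytic lam f) :
    IsLambdaAnalytic lam (c • f) := by
  refine ⟨hf.1.const_smul c, fun z hz => ?_⟩
  have h : dunklBar lam (c • f) z = c * dunklBar lam f z := by
    simp only [dunklBar, wirtingerBar, reflectionQuotient,
      fderiv_const_smul (hf.differentiableAt hz) c, smul_apply,
      Pi.smul_apply, smul_eq_mul]
    split_ifs <;> ring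
  rw [h, hf.2 z hz, mul_zero]

/-- The `lam`-Bergman space `A^p_lam(𝔻)`: the elements of `L^p(𝔻; dσ_lam)` that are `lam`-analytic
in the disk (that is, whose class contains a `lam`-analytic function), with the norm of `L^p`. -/
noncomputable def bergmanSpace (lam : ℝ) (p : ℝ≥0∞) : Submodule ℂ (Lp ℂ p (diskMeasure lam)) where
  carrier := {f | ∃ F : ℂ → ℂ, IsLambdaAnalytic lam F ∧ f =ᵐ[diskMeasure lam] F}
  zero_mem' := ⟨0, IsLambdaAnalytic.zero lam, Lp.coeFn_zero ℂ p (diskMeasure lam)⟩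
  add_mem' := by
    rintro f g ⟨F, hF, hf⟩ ⟨G, hG, hg⟩
    exact ⟨F + G, hF.add hG, (Lp.coeFn_add f g).trans (hf.add hg)⟩
  smul_mem' := by
    rintro c f ⟨F, hF, hf⟩
    exact ⟨c • F, hF.smul c, (Lp.coeFn_smul c f).trans (hf.const_smul c)⟩

/-!
The weight `|y| ^ (2 lam)` and the operator `D_{z̄}` are adapted to each other: away from the real
axis, `D_{z̄} f = 0` expresses the radial derivative `E f = z ∂_z f + z̄ ∂_{z̄} f` through an
operator in the angle which is symmetric for the weight `|sin θ| ^ (2 lam)` on each circle.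
Everything rests on the resulting orthogonality relations and on an explicit kernel.

*The Cauchy kernel.* It has the form `C(z, w) = (1 - z w̄)⁻¹ p(|1 - z w̄| ^ 2, |1 - z w| ^ 2)`,
where `p` is a normalised multiple of
`∫₀¹ u ^ lam (1 - u) ^ (lam - 1) ((1 - u) x + u y) ^ (-lam) du` (and `p = 1` for `lam = 0`). Two
first-order identities for `p`, its homogeneity and a relation between `p(x, y)` and `p(y, x)`, make
`C(·, w)` `lam`-analytic (`exists_isCauchyProfile`,
`IsCauchyProfile.isLambdaAnalytic_cauchyKer`).

*The Cauchy formula.* Symmetry of the angular operator, and a bilinear companion of it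
(`integral_eulerDeriv_mul_conj_sub`, `integral_eulerDeriv_mul_add`), show that the weighted integral
of `f(s e^{iθ}) conj g(t e^{iθ})` depends on `s t` only (`integral_mul_conj_eq_of_mul_eq`), and that
the weighted integral of `f(s e^{iθ}) g(t e^{iθ}) e^{iθ}` vanishes
(`integral_mul_mul_circlePt_eq_zero`), for `lam`-analytic `f` and `g`. By the second relation the
kernel `conj C` may be replaced by the nonnegative Poisson kernel
`(1 - t ^ 2) |1 - t e^{iθ} ē| ^ (-2) p`; by the first, `t` may be sent to `1` with `s t` fixed, and
the Poisson kernel concentrates at its pole. This gives `IsCauchyProfile.cauchy_formula`.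

*The Bergman projection.* Differentiating the Cauchy formula along the radius and integrating in
polar coordinates, a constant multiple of the kernel `K = (E + lam + 1) C` reproduces every
integrable `lam`-analytic function (`IsCauchyProfile.integral_bergmanKer_mul`). The bounds on `p`
give `|K(z, ρ e^{iθ})| |sin θ| ^ (2 lam) ≲ |1 - ρ e^{iθ} z̄| ^ (-2) + |1 - ρ e^{iθ} z| ^ (-2)`,
whence Schur's test with powers of `1 - |z|` makes the integral operator with kernel `|K|` bounded
on `L^r` for `1 < r < ∞` (`IsCauchyProfile.exists_eLpNorm_bergmanProj_le`). Its values are `lam`-analytic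
because `E` preserves `lam`-analyticity
(`IsCauchyProfile.exists_isLambdaAnalytic_bergmanProj`).

*Duality.* A functional on the Bergman space, composed with the projection, is a functional on
`L^p`, hence integration against some `h` in `L^{p'}` (`exists_memLp_forall_eq_integral_mul`);
projecting `conj h` gives the representing function (`exists_eq_bergmanPairing`). Since the
projection is symmetric and fixes `g`, testing `L_g` on projections of `L^p` functions and using the
converse of Hölder's inequality bounds `‖g‖` by a multiple of `‖L_g‖`
(`exists_mul_norm_le_norm_bergmanPairing`), which contains the uniqueness and the continuity of the
inverse.
-/

/-! ### Duality of Lᵖ spaces over a finite measure -/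

section LpDuality

open Filter Topology

variable {α : Type*} {m : MeasurableSpace α} {μ : Measure α}

/-- Converse of Hölder's inequality, tested on `f = conj g * ‖g‖ ^ (q - 2)`. -/
theorem toReal_eLpNorm_le_of_forall_integral_mul_le {p q : ℝ≥0∞} [p.HolderConjugate q]
    (hp : p ≠ ∞) (hq : q ≠ ∞) {g : α → ℂ} (hg : MemLp g q μ) {M : ℝ} (hM : 0 ≤ M)
    (h : ∀ f, MemLp f p μ → ‖∫ x, f x * g x ∂μ‖ ≤ M * (eLpNorm f p μ).toReal) :
    (eLpNorm g q μ).toReal ≤ M := by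
  have hpq : p.toReal.HolderConjugate q.toReal :=
    ENNReal.HolderConjugate.toReal_of_ne_top hp hq
  set P := p.toReal
  set Q := q.toReal
  have hP0 : 0 < P := hpq.pos
  have hQ0 : 0 < Q := hpq.symm.pos
  have hQ1 : 1 < Q := hpq.symm.lt
  have hp0 : p ≠ 0 := fun h0 => by simp [P, h0] at hP0
  have hq0 : q ≠ 0 := fun h0 => by simp [Q, h0] at hQ0
  set N := (eLpNorm g q μ).toReal with hN
  have hNQ : N ^ Q = ∫ x, ‖g x‖ ^ Q ∂μ := by
    rw [hN, hg.eLpNorm_eq_integral_rpow_norm hq0 hq, ENNReal.toReal_ofReal (by positivity),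
      ← Real.rpow_mul (by positivity), inv_mul_cancel₀ hQ0.ne', Real.rpow_one]
  have hN0 : 0 ≤ N := ENNReal.toReal_nonneg
  set f : α → ℂ := fun x => conj (g x) * ((‖g x‖ ^ (Q - 2) : ℝ) : ℂ) with hf
  have hfn : ∀ x, ‖f x‖ = ‖g x‖ ^ (Q - 1) := fun x => by
    rcases eq_or_ne (g x) 0 with h0 | h0
    · simp [hf, h0, Real.zero_rpow (sub_ne_zero.2 hQ1.ne')]
    · have : 0 < ‖g x‖ := norm_pos_iff.2 h0
      rw [hf, norm_mul, RCLike.norm_conj, Complex.norm_real, Real.norm_of_nonneg (by positivity)]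
      rw [show Q - 1 = 1 + (Q - 2) by ring, Real.rpow_add this, Real.rpow_one]
  have hfg : ∀ x, f x * g x = ((‖g x‖ ^ Q : ℝ) : ℂ) := fun x => by
    rcases eq_or_ne (g x) 0 with h0 | h0
    · simp [h0, Real.zero_rpow hQ0.ne']
    · have : 0 < ‖g x‖ := norm_pos_iff.2 h0
      have e : conj (g x) * g x = ((‖g x‖ ^ 2 : ℝ) : ℂ) := by
        rw [mul_comm, Complex.mul_conj, Complex.normSq_eq_norm_sq]
      calc f x * g x = conj (g x) * g x * ((‖g x‖ ^ (Q - 2) : ℝ) : ℂ) := by rw [hf]; ring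
        _ = ((‖g x‖ ^ 2 * ‖g x‖ ^ (Q - 2) : ℝ) : ℂ) := by rw [e]; push_cast; ring
        _ = _ := by
            rw [← Real.rpow_natCast, ← Real.rpow_add this]
            norm_num
  have hpow : ∀ x, ‖f x‖ ^ P = ‖g x‖ ^ Q := fun x => by
    rw [hfn, ← Real.rpow_mul (norm_nonneg _), hpq.symm.sub_one_mul_conj]
  have hfm : AEStronglyMeasurable f μ := by
    have h1 : AEStronglyMeasurable (fun x => ‖g x‖ ^ (Q - 2)) μ :=
      (hg.1.norm.aemeasurable.pow_const _).aestronglyMeasurable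
    exact (Complex.continuous_conj.comp_aestronglyMeasurable hg.1).mul
      (Complex.continuous_ofReal.comp_aestronglyMeasurable h1)
  have hfL : MemLp f p μ := by
    rw [← integrable_norm_rpow_iff hfm hp0 hp]
    exact ((integrable_norm_rpow_iff hg.1 hq0 hq).2 hg).congr (ae_of_all _ fun x => (hpow x).symm)
  have hfN : (eLpNorm f p μ).toReal = N ^ (Q - 1) := by
    rw [hfL.eLpNorm_eq_integral_rpow_norm hp0 hp, ENNReal.toReal_ofReal (by positivity)]
    rw [integral_congr_ae (ae_of_all μ hpow), ← hNQ, ← Real.rpow_mul hN0]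
    congr 1
    have hs := hpq.inv_add_inv_eq_one
    change Q * P⁻¹ = Q - 1
    field_simp at hs ⊢
    linarith
  have key := h f hfL
  simp only [hfg] at key
  rw [integral_complex_ofReal, Complex.norm_real, ← hNQ, Real.norm_of_nonneg (by positivity), hfN]
    at key
  rcases hN0.eq_or_lt with h0 | h0
  · rw [← h0]; exact hM
  · have : N ^ Q = N * N ^ (Q - 1) := by
      rw [show Q = 1 + (Q - 1) by ring, Real.rpow_add h0, Real.rpow_one]; norm_num
    rw [this] at key
    exact le_of_mul_le_mul_right key (by positivity)

/-- The complex measure `s ↦ Λ (1_s)` of a functional on `Lᵖ` has a density. -/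
theorem exists_integrable_forall_indicator [IsFiniteMeasure μ] {p : ℝ≥0∞} [Fact (1 ≤ p)]
    (hp : p ≠ ∞) (Λ : StrongDual ℂ (Lp ℂ p μ)) :
    ∃ h : α → ℂ, Integrable h μ ∧ ∀ (s : Set α) (hs : MeasurableSet s),
      Λ (indicatorConstLp p hs (measure_ne_top μ s) 1) = ∫ x in s, h x ∂μ := by
  classical
  have hp0 : p ≠ 0 := (one_pos.trans_le (Fact.out : 1 ≤ p)).ne'
  -- The Radon–Nikodym theorem for signed measures, applied to the real and imaginary parts.
  have real_case : ∀ R : ℂ →L[ℝ] ℝ, ∃ h : α → ℝ, Integrable h μ ∧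
      ∀ (s : Set α) (hs : MeasurableSet s),
      R (Λ (indicatorConstLp p hs (measure_ne_top μ s) 1)) = ∫ x in s, h x ∂μ := by
    intro R
    -- `s ↦ 1_s` is countably additive with values in `Lᵖ`, as `p < ∞`.
    have hadd : ∀ (f : ℕ → Set α) (hf : ∀ i, MeasurableSet (f i)),
        Pairwise (Function.onFun Disjoint f) →
        HasSum (fun i => indicatorConstLp p (hf i) (measure_ne_top μ _) (1 : ℂ))
          (indicatorConstLp p (MeasurableSet.iUnion hf) (measure_ne_top μ _) (1 : ℂ)) := by
      intro f hf hd
      have hfin : ∀ t : Finset ℕ, MeasurableSet (⋃ i ∈ t, f i) := fun t =>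
        t.measurableSet_biUnion fun i _ => hf i
      have hsum : ∀ t : Finset ℕ, ∑ i ∈ t, indicatorConstLp p (hf i) (measure_ne_top μ _) (1 : ℂ)
          = indicatorConstLp p (hfin t) (measure_ne_top μ _) (1 : ℂ) := by
        intro t
        induction t using Finset.induction_on with
        | empty => simp
        | insert a t ha ih =>
          rw [Finset.sum_insert ha, ih, ← indicatorConstLp_disjoint_union (hf a) (hfin t)]
          · congr 1
            simp
          · simp only [Set.disjoint_iUnion_right]
            exact fun i hi => hd (fun h => ha (h ▸ hi))
      rw [HasSum]
      simp only [hsum]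
      refine tendsto_indicatorConstLp_set hp ?_
      have h1 : ∀ t : Finset ℕ, μ (symmDiff (⋃ i ∈ t, f i) (⋃ i, f i)) =
          μ (⋃ i, f i) - ∑ i ∈ t, μ (f i) := by
        intro t
        have hsub : (⋃ i ∈ t, f i) ⊆ ⋃ i, f i := Set.iUnion₂_subset_iUnion _ _
        rw [Set.symmDiff_def, Set.sdiff_eq_empty.2 hsub, Set.empty_union,
          measure_sdiff hsub (hfin t).nullMeasurableSet (measure_ne_top μ _),
          measure_biUnion_finset (fun i _ j _ hij => hd hij) (fun i _ => hf i)]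
      simp only [h1]
      have h2 : Tendsto (fun t : Finset ℕ => ∑ i ∈ t, μ (f i)) atTop (𝓝 (μ (⋃ i, f i))) := by
        rw [measure_iUnion hd hf]
        exact ENNReal.summable.hasSum
      have := ENNReal.Tendsto.sub (tendsto_const_nhds (x := μ (⋃ i, f i))) h2
        (Or.inl (measure_ne_top μ _))
      simpa using this
    let ν : SignedMeasure α :=
      { measureOf' := fun s => if hs : MeasurableSet s then
          R (Λ (indicatorConstLp p hs (measure_ne_top μ s) 1)) else 0
        empty' := by simp
        not_measurable' := fun s hs => by simp [hs]
        m_iUnion' := fun f hf hd => by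
          simp only [hf, MeasurableSet.iUnion hf, dif_pos]
          exact (hadd f hf hd).mapL ((R.comp (Λ.restrictScalars ℝ))) }
    have hν : ∀ s (hs : MeasurableSet s),
        ν s = R (Λ (indicatorConstLp p hs (measure_ne_top μ s) 1)) := fun s hs => dif_pos hs
    have hac : ν ≪ᵥ μ.toENNRealVectorMeasure := by
      refine VectorMeasure.AbsolutelyContinuous.mk fun s hs h0 => ?_
      rw [Measure.toENNRealVectorMeasure_apply_measurable hs] at h0
      rw [hν s hs]
      have : indicatorConstLp p hs (measure_ne_top μ s) (1 : ℂ) = 0 := by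
        rw [← norm_eq_zero, norm_indicatorConstLp hp0 hp, Measure.real, h0]
        have : p.toReal ≠ 0 := (ENNReal.toReal_pos hp0 hp).ne'
        simp [Real.zero_rpow (inv_ne_zero this)]
      simp [this]
    refine ⟨ν.rnDeriv μ, SignedMeasure.integrable_rnDeriv _ _, fun s hs => ?_⟩
    rw [← hν s hs, ← withDensityᵥ_apply (SignedMeasure.integrable_rnDeriv _ _) hs,
      SignedMeasure.withDensityᵥ_rnDeriv_eq ν μ hac]
  obtain ⟨h₁, hi₁, e₁⟩ := real_case Complex.reCLM
  obtain ⟨h₂, hi₂, e₂⟩ := real_case Complex.imCLM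
  refine ⟨fun x => h₁ x + h₂ x * Complex.I, hi₁.ofReal.add (hi₂.ofReal.mul_const _), fun s hs => ?_⟩
  have i₁ : Integrable (fun x => (h₁ x : ℂ)) (μ.restrict s) := hi₁.ofReal.integrableOn
  have i₂ : Integrable (fun x => (h₂ x : ℂ) * Complex.I) (μ.restrict s) :=
    (hi₂.ofReal.mul_const _).integrableOn
  rw [integral_add i₁ i₂, integral_mul_const, integral_complex_ofReal, integral_complex_ofReal,
    ← e₁ s hs, ← e₂ s hs]
  exact (Complex.re_add_im _).symm

/-- If a functional on `Lᵖ` is integration against `h` on indicators of measurable subsets of `G`,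
and `h` is `q`-integrable on `G`, then it is so on all functions supported in `G`. -/
theorem apply_indicator_eq_integral [IsFiniteMeasure μ] {p q : ℝ≥0∞} [p.HolderConjugate q]
    [Fact (1 ≤ p)] [Fact (1 ≤ q)] (hp : p ≠ ∞) (Λ : StrongDual ℂ (Lp ℂ p μ)) {h : α → ℂ}
    (hΛ : ∀ (s : Set α) (hs : MeasurableSet s),
      Λ (indicatorConstLp p hs (measure_ne_top μ s) 1) = ∫ x in s, h x ∂μ)
    {G : Set α} (hG : MeasurableSet G) (hh : MemLp (G.indicator h) q μ)
    {f : α → ℂ} (hf : MemLp f p μ) :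
    Λ ((hf.indicator hG).toLp _) = ∫ x, f x * G.indicator h x ∂μ := by
  have : ENNReal.HolderTriple ∞ p p := inferInstance
  have hGi : MemLp (G.indicator fun _ => (1 : ℂ)) ∞ μ := memLp_indicator_const _ hG _ (by simp)
  -- Both sides are continuous in `f`: `A` restricts to `G`, and `Bp` integrates against `1_G h`.
  let A : Lp ℂ p μ →L[ℂ] Lp ℂ p μ :=
    (ContinuousLinearMap.mul ℂ ℂ).holderL μ ∞ p p (hGi.toLp _)
  have hA : ∀ u : Lp ℂ p μ, A u =ᵐ[μ] G.indicator u := fun u => by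
    filter_upwards [(ContinuousLinearMap.mul ℂ ℂ).coeFn_holder (r := p) (hGi.toLp _) u,
      hGi.coeFn_toLp] with x hx h1
    rw [show A u x = _ from hx, h1]
    by_cases hxG : x ∈ G <;> simp [hxG]
  let Bp := (ContinuousLinearMap.mul ℂ ℂ).lpPairing μ q p (hh.toLp _)
  have hB : ∀ u : Lp ℂ p μ, Bp u = ∫ x, u x * G.indicator h x ∂μ := fun u => by
    rw [show Bp u = _ from ContinuousLinearMap.lpPairing_eq_integral _ _ _]
    refine integral_congr_ae ?_
    filter_upwards [hh.coeFn_toLp] with x hx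
    rw [hx]; simp [mul_comm]
  have key : ∀ u : Lp ℂ p μ, Λ (A u) = Bp u := by
    refine Lp.induction hp _ ?_ ?_ ?_
    · intro c s hs hμs
      rw [Lp.simpleFunc.coe_indicatorConst]
      have e1 : A (indicatorConstLp p hs hμs.ne c) =
          c • indicatorConstLp p (hs.inter hG) (measure_ne_top μ _) (1 : ℂ) := by
        refine Lp.ext ?_
        filter_upwards [hA (indicatorConstLp p hs hμs.ne c),
          indicatorConstLp_coeFn (p := p) (hs := hs) (hμs := hμs.ne) (c := c),
          Lp.coeFn_smul c (indicatorConstLp p (hs.inter hG) (measure_ne_top μ _) (1 : ℂ)),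
          indicatorConstLp_coeFn (p := p) (hs := hs.inter hG) (hμs := measure_ne_top μ _)
            (c := (1 : ℂ))] with x h1 h2 h3 h4
        rw [h1, h3, Pi.smul_apply, h4]
        by_cases hxG : x ∈ G <;> by_cases hxs : x ∈ s <;> simp [hxG, hxs, h2]
      rw [e1, map_smul, hΛ, hB]
      have e2 : ∀ᵐ x ∂μ, indicatorConstLp p hs hμs.ne c x * G.indicator h x =
          (s ∩ G).indicator (fun x => c * h x) x := by
        filter_upwards [indicatorConstLp_coeFn (p := p) (hs := hs) (hμs := hμs.ne) (c := c)]
          with x h2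
        by_cases hxG : x ∈ G <;> by_cases hxs : x ∈ s <;> simp [hxG, hxs, h2]
      rw [integral_congr_ae e2, integral_indicator (hs.inter hG), integral_const_mul, smul_eq_mul]
    · intro f g hf hg _ h1 h2
      rw [map_add, map_add, map_add, h1, h2]
    · exact isClosed_eq (Λ.continuous.comp A.continuous) Bp.continuous
  have e : A (hf.toLp f) = (hf.indicator hG).toLp _ := by
    refine Lp.ext ?_
    filter_upwards [hA (hf.toLp f), hf.coeFn_toLp, (hf.indicator hG).coeFn_toLp] with x h1 h2 h3
    rw [h1, h3]
    by_cases hxG : x ∈ G <;> simp [hxG, h2]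
  rw [← e, key, hB]
  refine integral_congr_ae ?_
  filter_upwards [hf.coeFn_toLp] with x hx
  rw [hx]

/-- Riesz representation of the functionals on `Lᵖ` of a finite measure, `1 < p < ∞`. -/
theorem exists_memLp_forall_eq_integral_mul [IsFiniteMeasure μ] {p q : ℝ≥0∞} [p.HolderConjugate q]
    [Fact (1 ≤ p)] [Fact (1 ≤ q)] (hp : p ≠ ∞) (hq : q ≠ ∞) (Λ : StrongDual ℂ (Lp ℂ p μ)) :
    ∃ h : α → ℂ, MemLp h q μ ∧ ∀ f (hf : MemLp f p μ),
      Λ (hf.toLp f) = ∫ x, f x * h x ∂μ := by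
  obtain ⟨h₀, hi₀, hΛ₀⟩ := exists_integrable_forall_indicator hp Λ
  obtain ⟨h, hhm, hae⟩ := hi₀.1
  have hΛ : ∀ (s : Set α) (hs : MeasurableSet s),
      Λ (indicatorConstLp p hs (measure_ne_top μ s) 1) = ∫ x in s, h x ∂μ := fun s hs => by
    rw [hΛ₀ s hs]
    exact integral_congr_ae (ae_restrict_of_ae hae)
  -- On `G n` the density is bounded; the bound by `‖Λ‖` there passes to the limit by Fatou's lemma.
  let G : ℕ → Set α := fun n => {x | ‖h x‖ ≤ n}
  have hG : ∀ n, MeasurableSet (G n) := fun n =>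
    measurableSet_le hhm.measurable.norm measurable_const
  have hmem : ∀ n, MemLp ((G n).indicator h) q μ := fun n => by
    refine MemLp.of_bound (hhm.indicator (hG n)).aestronglyMeasurable n (ae_of_all _ fun x => ?_)
    by_cases hx : x ∈ G n
    · rw [Set.indicator_of_mem hx]
      exact hx
    · simp [hx]
  have hbd : ∀ n, (eLpNorm ((G n).indicator h) q μ).toReal ≤ ‖Λ‖ := fun n => by
    refine toReal_eLpNorm_le_of_forall_integral_mul_le (p := p) hp hq (hmem n) (norm_nonneg _)
      fun f hf => ?_
    rw [← apply_indicator_eq_integral hp Λ hΛ (hG n) (hmem n) hf]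
    refine (Λ.le_opNorm _).trans ?_
    rw [Lp.norm_toLp]
    gcongr
    · exact hf.2.ne
    · exact eLpNorm_indicator_le _
  have hmemh : MemLp h q μ := by
    refine ⟨hhm.aestronglyMeasurable, ?_⟩
    refine lt_of_le_of_lt (Lp.eLpNorm_lim_le_liminf_eLpNorm (f := fun n => (G n).indicator h)
      (fun n => (hmem n).1) h (ae_of_all _ fun x => ?_)) ?_
    · obtain ⟨N, hN⟩ := exists_nat_ge ‖h x‖
      refine tendsto_const_nhds.congr' ?_
      filter_upwards [eventually_ge_atTop N] with n hn
      have : x ∈ G n := hN.trans (by exact_mod_cast hn)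
      simp [this]
    · refine lt_of_le_of_lt (liminf_le_of_le (by isBoundedDefault) fun b hb => ?_)
        (ENNReal.ofReal_lt_top (r := ‖Λ‖))
      obtain ⟨n, hn⟩ := hb.exists
      exact hn.trans ((ENNReal.le_ofReal_iff_toReal_le (hmem n).2.ne (norm_nonneg _)).2 (hbd n))
  refine ⟨h, hmemh, fun f hf => ?_⟩
  have := apply_indicator_eq_integral hp Λ hΛ MeasurableSet.univ (by simpa using hmemh) hf
  simpa using this

end LpDuality

/-! ### Schur's test -/

section Schur

variable {α : Type*} {m : MeasurableSpace α} {μ : Measure α}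

/-- Schur's test for a symmetric nonnegative kernel, with weight `h`: the test function `h ^ p`
controls the exponent `p`, the test function `h ^ q` its conjugate. -/
theorem lintegral_rpow_lintegral_mul_le_of_schur [SFinite μ] {p q : ℝ} (hpq : p.HolderConjugate q)
    {k : α → α → ℝ≥0∞} (hk : Measurable (Function.uncurry k)) (hsymm : ∀ x y, k x y = k y x)
    {h : α → ℝ≥0∞} (hh : Measurable h) (h0 : ∀ᵐ x ∂μ, h x ≠ 0) (htop : ∀ᵐ x ∂μ, h x ≠ ∞)
    {A : ℝ≥0∞}
    (hq : ∀ᵐ x ∂μ, ∫⁻ y, k x y * h y ^ q ∂μ ≤ A * h x ^ q)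
    (hp : ∀ᵐ x ∂μ, ∫⁻ y, k x y * h y ^ p ∂μ ≤ A * h x ^ p)
    {f : α → ℝ≥0∞} (hf : AEMeasurable f μ) :
    ∫⁻ x, (∫⁻ y, k x y * f y ∂μ) ^ p ∂μ ≤ A ^ p * ∫⁻ x, f x ^ p ∂μ := by
  have hp0 : 0 < p := hpq.pos
  have hq0 : 0 < q := hpq.symm.pos
  have hkx : ∀ x, Measurable (k x) := fun x => hk.of_uncurry_left
  have hinv : 1 / q + 1 / p = 1 := by simpa [add_comm] using hpq.inv_add_inv_eq_one
  have hpqd : p / q = p - 1 := by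
    have := hpq.inv_add_inv_eq_one
    field_simp at this ⊢
    linarith
  -- Hölder's inequality for `k f = (k ^ (1 / q) h) (k ^ (1 / p) f h⁻¹)`.
  have step : ∀ᵐ x ∂μ, (∫⁻ y, k x y * f y ∂μ) ^ p ≤
      A ^ (p / q) * ∫⁻ y, h x ^ p * (k x y * (f y ^ p * (h y ^ p)⁻¹)) ∂μ := by
    filter_upwards [hq] with x hx
    have e1 : ∫⁻ y, k x y * f y ∂μ =
        ∫⁻ y, k x y ^ (1 / q) * h y * (k x y ^ (1 / p) * (f y * (h y)⁻¹)) ∂μ := by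
      refine lintegral_congr_ae ?_
      filter_upwards [h0, htop] with y hy0 hyt
      have : k x y = k x y ^ (1 / q) * k x y ^ (1 / p) := by
        rw [← ENNReal.rpow_add_of_nonneg _ _ (by positivity) (by positivity), hinv,
          ENNReal.rpow_one]
      calc k x y * f y = k x y ^ (1 / q) * k x y ^ (1 / p) * f y * (h y * (h y)⁻¹) := by
            rw [← this, ENNReal.mul_inv_cancel hy0 hyt, mul_one]
        _ = _ := by ring
    have hol := ENNReal.lintegral_mul_le_Lp_mul_Lq μ hpq.symm
      (f := fun y => k x y ^ (1 / q) * h y) (g := fun y => k x y ^ (1 / p) * (f y * (h y)⁻¹))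
      (((hkx x).pow_const _).mul hh).aemeasurable
      (((hkx x).pow_const _).aemeasurable.mul (hf.mul hh.inv.aemeasurable))
    have e2 : ∀ y, (k x y ^ (1 / q) * h y) ^ q = k x y * h y ^ q := fun y => by
      rw [ENNReal.mul_rpow_of_nonneg _ _ hq0.le, ← ENNReal.rpow_mul, one_div_mul_cancel hq0.ne',
        ENNReal.rpow_one]
    have e3 : ∀ y, (k x y ^ (1 / p) * (f y * (h y)⁻¹)) ^ p = k x y * (f y ^ p * (h y ^ p)⁻¹) :=
      fun y => by
      rw [ENNReal.mul_rpow_of_nonneg _ _ hp0.le, ← ENNReal.rpow_mul, one_div_mul_cancel hp0.ne',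
        ENNReal.rpow_one, ENNReal.mul_rpow_of_nonneg _ _ hp0.le, ENNReal.inv_rpow]
    simp only [Pi.mul_apply, e2, e3] at hol
    rw [e1]
    calc _ ≤ ((∫⁻ y, k x y * h y ^ q ∂μ) ^ (1 / q) *
          (∫⁻ y, k x y * (f y ^ p * (h y ^ p)⁻¹) ∂μ) ^ (1 / p)) ^ p := by
            gcongr
      _ ≤ ((A * h x ^ q) ^ (1 / q) *
          (∫⁻ y, k x y * (f y ^ p * (h y ^ p)⁻¹) ∂μ) ^ (1 / p)) ^ p := by gcongr
      _ = A ^ (p / q) * (h x ^ p * ∫⁻ y, (k x y * (f y ^ p * (h y ^ p)⁻¹)) ∂μ) := by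
          rw [ENNReal.mul_rpow_of_nonneg _ _ hp0.le, ← ENNReal.rpow_mul, ← ENNReal.rpow_mul,
            one_div_mul_cancel hp0.ne', ENNReal.rpow_one,
            ENNReal.mul_rpow_of_nonneg _ _ (by positivity), ← ENNReal.rpow_mul]
          rw [show 1 / q * p = p / q by ring, show q * (p / q) = p by field_simp, mul_assoc]
      _ = _ := by
          have hm : AEMeasurable (fun y => k x y * (f y ^ p * (h y ^ p)⁻¹)) μ :=
            (hkx x).aemeasurable.mul ((hf.pow_const _).mul (hh.pow_const _).inv.aemeasurable)
          rw [lintegral_const_mul'' _ hm]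
  calc ∫⁻ x, (∫⁻ y, k x y * f y ∂μ) ^ p ∂μ
      ≤ ∫⁻ x, A ^ (p / q) * ∫⁻ y, h x ^ p * (k x y * (f y ^ p * (h y ^ p)⁻¹)) ∂μ ∂μ :=
        lintegral_mono_ae step
    _ = A ^ (p / q) * ∫⁻ y, ∫⁻ x, h x ^ p * (k x y * (f y ^ p * (h y ^ p)⁻¹)) ∂μ ∂μ := by
        have hm : AEMeasurable (Function.uncurry fun x y =>
            h x ^ p * (k x y * (f y ^ p * (h y ^ p)⁻¹))) (μ.prod μ) := by
          refine ((hh.comp measurable_fst).pow_const _).aemeasurable.mul (hk.aemeasurable.mul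
            ((hf.comp_snd.pow_const _).mul ?_))
          exact ((hh.comp measurable_snd).pow_const _).inv.aemeasurable
        have hm' : AEMeasurable (fun x => ∫⁻ y, h x ^ p * (k x y * (f y ^ p * (h y ^ p)⁻¹)) ∂μ) μ :=
          hm.lintegral_prod_right'
        rw [lintegral_const_mul'' _ hm', lintegral_lintegral_swap hm]
    _ ≤ A ^ (p / q) * ∫⁻ y, A * f y ^ p ∂μ := by
        gcongr 1
        refine lintegral_mono_ae ?_
        filter_upwards [hp, h0, htop] with y hy hy0 hyt
        have e : ∀ x, h x ^ p * (k x y * (f y ^ p * (h y ^ p)⁻¹)) =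
            (f y ^ p * (h y ^ p)⁻¹) * (k y x * h x ^ p) := fun x => by
          rw [hsymm x y]; ring
        simp only [e]
        have hm : Measurable fun x => k y x * h x ^ p := (hkx y).mul (hh.pow_const _)
        rw [lintegral_const_mul _ hm]
        calc _ ≤ (f y ^ p * (h y ^ p)⁻¹) * (A * h y ^ p) := by gcongr
          _ = A * f y ^ p * (h y ^ p * (h y ^ p)⁻¹) := by ring
          _ = A * f y ^ p := by
            rw [ENNReal.mul_inv_cancel, mul_one]
            · exact (ENNReal.rpow_pos (pos_iff_ne_zero.2 hy0) hyt).ne'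
            · exact ENNReal.rpow_ne_top_of_nonneg hp0.le hyt
    _ = A ^ p * ∫⁻ x, f x ^ p ∂μ := by
        rw [lintegral_const_mul'' _ (hf.pow_const _), ← mul_assoc]
        congr 1
        nth_rewrite 2 [← ENNReal.rpow_one A]
        rw [← ENNReal.rpow_add_of_nonneg _ _ (by positivity) zero_le_one, hpqd]
        congr 1; ring

end Schur

/-! ### Parametric integrals over a compact set -/

section ParametricIntegral

open Filter Topology Metric

universe u

set_option linter.unusedSectionVars false

variable {𝕜 : Type*} [RCLike 𝕜] {E G : Type u} [NormedAddCommGroup E] [NormedSpace ℝ E]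
  [ProperSpace E] [NormedAddCommGroup G] [NormedSpace ℝ G] [NormedSpace 𝕜 G]
  [SMulCommClass ℝ 𝕜 G] {X : Type*} [NormedAddCommGroup X] [NormedSpace ℝ X]
  [MeasurableSpace X] [BorelSpace X]
  {μ : Measure X} {Ω : Set (E × X)} {U : Set E} {S : Set X} {k : E → X → G} {f : X → 𝕜}

theorem exists_ball_bound_of_continuousOn (hk : ContinuousOn (Function.uncurry k) Ω)
    (hU : IsOpen U) (hS : IsCompact S) (hUS : U ×ˢ S ⊆ Ω) {z : E} (hz : z ∈ U) :
    ∃ ε > 0, ball z ε ⊆ U ∧ ∃ C, ∀ w ∈ ball z ε, ∀ x ∈ S, ‖k w x‖ ≤ C := by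
  obtain ⟨ε, hε, hεU⟩ := nhds_basis_closedBall.mem_iff.1 (hU.mem_nhds hz)
  have hc : IsCompact (closedBall z ε ×ˢ S) := (isCompact_closedBall z ε).prod hS
  obtain ⟨C, hC⟩ := hc.exists_bound_of_continuousOn
    (hk.mono ((Set.prod_mono hεU subset_rfl).trans hUS))
  exact ⟨ε, hε, ball_subset_closedBall.trans hεU, C, fun w hw x hx =>
    hC (w, x) ⟨ball_subset_closedBall hw, hx⟩⟩

theorem aestronglyMeasurable_smul_section (hk : ContinuousOn (Function.uncurry k) Ω)
    (hS : IsCompact S) (hUS : U ×ˢ S ⊆ Ω) (hf : IntegrableOn f S μ) {z : E} (hz : z ∈ U) :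
    AEStronglyMeasurable (fun x => f x • k z x) (μ.restrict S) :=
  hf.1.smul ((hk.comp (f := fun x => (z, x)) (by fun_prop)
    fun _ hx => hUS ⟨hz, hx⟩ : ContinuousOn (k z) S).aestronglyMeasurable_of_isCompact hS
      hS.measurableSet)

theorem integrableOn_smul_section (hk : ContinuousOn (Function.uncurry k) Ω) (hU : IsOpen U)
    (hS : IsCompact S) (hUS : U ×ˢ S ⊆ Ω) (hf : IntegrableOn f S μ) {z : E} (hz : z ∈ U) :
    IntegrableOn (fun x => f x • k z x) S μ := by
  obtain ⟨ε, hε, -, C, hC⟩ := exists_ball_bound_of_continuousOn hk hU hS hUS hz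
  refine (hf.norm.mul_const C).mono' (aestronglyMeasurable_smul_section hk hS hUS hf hz) ?_
  filter_upwards [ae_restrict_mem hS.measurableSet] with x hx
  rw [norm_smul]
  gcongr
  exact hC z (mem_ball_self hε) x hx

theorem continuousOn_setIntegral_smul (hk : ContinuousOn (Function.uncurry k) Ω) (hU : IsOpen U)
    (hS : IsCompact S) (hUS : U ×ˢ S ⊆ Ω) (hf : IntegrableOn f S μ) (hΩ : IsOpen Ω) :
    ContinuousOn (fun z => ∫ x in S, f x • k z x ∂μ) U := by
  intro z hz
  refine ContinuousAt.continuousWithinAt ?_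
  obtain ⟨ε, hε, hεU, C, hC⟩ := exists_ball_bound_of_continuousOn hk hU hS hUS hz
  refine continuousAt_of_dominated (bound := fun x => ‖f x‖ * C) ?_ ?_ (hf.norm.mul_const C) ?_
  · filter_upwards [ball_mem_nhds z hε] with w hw
    exact aestronglyMeasurable_smul_section hk hS hUS hf (hεU hw)
  · filter_upwards [ball_mem_nhds z hε] with w hw
    filter_upwards [ae_restrict_mem hS.measurableSet] with x hx
    rw [norm_smul]
    gcongr
    exact hC w hw x hx
  · filter_upwards [ae_restrict_mem hS.measurableSet] with x hx
    have h1 : ContinuousAt (Function.uncurry k) (z, x) := hk.continuousAt (hΩ.mem_nhds (hUS ⟨hz, hx⟩))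
    have h2 : ContinuousAt (fun w => k w x) z := by
      have : ContinuousAt (fun w : E => (w, x)) z := by fun_prop
      exact ContinuousAt.comp (g := Function.uncurry k) (f := fun w : E => (w, x)) h1 this
    exact h2.const_smul _

theorem hasFDerivAt_section (hΩ : IsOpen Ω) (hk : ContDiffOn ℝ 1 (Function.uncurry k) Ω)
    {z : E} {x : X} (hzx : (z, x) ∈ Ω) :
    HasFDerivAt (fun w => k w x)
      ((fderiv ℝ (Function.uncurry k) (z, x)).comp (ContinuousLinearMap.inl ℝ E X)) z := by
  have h1 : DifferentiableAt ℝ (Function.uncurry k) (z, x) :=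
    (hk.differentiableOn one_ne_zero).differentiableAt (hΩ.mem_nhds hzx)
  have h2 : HasFDerivAt (fun w : E => (w, x)) (ContinuousLinearMap.inl ℝ E X) z :=
    hasFDerivAt_prodMk_left z x
  exact HasFDerivAt.comp (g := Function.uncurry k) (f := fun w : E => (w, x)) z h1.hasFDerivAt h2

theorem contDiffOn_fderiv_section {n m : WithTop ℕ∞} (hΩ : IsOpen Ω)
    (hk : ContDiffOn ℝ n (Function.uncurry k) Ω) (hmn : m + 1 ≤ n) :
    ContDiffOn ℝ m (Function.uncurry fun z x => fderiv ℝ (fun w => k w x) z) Ω := by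
  have h1 : ContDiffOn ℝ m (fun p => (fderiv ℝ (Function.uncurry k) p).comp
      (ContinuousLinearMap.inl ℝ E X)) Ω :=
    (hk.fderiv_of_isOpen hΩ hmn).clm_comp contDiffOn_const
  refine h1.congr fun p hp => ?_
  exact (hasFDerivAt_section hΩ (hk.of_le (le_trans (by simp) hmn)) hp).fderiv

/-- Differentiation under the integral sign, for a kernel of class `C¹` near `U × S` with `S`
compact. -/
theorem hasFDerivAt_setIntegral_smul (hΩ : IsOpen Ω) (hk : ContDiffOn ℝ 1 (Function.uncurry k) Ω)
    (hU : IsOpen U) (hS : IsCompact S) (hUS : U ×ˢ S ⊆ Ω) (hf : IntegrableOn f S μ)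
    {z : E} (hz : z ∈ U) :
    HasFDerivAt (fun z => ∫ x in S, f x • k z x ∂μ)
      (∫ x in S, f x • fderiv ℝ (fun w => k w x) z ∂μ) z := by
  have hk' : ContinuousOn (Function.uncurry fun z x => fderiv ℝ (fun w => k w x) z) Ω :=
    (contDiffOn_fderiv_section (m := 0) hΩ hk (by simp)).continuousOn
  obtain ⟨ε, hε, hεU, C, hC⟩ := exists_ball_bound_of_continuousOn hk' hU hS hUS hz
  refine hasFDerivAt_integral_of_dominated_of_fderiv_le (𝕜 := ℝ) (μ := μ.restrict S)
    (F := fun z x => f x • k z x) (F' := fun z x => f x • fderiv ℝ (fun w => k w x) z)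
    (bound := fun x => ‖f x‖ * C)
    (ball_mem_nhds z hε) ?_ (integrableOn_smul_section hk.continuousOn hU hS hUS hf hz)
    (aestronglyMeasurable_smul_section hk' hS hUS hf hz) ?_ (hf.norm.mul_const C) ?_
  · filter_upwards [ball_mem_nhds z hε] with w hw
    exact aestronglyMeasurable_smul_section hk.continuousOn hS hUS hf (hεU hw)
  · filter_upwards [ae_restrict_mem hS.measurableSet] with x hx w hw
    rw [norm_smul]
    gcongr
    exact hC w hw x hx
  · filter_upwards [ae_restrict_mem hS.measurableSet] with x hx w hw
    have := hasFDerivAt_section hΩ hk (hUS ⟨hεU hw, hx⟩)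
    exact (this.differentiableAt.hasFDerivAt).const_smul (f x)

/-- By induction on `n`, since the derivative of the integral is an integral of the same form with
values in the continuous linear maps. -/
theorem contDiffOn_setIntegral_smul (n : ℕ) (hΩ : IsOpen Ω)
    (hk : ContDiffOn ℝ n (Function.uncurry k) Ω)
    (hU : IsOpen U) (hS : IsCompact S) (hUS : U ×ˢ S ⊆ Ω) (hf : IntegrableOn f S μ) :
    ContDiffOn ℝ n (fun z => ∫ x in S, f x • k z x ∂μ) U := by
  induction n generalizing G with
  | zero =>
    simp only [Nat.cast_zero, contDiffOn_zero] at hk ⊢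
    exact continuousOn_setIntegral_smul hk hU hS hUS hf hΩ
  | succ n ih =>
    have hk1 : ContDiffOn ℝ 1 (Function.uncurry k) Ω := hk.of_le (by norm_cast; omega)
    have hd : ∀ z ∈ U, HasFDerivAt _ _ z := fun z hz =>
      hasFDerivAt_setIntegral_smul hΩ hk1 hU hS hUS hf hz
    rw [show ((n + 1 : ℕ) : WithTop ℕ∞) = n + 1 by norm_cast,
      contDiffOn_succ_iff_fderiv_of_isOpen hU]
    refine ⟨fun z hz => (hd z hz).differentiableAt.differentiableWithinAt, by simp, ?_⟩
    refine (ih (k := fun z x => fderiv ℝ (fun w => k w x) z)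
      (contDiffOn_fderiv_section hΩ hk (by norm_cast))).congr fun z hz => (hd z hz).fderiv

end ParametricIntegral

/-! ### The profile of the Cauchy kernel -/

section CauchyProfile

open Set

/-- The properties of a function `p` of two positive variables for which
`(1 - z * conj w)⁻¹ * p (|1 - z * conj w| ^ 2) (|1 - z * w| ^ 2)` is a Cauchy kernel for
`lam`-analytic functions: `euler` (homogeneity of degree `-lam`) and `swap` amount to the
`lam`-analyticity, the signs and the bounds serve to estimate the kernel. -/
structure IsCauchyProfile (lam : ℝ) (p : ℝ → ℝ → ℝ) : Prop where
  contDiffOn : ContDiffOn ℝ 3 (Function.uncurry p) (Ioi 0 ×ˢ Ioi 0)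
  one_one : p 1 1 = 1
  nonneg : ∀ x y, 0 < x → 0 < y → 0 ≤ p x y
  euler : ∀ x y, 0 < x → 0 < y →
    fderiv ℝ (Function.uncurry p) (x, y) (x, y) = -lam * p x y
  swap : ∀ x y, 0 < x → 0 < y →
    y * fderiv ℝ (Function.uncurry p) (x, y) (1, 1) = -lam * p y x
  fst_nonpos : ∀ x y, 0 < x → 0 < y → fderiv ℝ (Function.uncurry p) (x, y) (1, 0) ≤ 0
  snd_nonpos : ∀ x y, 0 < x → 0 < y → fderiv ℝ (Function.uncurry p) (x, y) (0, 1) ≤ 0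
  bound : ∃ C, 0 < C ∧ (∀ x y, 0 < x → x ≤ y → p x y * y ^ lam ≤ C) ∧
    ∀ x y, 0 < y → y ≤ x → p x y * x ^ lam ≤ C * √(x / y)

theorem isCauchyProfile_zero : IsCauchyProfile 0 fun _ _ => 1 := by
  have h : ∀ q : ℝ × ℝ, fderiv ℝ (Function.uncurry fun _ _ : ℝ => (1 : ℝ)) q = 0 := fun q =>
    fderiv_const_apply (1 : ℝ)
  refine ⟨contDiffOn_const (c := (1 : ℝ)), rfl, fun _ _ _ _ => zero_le_one, ?_, ?_, ?_, ?_,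
    1, one_pos, ?_, ?_⟩
  · simp [h]
  · simp [h]
  · simp [h]
  · simp [h]
  · simp
  · intro x y hy hyx
    simp only [Real.rpow_zero, mul_one, one_mul]
    rw [Real.one_le_sqrt, one_le_div hy]
    exact hyx

variable {lam : ℝ}

theorem intervalIntegrable_rpow_mul_rpow {a b : ℝ} (ha : 0 ≤ a) (hb : -1 < b) :
    IntervalIntegrable (fun u : ℝ => u ^ a * (1 - u) ^ b) volume 0 1 := by
  have h1 : IntervalIntegrable (fun u : ℝ => (1 - u) ^ b) volume 0 1 := by
    have := (intervalIntegral.intervalIntegrable_rpow' (a := 0) (b := 1) hb).comp_sub_left 1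
    simpa using this.symm
  exact h1.continuousOn_mul (Real.continuous_rpow_const ha).continuousOn

/-- The integrand `((1 - u) x + u y) ^ (-lam)`. -/
noncomputable def profileIntegrand (lam : ℝ) (q : ℝ × ℝ) (u : ℝ) : ℝ :=
  ((1 - u) * q.1 + u * q.2) ^ (-lam)

/-- The non-normalised profile `∫₀¹ u ^ lam (1 - u) ^ (lam - 1) ((1 - u) x + u y) ^ (-lam) du`. -/
noncomputable def profileIntegral (lam : ℝ) (q : ℝ × ℝ) : ℝ :=
  ∫ u in Icc (0 : ℝ) 1, (u ^ lam * (1 - u) ^ (lam - 1)) • profileIntegrand lam q u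

theorem isOpen_profileDomain : IsOpen {r : (ℝ × ℝ) × ℝ | 0 < (1 - r.2) * r.1.1 + r.2 * r.1.2} :=
  isOpen_lt continuous_const (by fun_prop)

theorem contDiffOn_profileIntegrand :
    ContDiffOn ℝ 3 (Function.uncurry (profileIntegrand lam))
      {r : (ℝ × ℝ) × ℝ | 0 < (1 - r.2) * r.1.1 + r.2 * r.1.2} := by
  intro r hr
  refine ContDiffAt.contDiffWithinAt ?_
  refine ContDiffAt.rpow_const_of_ne ?_ (ne_of_gt hr)
  fun_prop

theorem convexComb_pos {x y u : ℝ} (hx : 0 < x) (hy : 0 < y) (hu : u ∈ Icc (0 : ℝ) 1) :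
    0 < (1 - u) * x + u * y := by
  rcases hu.1.eq_or_lt with h | h
  · simp [← h, hx]
  · have := mul_pos h hy
    have := mul_nonneg (sub_nonneg.2 hu.2) hx.le
    linarith

theorem quadrant_prod_subset : (Ioi (0 : ℝ) ×ˢ Ioi (0 : ℝ)) ×ˢ Icc (0 : ℝ) 1 ⊆
    {r : (ℝ × ℝ) × ℝ | 0 < (1 - r.2) * r.1.1 + r.2 * r.1.2} := by
  rintro ⟨⟨x, y⟩, u⟩ ⟨⟨hx, hy⟩, hu⟩
  exact convexComb_pos hx hy hu

theorem integrableOn_betaWeight (hlam : 0 < lam) :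
    IntegrableOn (fun u : ℝ => u ^ lam * (1 - u) ^ (lam - 1)) (Icc 0 1) := by
  rw [integrableOn_Icc_iff_integrableOn_Ioc, ← intervalIntegrable_iff_integrableOn_Ioc_of_le zero_le_one]
  exact intervalIntegrable_rpow_mul_rpow hlam.le (by linarith)

theorem contDiffOn_profileIntegral (hlam : 0 < lam) :
    ContDiffOn ℝ 3 (profileIntegral lam) (Ioi 0 ×ˢ Ioi 0) :=
  contDiffOn_setIntegral_smul 3 isOpen_profileDomain contDiffOn_profileIntegrand
    (isOpen_Ioi.prod isOpen_Ioi) isCompact_Icc quadrant_prod_subset (integrableOn_betaWeight hlam)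

theorem fderiv_profileIntegrand {x y u : ℝ} (h : 0 < (1 - u) * x + u * y) (v : ℝ × ℝ) :
    fderiv ℝ (fun q => profileIntegrand lam q u) (x, y) v =
      -lam * ((1 - u) * x + u * y) ^ (-lam - 1) * ((1 - u) * v.1 + u * v.2) := by
  have h1 : HasFDerivAt (fun q : ℝ × ℝ => (1 - u) * q.1 + u * q.2)
      ((1 - u) • ContinuousLinearMap.fst ℝ ℝ ℝ + u • ContinuousLinearMap.snd ℝ ℝ ℝ) (x, y) :=
    (hasFDerivAt_fst.const_mul _).add (hasFDerivAt_snd.const_mul _)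
  have h2 := h1.rpow_const (p := -lam) (Or.inl h.ne')
  rw [show (fun q => profileIntegrand lam q u) = fun q : ℝ × ℝ =>
    ((1 - u) * q.1 + u * q.2) ^ (-lam) from rfl, h2.fderiv]
  simp only [smul_apply, add_apply, ContinuousLinearMap.coe_fst', ContinuousLinearMap.coe_snd',
    smul_eq_mul]

theorem integrableOn_fderiv_profileIntegrand (hlam : 0 < lam) {x y : ℝ} (hx : 0 < x) (hy : 0 < y) :
    IntegrableOn (fun u : ℝ => (u ^ lam * (1 - u) ^ (lam - 1)) •
      fderiv ℝ (fun q => profileIntegrand lam q u) (x, y)) (Icc 0 1) :=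
  integrableOn_smul_section (contDiffOn_fderiv_section (m := 0) isOpen_profileDomain
    contDiffOn_profileIntegrand (by simp)).continuousOn (isOpen_Ioi.prod isOpen_Ioi)
    isCompact_Icc quadrant_prod_subset (integrableOn_betaWeight hlam) ⟨hx, hy⟩

theorem fderiv_profileIntegral (hlam : 0 < lam) {x y : ℝ} (hx : 0 < x) (hy : 0 < y) (v : ℝ × ℝ) :
    fderiv ℝ (profileIntegral lam) (x, y) v = ∫ u in Icc (0 : ℝ) 1, u ^ lam * (1 - u) ^ (lam - 1) *
      (-lam * ((1 - u) * x + u * y) ^ (-lam - 1) * ((1 - u) * v.1 + u * v.2)) := by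
  have h := hasFDerivAt_setIntegral_smul (μ := volume) (k := profileIntegrand lam)
    (f := fun u : ℝ => u ^ lam * (1 - u) ^ (lam - 1)) isOpen_profileDomain
    (contDiffOn_profileIntegrand.of_le (by norm_num)) (isOpen_Ioi.prod isOpen_Ioi) isCompact_Icc
    quadrant_prod_subset (integrableOn_betaWeight hlam) (show (x, y) ∈ Ioi 0 ×ˢ Ioi 0 from ⟨hx, hy⟩)
  rw [show fderiv ℝ (profileIntegral lam) (x, y) = _ from h.fderiv,
    ContinuousLinearMap.integral_apply (integrableOn_fderiv_profileIntegrand hlam hx hy)]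
  refine setIntegral_congr_fun measurableSet_Icc fun u hu => ?_
  rw [smul_apply, fderiv_profileIntegrand (convexComb_pos hx hy hu), smul_eq_mul]

theorem integrableOn_profileIntegrand (hlam : 0 < lam) {x y : ℝ} (hx : 0 < x) (hy : 0 < y) :
    IntegrableOn (fun u : ℝ => u ^ lam * (1 - u) ^ (lam - 1) * profileIntegrand lam (x, y) u)
      (Icc 0 1) :=
  integrableOn_smul_section contDiffOn_profileIntegrand.continuousOn (isOpen_Ioi.prod isOpen_Ioi)
    isCompact_Icc quadrant_prod_subset (integrableOn_betaWeight hlam)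
    (show (x, y) ∈ Ioi 0 ×ˢ Ioi 0 from ⟨hx, hy⟩)

theorem profileIntegral_pos_one (hlam : 0 < lam) : 0 < profileIntegral lam (1, 1) := by
  have e : profileIntegral lam (1, 1) = ∫ u in (0 : ℝ)..1, u ^ lam * (1 - u) ^ (lam - 1) := by
    rw [intervalIntegral.integral_of_le zero_le_one, ← integral_Icc_eq_integral_Ioc, profileIntegral]
    simp [profileIntegrand]
  rw [e]
  refine intervalIntegral.intervalIntegral_pos_of_pos_on
    (intervalIntegrable_rpow_mul_rpow hlam.le (by linarith)) (fun u hu => ?_) zero_lt_one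
  have := sub_pos.2 hu.2
  have := hu.1
  positivity

/-- The two sides differ by the integral of the derivative of
`-lam⁻¹ (u (1 - u)) ^ lam ((1 - u) x + u y) ^ (-lam)`. -/
theorem swap_profileIntegral (hlam : 0 < lam) {x y : ℝ} (hx : 0 < x) (hy : 0 < y) :
    y * fderiv ℝ (profileIntegral lam) (x, y) (1, 1) = -lam * profileIntegral lam (y, x) := by
  set q : ℝ → ℝ := fun u => (1 - u) * x + u * y with hq
  have hqpos : ∀ u ∈ Icc (0 : ℝ) 1, 0 < q u := fun u hu => convexComb_pos hx hy hu
  set A : ℝ → ℝ := fun u => u ^ lam * (1 - u) ^ (lam - 1) * (q u ^ (-lam - 1) * y) with hA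
  set B : ℝ → ℝ := fun u => (1 - u) ^ lam * u ^ (lam - 1) * q u ^ (-lam) with hB
  have e1 : y * fderiv ℝ (profileIntegral lam) (x, y) (1, 1) = -lam * ∫ u in (0 : ℝ)..1, A u := by
    rw [fderiv_profileIntegral hlam hx hy, intervalIntegral.integral_of_le zero_le_one,
      ← integral_Icc_eq_integral_Ioc, ← integral_const_mul, ← integral_const_mul]
    refine setIntegral_congr_fun measurableSet_Icc fun u hu => ?_
    simp only [hA, hq]
    ring
  have e2 : profileIntegral lam (y, x) = ∫ u in (0 : ℝ)..1, B u := by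
    have h := intervalIntegral.integral_comp_sub_left (a := 0) (b := 1) B 1
    simp only [sub_self, sub_zero] at h
    rw [← h, profileIntegral, integral_Icc_eq_integral_Ioc,
      ← intervalIntegral.integral_of_le zero_le_one]
    refine intervalIntegral.integral_congr fun u hu => ?_
    simp only [hB, hq, profileIntegrand, smul_eq_mul]
    rw [show 1 - (1 - u) = u by ring, add_comm (u * x)]
  have hcont : ∀ a : ℝ, ContinuousOn (fun u => q u ^ a) (uIcc 0 1) := fun a => by
    rw [uIcc_of_le zero_le_one]
    refine ContinuousOn.rpow_const (by fun_prop) fun u hu => Or.inl (hqpos u hu).ne'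
  have iA : IntervalIntegrable A volume 0 1 :=
    (intervalIntegrable_rpow_mul_rpow hlam.le (by linarith)).mul_continuousOn
      ((hcont _).mul continuousOn_const)
  have iB : IntervalIntegrable B volume 0 1 := by
    refine IntervalIntegrable.mul_continuousOn ?_ (hcont _)
    have := (intervalIntegrable_rpow_mul_rpow hlam.le (b := lam - 1) (by linarith)).comp_sub_left 1
    simpa using this.symm
  have hftc := intervalIntegral.integral_eq_sub_of_hasDerivAt_of_le (a := 0) (b := 1) zero_le_one
    (f := fun u => (-lam⁻¹) * ((u * (1 - u)) ^ lam * q u ^ (-lam))) (f' := fun u => A u - B u)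
    ?_ ?_ (iA.sub iB)
  · rw [intervalIntegral.integral_sub iA iB] at hftc
    simp only [sub_self, mul_zero, zero_mul, Real.zero_rpow hlam.ne'] at hftc
    rw [e1, e2, sub_eq_zero.1 hftc]
  · refine continuousOn_const.mul (ContinuousOn.mul ?_ ?_)
    · exact ContinuousOn.rpow_const (by fun_prop) fun u _ => Or.inr hlam.le
    · simpa [uIcc_of_le] using hcont (-lam)
  · intro u hu
    have hu0 : 0 < u := hu.1
    have hu1 : 0 < 1 - u := sub_pos.2 hu.2
    have hqu := hqpos u ⟨hu.1.le, hu.2.le⟩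
    have d1 : HasDerivAt (fun u : ℝ => u * (1 - u)) (1 * (1 - u) + u * (-1)) u :=
      (hasDerivAt_id u).mul ((hasDerivAt_id u).const_sub 1)
    have d2 : HasDerivAt q (-1 * x + 1 * y) u :=
      (((hasDerivAt_id u).const_sub 1).mul_const x).add ((hasDerivAt_id u).mul_const y)
    have d := ((d1.rpow_const (p := lam) (Or.inl (by positivity))).mul
      (d2.rpow_const (p := -lam) (Or.inl hqu.ne'))).const_mul (-lam⁻¹)
    refine d.congr_deriv ?_
    have r1 : (u * (1 - u)) ^ lam = (u * (1 - u)) ^ (lam - 1) * (u * (1 - u)) := by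
      rw [← Real.rpow_add_one (by positivity)]; norm_num
    have r2 : q u ^ (-lam) = q u ^ (-lam - 1) * q u := by
      rw [← Real.rpow_add_one hqu.ne']; norm_num
    have r3 : u ^ lam = u ^ (lam - 1) * u := by
      rw [← Real.rpow_add_one hu0.ne']; norm_num
    have r4 : (1 - u) ^ lam = (1 - u) ^ (lam - 1) * (1 - u) := by
      rw [← Real.rpow_add_one hu1.ne']; norm_num
    simp only [hA, hB]
    rw [r1, r2, r3, r4, Real.mul_rpow hu0.le hu1.le]
    field_simp
    simp only [hq]
    ring

theorem profileIntegral_le (hlam : 0 < lam) {x y M a b : ℝ} (hx : 0 < x) (hy : 0 < y)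
    (ha : 0 ≤ a) (hb : -1 < b) (h : ∀ u ∈ Ioo (0 : ℝ) 1,
      u ^ lam * (1 - u) ^ (lam - 1) * ((1 - u) * x + u * y) ^ (-lam) ≤
        M * (u ^ a * (1 - u) ^ b)) :
    profileIntegral lam (x, y) ≤ M * ∫ u in Ioo (0 : ℝ) 1, u ^ a * (1 - u) ^ b := by
  have i1 := integrableOn_profileIntegrand hlam hx hy
  have i2 := intervalIntegrable_rpow_mul_rpow ha hb
  rw [intervalIntegrable_iff_integrableOn_Ioo_of_le zero_le_one] at i2
  rw [profileIntegral, integral_Icc_eq_integral_Ioo, ← integral_const_mul]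
  exact setIntegral_mono_on (i1.mono_set Ioo_subset_Icc_self) (i2.const_mul M) measurableSet_Ioo h

theorem exists_isCauchyProfile_of_pos (hlam : 0 < lam) : ∃ p, IsCauchyProfile lam p := by
  set c := (profileIntegral lam (1, 1))⁻¹ with hc
  have hc0 : 0 < c := inv_pos.2 (profileIntegral_pos_one hlam)
  set p : ℝ → ℝ → ℝ := fun x y => c * profileIntegral lam (x, y) with hp
  have hunc : Function.uncurry p = fun q => c * profileIntegral lam q := rfl
  have hd : ∀ x y, 0 < x → 0 < y → ∀ v, fderiv ℝ (Function.uncurry p) (x, y) v =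
      c * fderiv ℝ (profileIntegral lam) (x, y) v := fun x y hx hy v => by
    have : DifferentiableAt ℝ (profileIntegral lam) (x, y) :=
      ((contDiffOn_profileIntegral hlam).differentiableOn (by norm_num)).differentiableAt
        ((isOpen_Ioi.prod isOpen_Ioi).mem_nhds ⟨hx, hy⟩)
    rw [hunc, fderiv_const_mul this]
    rfl
  have hsign : ∀ x y, 0 < x → 0 < y → ∀ v : ℝ × ℝ, 0 ≤ v.1 → 0 ≤ v.2 →
      fderiv ℝ (Function.uncurry p) (x, y) v ≤ 0 := fun x y hx hy v h1 h2 => by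
    rw [hd x y hx hy, fderiv_profileIntegral hlam hx hy]
    refine mul_nonpos_of_nonneg_of_nonpos hc0.le
      (setIntegral_nonpos measurableSet_Icc fun u hu => ?_)
    have := convexComb_pos hx hy hu
    have := hu.1
    have := sub_nonneg.2 hu.2
    have h3 : 0 ≤ u ^ lam * (1 - u) ^ (lam - 1) * (lam * ((1 - u) * x + u * y) ^ (-lam - 1) *
      ((1 - u) * v.1 + u * v.2)) := by positivity
    linarith
  refine ⟨p, contDiffOn_const.mul (contDiffOn_profileIntegral hlam),
    inv_mul_cancel₀ (profileIntegral_pos_one hlam).ne', ?_, ?_, ?_, ?_, ?_, ?_⟩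
  · intro x y hx hy
    refine mul_nonneg hc0.le (setIntegral_nonneg measurableSet_Icc fun u hu => ?_)
    have h1 := convexComb_pos hx hy hu
    have := hu.1
    have := sub_nonneg.2 hu.2
    simp only [profileIntegrand, smul_eq_mul]
    positivity
  · intro x y hx hy
    simp only [hp]
    rw [hd x y hx hy, fderiv_profileIntegral hlam hx hy, profileIntegral, mul_left_comm,
      ← integral_const_mul (-lam)]
    congr 1
    refine setIntegral_congr_fun measurableSet_Icc fun u hu => ?_
    have h1 := convexComb_pos hx hy hu
    have r2 : ((1 - u) * x + u * y) ^ (-lam) =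
        ((1 - u) * x + u * y) ^ (-lam - 1) * ((1 - u) * x + u * y) := by
      rw [← Real.rpow_add_one h1.ne']; norm_num
    simp only [profileIntegrand, smul_eq_mul]
    rw [r2]
    ring
  · intro x y hx hy
    rw [hd x y hx hy, mul_left_comm, swap_profileIntegral hlam hx hy, hp]
    ring
  · exact fun x y hx hy => hsign x y hx hy _ zero_le_one le_rfl
  · exact fun x y hx hy => hsign x y hx hy _ le_rfl zero_le_one
  -- For `x ≤ y` the convex combination is at least `u y`. For `y ≤ x` it is at least `(1 - u) x`
  -- and at least `y`; splitting off a small power `ε` for the second bound keeps `(1 - u) ^ (ε - 1)`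
  -- integrable.
  · set ε := min lam (1 / 2) with hε
    have hε0 : 0 < ε := lt_min hlam (by norm_num)
    have hεl : ε ≤ lam := min_le_left _ _
    have hε2 : ε ≤ 1 / 2 := min_le_right _ _
    set I₁ := ∫ u in Ioo (0 : ℝ) 1, u ^ (0 : ℝ) * (1 - u) ^ (lam - 1)
    set I₂ := ∫ u in Ioo (0 : ℝ) 1, u ^ lam * (1 - u) ^ (ε - 1)
    have hI₁ : 0 ≤ I₁ := setIntegral_nonneg measurableSet_Ioo fun u hu => by
      have := sub_pos.2 hu.2
      have := hu.1
      positivity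
    have hI₂ : 0 ≤ I₂ := setIntegral_nonneg measurableSet_Ioo fun u hu => by
      have := sub_pos.2 hu.2
      have := hu.1
      positivity
    refine ⟨c * (I₁ + I₂) + 1, by positivity, ?_, ?_⟩
    · intro x y hx hxy
      have hy := hx.trans_le hxy
      have h := profileIntegral_le hlam hx hy (M := y ^ (-lam)) le_rfl (b := lam - 1) (by linarith)
        fun u hu => by
          have hu0 := hu.1
          have hu1 := sub_pos.2 hu.2
          have : ((1 - u) * x + u * y) ^ (-lam) ≤ (u * y) ^ (-lam) :=
            Real.rpow_le_rpow_of_nonpos (by positivity)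
              (by have := mul_pos hu1 hx; linarith) (by linarith)
          calc _ ≤ u ^ lam * (1 - u) ^ (lam - 1) * (u * y) ^ (-lam) := by gcongr
            _ = y ^ (-lam) * (u ^ lam * u ^ (-lam) * (1 - u) ^ (lam - 1)) := by
              rw [Real.mul_rpow hu0.le hy.le]; ring
            _ = _ := by rw [← Real.rpow_add hu0, add_neg_cancel]
      calc p x y * y ^ lam ≤ c * (y ^ (-lam) * I₁) * y ^ lam := by
            simp only [hp]; gcongr
        _ = c * I₁ * (y ^ (-lam) * y ^ lam) := by ring
        _ = c * I₁ := by rw [← Real.rpow_add hy]; simp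
        _ ≤ _ := by nlinarith
    · intro x y hy hyx
      have hx := hy.trans_le hyx
      have h := profileIntegral_le hlam hx hy (M := x ^ (-(lam - ε)) * y ^ (-ε)) hlam.le
        (b := ε - 1) (by linarith) fun u hu => by
          have hu0 := hu.1
          have hu1 := sub_pos.2 hu.2
          have hq := convexComb_pos hx hy ⟨hu.1.le, hu.2.le⟩
          have h1 : ((1 - u) * x + u * y) ^ (-(lam - ε)) ≤ ((1 - u) * x) ^ (-(lam - ε)) :=
            Real.rpow_le_rpow_of_nonpos (by positivity)
              (by have := mul_pos hu0 hy; linarith) (by linarith)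
          have h2 : ((1 - u) * x + u * y) ^ (-ε) ≤ y ^ (-ε) :=
            Real.rpow_le_rpow_of_nonpos (by positivity) (by nlinarith) (by linarith)
          calc _ = u ^ lam * (1 - u) ^ (lam - 1) * (((1 - u) * x + u * y) ^ (-(lam - ε)) *
                ((1 - u) * x + u * y) ^ (-ε)) := by
                rw [← Real.rpow_add hq]; congr 2; ring
            _ ≤ u ^ lam * (1 - u) ^ (lam - 1) * (((1 - u) * x) ^ (-(lam - ε)) * y ^ (-ε)) := by
                gcongr
            _ = x ^ (-(lam - ε)) * y ^ (-ε) *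
                (u ^ lam * ((1 - u) ^ (lam - 1) * (1 - u) ^ (-(lam - ε)))) := by
              rw [Real.mul_rpow hu1.le hx.le]; ring
            _ = _ := by rw [← Real.rpow_add hu1]; congr 3; ring
      have h3 : x ^ (-(lam - ε)) * y ^ (-ε) * x ^ lam = (x / y) ^ ε := by
        rw [Real.div_rpow hx.le hy.le, Real.rpow_neg hy.le, mul_right_comm, ← Real.rpow_add hx,
          div_eq_mul_inv]
        congr 2; ring
      have h4 : (x / y) ^ ε ≤ √(x / y) := by
        rw [Real.sqrt_eq_rpow]
        exact Real.rpow_le_rpow_of_exponent_le ((one_le_div hy).2 hyx) hε2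
      calc p x y * x ^ lam ≤ c * (x ^ (-(lam - ε)) * y ^ (-ε) * I₂) * x ^ lam := by
            simp only [hp]; gcongr
        _ = c * I₂ * (x ^ (-(lam - ε)) * y ^ (-ε) * x ^ lam) := by ring
        _ = c * I₂ * (x / y) ^ ε := by rw [h3]
        _ ≤ c * I₂ * √(x / y) := by gcongr
        _ ≤ _ := by gcongr; nlinarith

theorem exists_isCauchyProfile (hlam : 0 ≤ lam) : ∃ p, IsCauchyProfile lam p := by
  rcases hlam.eq_or_lt with rfl | h
  · exact ⟨_, isCauchyProfile_zero⟩
  · exact exists_isCauchyProfile_of_pos h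

end CauchyProfile

/-! ### The Cauchy and Bergman kernels -/

section CauchyKernel

open Set Filter Topology

variable {lam : ℝ} {p : ℝ → ℝ → ℝ}

/-- For a function of class `C¹` the operator `D_{z̄}` is continuous up to the real axis along
vertical lines, so that it suffices to check `D_{z̄} f = 0` off the real axis. -/
theorem isLambdaAnalytic_of_im_ne_zero {f : ℂ → ℂ} (hf : ContDiffOn ℝ 2 f (Metric.ball 0 1))
    (h : ∀ z ∈ Metric.ball (0 : ℂ) 1, z.im ≠ 0 → dunklBar lam f z = 0) :
    IsLambdaAnalytic lam f := by
  refine ⟨hf, fun z hz => ?_⟩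
  by_cases hz0 : z.im = 0
  swap
  · exact h z hz hz0
  have hnhds : Metric.ball (0 : ℂ) 1 ∈ 𝓝 z := Metric.isOpen_ball.mem_nhds hz
  have hγ : Tendsto (fun y : ℝ => z + y * Complex.I) (𝓝[≠] 0) (𝓝 z) := by
    have : Tendsto (fun y : ℝ => z + y * Complex.I) (𝓝 0) (𝓝 (z + (0 : ℝ) * Complex.I)) :=
      Continuous.tendsto (by fun_prop) 0
    simp only [Complex.ofReal_zero, zero_mul, add_zero] at this
    exact this.mono_left nhdsWithin_le_nhds
  have hfd : ContinuousAt (fderiv ℝ f) z :=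
    (hf.continuousOn_fderiv_of_isOpen Metric.isOpen_ball (by norm_num)).continuousAt hnhds
  have hW : Tendsto (fun y : ℝ => wirtingerBar f (z + y * Complex.I)) (𝓝[≠] 0)
      (𝓝 (wirtingerBar f z)) := by
    have : ContinuousAt (wirtingerBar f) z := by
      unfold wirtingerBar
      exact ((hfd.clm_apply continuousAt_const).add
        (continuousAt_const.mul (hfd.clm_apply continuousAt_const))).div_const 2
    exact this.tendsto.comp hγ
  have hQ : Tendsto (fun y : ℝ => reflectionQuotient f (z + y * Complex.I)) (𝓝[≠] 0)
      (𝓝 (reflectionQuotient f z)) := by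
    have hs : HasStrictFDerivAt f (fderiv ℝ f z) z :=
      (hf.contDiffAt hnhds).hasStrictFDerivAt (by norm_num)
    have hγ' : Tendsto (fun y : ℝ => z - y * Complex.I) (𝓝[≠] 0) (𝓝 z) := by
      have : Tendsto (fun y : ℝ => z - y * Complex.I) (𝓝 0) (𝓝 (z - (0 : ℝ) * Complex.I)) :=
        Continuous.tendsto (by fun_prop) 0
      simp only [Complex.ofReal_zero, zero_mul, sub_zero] at this
      exact this.mono_left nhdsWithin_le_nhds
    have ho := hs.isLittleO.comp_tendsto (hγ.prodMk_nhds hγ')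
    rw [reflectionQuotient, if_pos hz0]
    have hconj : conj z = z := Complex.conj_eq_iff_im.2 hz0
    rw [tendsto_iff_norm_sub_tendsto_zero]
    have ho' := ho.tendsto_div_nhds_zero.norm
    rw [norm_zero] at ho'
    refine ho'.congr' ?_
    filter_upwards [self_mem_nhdsWithin] with y hy
    have hy0 : (y : ℂ) ≠ 0 := by simpa using hy
    have him : (z + y * Complex.I).im ≠ 0 := by simpa [hz0] using hy
    rw [reflectionQuotient, if_neg him]
    have e1 : conj (z + y * Complex.I) = z - y * Complex.I := by
      simp [hconj, sub_eq_add_neg]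
    have e2 : z + y * Complex.I - (z - y * Complex.I) = ((2 * y : ℝ) : ℂ) * Complex.I := by
      push_cast; ring
    have e3 : fderiv ℝ f z (((2 * y : ℝ) : ℂ) * Complex.I) = 2 * y * fderiv ℝ f z Complex.I := by
      rw [← Complex.real_smul, map_smul, Complex.real_smul]; push_cast; ring
    simp only [Function.comp_apply]
    rw [e1, e2, e3]
    congr 1
    push_cast
    field_simp
    ring_nf
    simp only [Complex.I_sq]
    ring
  have hD : Tendsto (fun y : ℝ => dunklBar lam f (z + y * Complex.I)) (𝓝[≠] 0)
      (𝓝 (dunklBar lam f z)) := hW.sub (hQ.const_mul _)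
  refine tendsto_nhds_unique hD (tendsto_const_nhds.congr' ?_)
  filter_upwards [hγ hnhds, self_mem_nhdsWithin] with y hy hy0
  exact (h _ hy (by simpa [hz0] using hy0)).symm

/-- The Cauchy kernel for `lam`-analytic functions attached to a profile. -/
noncomputable def cauchyKer (p : ℝ → ℝ → ℝ) (z w : ℂ) : ℂ :=
  (1 - z * conj w)⁻¹ * (p (‖1 - z * conj w‖ ^ 2) (‖1 - z * w‖ ^ 2) : ℂ)

theorem conj_cauchyKer (z w : ℂ) : conj (cauchyKer p z w) = cauchyKer p w z := by
  have e1 : ‖1 - w * conj z‖ = ‖1 - z * conj w‖ := by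
    rw [← RCLike.norm_conj (1 - w * conj z)]
    simp [mul_comm]
  rw [cauchyKer, cauchyKer, e1, mul_comm w z]
  simp [mul_comm]

theorem cauchyKer_real_mul (s : ℝ) (z w : ℂ) : cauchyKer p (s * z) w = cauchyKer p z (s * w) := by
  simp only [cauchyKer, map_mul, Complex.conj_ofReal]
  rw [show (s : ℂ) * z * conj w = z * (s * conj w) by ring,
    show (s : ℂ) * z * w = z * (s * w) by ring]

theorem isOpen_kernelDomain : IsOpen {q : ℂ × ℂ | ‖q.1‖ * ‖q.2‖ < 1} :=
  isOpen_lt (by fun_prop) continuous_const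

theorem norm_one_sub_pos {a : ℂ} (ha : ‖a‖ < 1) : 0 < ‖1 - a‖ := by
  refine norm_pos_iff.2 fun h => ?_
  rw [← sub_eq_zero.1 h] at ha
  simp at ha

theorem norm_one_sub_mul_conj_pos {z w : ℂ} (h : ‖z‖ * ‖w‖ < 1) : 0 < ‖1 - z * conj w‖ :=
  norm_one_sub_pos (by simpa using h)

theorem norm_one_sub_mul_pos {z w : ℂ} (h : ‖z‖ * ‖w‖ < 1) : 0 < ‖1 - z * w‖ :=
  norm_one_sub_pos (by simpa using h)

theorem IsCauchyProfile.contDiffOn_cauchyKer (hp : IsCauchyProfile lam p) :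
    ContDiffOn ℝ 3 (Function.uncurry (cauchyKer p)) {q : ℂ × ℂ | ‖q.1‖ * ‖q.2‖ < 1} := by
  have hconj : ContDiff ℝ 3 (fun q : ℂ × ℂ => conj q.2) :=
    Complex.conjCLE.contDiff.comp contDiff_snd
  have h1 : ContDiff ℝ 3 (fun q : ℂ × ℂ => 1 - q.1 * conj q.2) :=
    contDiff_const.sub (contDiff_fst.mul hconj)
  have h2 : ContDiff ℝ 3 (fun q : ℂ × ℂ => 1 - q.1 * q.2) :=
    contDiff_const.sub (contDiff_fst.mul contDiff_snd)
  refine ContDiffOn.mul (h1.contDiffOn.inv fun q hq => ?_)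
    (Complex.ofRealCLM.contDiff.comp_contDiffOn ?_)
  · exact norm_pos_iff.1 (norm_one_sub_mul_conj_pos hq)
  · exact hp.contDiffOn.comp (t := Ioi 0 ×ˢ Ioi 0)
      (f := fun q : ℂ × ℂ => (‖1 - q.1 * conj q.2‖ ^ 2, ‖1 - q.1 * q.2‖ ^ 2))
      ((h1.norm_sq ℝ).prodMk (h2.norm_sq ℝ)).contDiffOn fun q hq =>
        ⟨pow_pos (norm_one_sub_mul_conj_pos hq) 2, pow_pos (norm_one_sub_mul_pos hq) 2⟩

theorem IsCauchyProfile.fderiv_cauchyKer (hp : IsCauchyProfile lam p) {z w : ℂ}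
    (h : ‖z‖ * ‖w‖ < 1) (v : ℂ) :
    fderiv ℝ (fun z => cauchyKer p z w) z v =
      conj w * v * (1 - z * conj w)⁻¹ ^ 2 *
        (p (‖1 - z * conj w‖ ^ 2) (‖1 - z * w‖ ^ 2) : ℂ) -
      2 * (1 - z * conj w)⁻¹ *
        ((fderiv ℝ (Function.uncurry p) (‖1 - z * conj w‖ ^ 2, ‖1 - z * w‖ ^ 2) (1, 0) *
            (conj (1 - z * conj w) * (conj w * v)).re +
          fderiv ℝ (Function.uncurry p) (‖1 - z * conj w‖ ^ 2, ‖1 - z * w‖ ^ 2) (0, 1) *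
            (conj (1 - z * w) * (w * v)).re : ℝ) : ℂ) := by
  have ha := norm_one_sub_mul_conj_pos h
  have hb := norm_one_sub_mul_pos h
  have lin : ∀ c : ℂ, HasFDerivAt (fun z : ℂ => 1 - z * c)
      (-(ContinuousLinearMap.mul ℝ ℂ c)) z := fun c => by
    have := ((ContinuousLinearMap.mul ℝ ℂ c).hasFDerivAt (x := z)).const_sub 1
    refine this.congr_of_eventuallyEq (Eventually.of_forall fun z => ?_)
    simp [mul_comm]
  have hinv : HasFDerivAt (fun z : ℂ => (1 - z * conj w)⁻¹)
      ((ContinuousLinearMap.mul ℝ ℂ (-((1 - z * conj w) ^ 2)⁻¹)).comp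
        (-(ContinuousLinearMap.mul ℝ ℂ (conj w)))) z := by
    have h0 : HasFDerivAt (fun a : ℂ => a⁻¹)
        (ContinuousLinearMap.mul ℝ ℂ (-((1 - z * conj w) ^ 2)⁻¹)) (1 - z * conj w) := by
      have := ((hasDerivAt_inv (norm_pos_iff.1 ha)).hasFDerivAt).restrictScalars ℝ
      refine this.congr_fderiv ?_
      ext v; simp [mul_comm]
    exact HasFDerivAt.comp (g := fun a : ℂ => a⁻¹) (f := fun z : ℂ => 1 - z * conj w) z h0
      (lin (conj w))
  have hP : HasFDerivAt (Function.uncurry p)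
      (fderiv ℝ (Function.uncurry p) (‖1 - z * conj w‖ ^ 2, ‖1 - z * w‖ ^ 2))
      (‖1 - z * conj w‖ ^ 2, ‖1 - z * w‖ ^ 2) :=
    ((hp.contDiffOn.differentiableOn (by norm_num)).differentiableAt
      ((isOpen_Ioi.prod isOpen_Ioi).mem_nhds (show (_, _) ∈ Ioi (0 : ℝ) ×ˢ Ioi (0 : ℝ) from
        ⟨pow_pos ha 2, pow_pos hb 2⟩))).hasFDerivAt
  have hP' := hP.comp z ((lin (conj w)).norm_sq.prodMk (lin w).norm_sq)
  have hC := hinv.mul ((Complex.ofRealCLM.hasFDerivAt).comp z hP')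
  rw [show (fun z => cauchyKer p z w) = fun z => (1 - z * conj w)⁻¹ *
    (p (‖1 - z * conj w‖ ^ 2) (‖1 - z * w‖ ^ 2) : ℂ) from rfl]
  rw [show fderiv ℝ (fun z => (1 - z * conj w)⁻¹ *
    (p (‖1 - z * conj w‖ ^ 2) (‖1 - z * w‖ ^ 2) : ℂ)) z = _ from hC.fderiv]
  set D := fderiv ℝ (Function.uncurry p) (‖1 - z * conj w‖ ^ 2, ‖1 - z * w‖ ^ 2)
  have hD : ∀ s t : ℝ, D (s, t) = D (1, 0) * s + D (0, 1) * t := fun s t => by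
    have : ((s, t) : ℝ × ℝ) = s • (1, 0) + t • (0, 1) := by simp
    rw [this, map_add, map_smul, map_smul, smul_eq_mul, smul_eq_mul]
    ring
  set px := D (1, 0)
  set py := D (0, 1)
  simp only [add_apply, smul_apply, ContinuousLinearMap.comp_apply, ContinuousLinearMap.prod_apply,
    neg_apply, ContinuousLinearMap.mul_apply', innerSL_apply_apply, Complex.inner,
    smul_eq_mul, Complex.ofRealCLM_apply, hD, Function.comp_apply, Function.uncurry_apply_pair]
  simp only [neg_mul, Complex.neg_re, nsmul_eq_mul, ← inv_pow,
    mul_comm (conj w * v) (conj (1 - z * conj w)), mul_comm (w * v) (conj (1 - z * w))]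
  push_cast
  ring

/-- With `a = 1 - z w̄`, `b = 1 - z w`, the equation `D_{z̄} C = 0` reduces, by
`w (z - z̄) = ā - b` and `w̄ (z - z̄) = b̄ - a`, to the identities `euler` and `swap`. -/
theorem IsCauchyProfile.isLambdaAnalytic_cauchyKer (hp : IsCauchyProfile lam p) {w : ℂ}
    (hw : ‖w‖ ≤ 1) : IsLambdaAnalytic lam (fun z => cauchyKer p z w) := by
  have hdom : ∀ z ∈ Metric.ball (0 : ℂ) 1, ‖z‖ * ‖w‖ < 1 := fun z hz => by
    rw [mem_ball_zero_iff] at hz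
    exact lt_of_le_of_lt (mul_le_of_le_one_right (norm_nonneg _) hw) hz
  refine isLambdaAnalytic_of_im_ne_zero ?_ fun z hz hz0 => ?_
  · have h := (hp.contDiffOn_cauchyKer.of_le (m := 2) (by norm_num)).comp
      (f := fun z : ℂ => (z, w)) (s := Metric.ball 0 1) (by fun_prop) hdom
    exact h
  have h := hdom z hz
  have hapos := norm_one_sub_mul_conj_pos h
  have hbpos := norm_one_sub_mul_pos h
  have hE := hp.euler _ _ (pow_pos hapos 2) (pow_pos hbpos 2)
  have hS := hp.swap _ _ (pow_pos hapos 2) (pow_pos hbpos 2)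
  rw [dunklBar, wirtingerBar, reflectionQuotient, if_neg hz0, hp.fderiv_cauchyKer h,
    hp.fderiv_cauchyKer h, cauchyKer, cauchyKer]
  have e1 : ‖1 - conj z * conj w‖ = ‖1 - z * w‖ := by
    rw [← RCLike.norm_conj (1 - z * w)]; simp
  have e2 : ‖1 - conj z * w‖ = ‖1 - z * conj w‖ := by
    rw [← RCLike.norm_conj (1 - z * conj w)]; simp
  have hD : ∀ s t : ℝ, fderiv ℝ (Function.uncurry p) (‖1 - z * conj w‖ ^ 2, ‖1 - z * w‖ ^ 2) (s, t) =
      fderiv ℝ (Function.uncurry p) (‖1 - z * conj w‖ ^ 2, ‖1 - z * w‖ ^ 2) (1, 0) * s +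
      fderiv ℝ (Function.uncurry p) (‖1 - z * conj w‖ ^ 2, ‖1 - z * w‖ ^ 2) (0, 1) * t := by
    intro s t
    have : ((s, t) : ℝ × ℝ) = s • (1, 0) + t • (0, 1) := by simp
    rw [this, map_add, map_smul, map_smul, smul_eq_mul, smul_eq_mul]
    ring
  rw [e1, e2]
  rw [hD] at hE hS
  set px := fderiv ℝ (Function.uncurry p) (‖1 - z * conj w‖ ^ 2, ‖1 - z * w‖ ^ 2) (1, 0)
  set py := fderiv ℝ (Function.uncurry p) (‖1 - z * conj w‖ ^ 2, ‖1 - z * w‖ ^ 2) (0, 1)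
  set P := p (‖1 - z * conj w‖ ^ 2) (‖1 - z * w‖ ^ 2)
  set P' := p (‖1 - z * w‖ ^ 2) (‖1 - z * conj w‖ ^ 2)
  have hx : ((‖1 - z * conj w‖ ^ 2 : ℝ) : ℂ) = (1 - z * conj w) * (1 - conj z * w) := by
    rw [← Complex.normSq_eq_norm_sq, ← Complex.mul_conj]; simp
  have hy : ((‖1 - z * w‖ ^ 2 : ℝ) : ℂ) = (1 - z * w) * (1 - conj z * conj w) := by
    rw [← Complex.normSq_eq_norm_sq, ← Complex.mul_conj]; simp
  have hE' := congrArg (fun r : ℝ => (r : ℂ)) hE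
  have hS' := congrArg (fun r : ℝ => (r : ℂ)) hS
  simp only [Complex.ofReal_add, Complex.ofReal_mul, Complex.ofReal_neg, hx, hy, mul_one] at hE' hS'
  have ha0 : 1 - z * conj w ≠ 0 := norm_pos_iff.1 hapos
  have hb0 : 1 - z * w ≠ 0 := norm_pos_iff.1 hbpos
  have hb0' : 1 - conj z * conj w ≠ 0 := by
    rw [← norm_pos_iff, e1]; exact hbpos
  have hzz : z - conj z ≠ 0 := by
    rw [Complex.sub_conj]
    simpa using hz0
  -- `α ↦ Re (α v)` contributes `conj α` to the Wirtinger derivative.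
  have hre : ∀ α : ℂ, ((α * 1).re : ℂ) + Complex.I * ((α * Complex.I).re : ℂ) = conj α := by
    intro α
    apply Complex.ext <;> simp
  have r1 := hre (conj (1 - z * conj w) * conj w)
  have r2 := hre (conj (1 - z * w) * w)
  simp only [map_mul, Complex.conj_conj] at r1 r2
  set α := conj (1 - z * conj w) * conj w with hα
  set β := conj (1 - z * w) * w with hβ
  rw [← mul_assoc (conj (1 - z * conj w)), ← mul_assoc (conj (1 - z * w)),
    ← mul_assoc (conj (1 - z * conj w)), ← mul_assoc (conj (1 - z * w)), ← hα, ← hβ]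
  have key : (conj w * 1 * (1 - z * conj w)⁻¹ ^ 2 * (P : ℂ) - 2 * (1 - z * conj w)⁻¹ *
      ((px * (α * 1).re + py * (β * 1).re : ℝ) : ℂ) + Complex.I *
      (conj w * Complex.I * (1 - z * conj w)⁻¹ ^ 2 * (P : ℂ) - 2 * (1 - z * conj w)⁻¹ *
      ((px * (α * Complex.I).re + py * (β * Complex.I).re : ℝ) : ℂ))) / 2 =
      -(1 - z * conj w)⁻¹ * (px * ((1 - z * conj w) * w) + py * ((1 - z * w) * conj w)) := by
    rw [← r1, ← r2]
    push_cast
    linear_combination (conj w * (1 - z * conj w)⁻¹ ^ 2 * (P : ℂ) / 2) * Complex.I_sq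
  rw [key]
  have hw : w * (z - conj z) = (1 - conj z * w) - (1 - z * w) := by ring
  have hw' : conj w * (z - conj z) = (1 - conj z * conj w) - (1 - z * conj w) := by ring
  clear_value α β px py P P'
  clear r1 r2 hre key e1 e2 hα hβ hx hy hapos hbpos hD h hE hS
  generalize 1 - z * conj w = a at *
  generalize 1 - conj z * conj w = b' at *
  generalize 1 - conj z * w = a' at *
  generalize 1 - z * w = b at *
  generalize z - conj z = d at *
  field_simp
  linear_combination (-b') * hE' + a * hS' - (px * a * b') * hw - (py * b * b') * hw'

/-- The Bergman kernel `(z ∂_z + z̄ ∂_{z̄} + lam + 1) C(z, w)`, up to a constant factor. -/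
noncomputable def bergmanKer (lam : ℝ) (p : ℝ → ℝ → ℝ) (z w : ℂ) : ℂ :=
  fderiv ℝ (fun z => cauchyKer p z w) z z + (lam + 1) * cauchyKer p z w

end CauchyKernel

/-! ### Estimates for the Bergman kernel -/

section KernelEstimates

open Set Filter Topology

variable {lam : ℝ} {p : ℝ → ℝ → ℝ}

theorem hasDerivAt_comp_real_mul {f : ℂ → ℂ} {z : ℂ} {r : ℝ}
    (hf : DifferentiableAt ℝ f (r * z)) :
    HasDerivAt (fun s : ℝ => f (s * z)) (fderiv ℝ f (r * z) z) r := by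
  have h1 : HasDerivAt (fun s : ℝ => (s : ℂ) * z) z r := by
    have := (Complex.ofRealCLM.hasDerivAt (x := r)).mul_const z
    simpa using this
  exact hf.hasFDerivAt.comp_hasDerivAt r h1

theorem IsCauchyProfile.differentiableAt_cauchyKer (hp : IsCauchyProfile lam p) {z w : ℂ}
    (h : ‖z‖ * ‖w‖ < 1) : DifferentiableAt ℝ (fun z => cauchyKer p z w) z :=
  (hasFDerivAt_section isOpen_kernelDomain (hp.contDiffOn_cauchyKer.of_le (by norm_num))
    (show (z, w) ∈ {q : ℂ × ℂ | ‖q.1‖ * ‖q.2‖ < 1} from h)).differentiableAt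

theorem IsCauchyProfile.conj_bergmanKer (hp : IsCauchyProfile lam p) {z w : ℂ}
    (h : ‖z‖ * ‖w‖ < 1) : conj (bergmanKer lam p z w) = bergmanKer lam p w z := by
  have h' : ‖w‖ * ‖z‖ < 1 := by rwa [mul_comm]
  have d1 : HasDerivAt (fun s : ℝ => cauchyKer p (s * z) w)
      (fderiv ℝ (fun z => cauchyKer p z w) z z) 1 := by
    have := hasDerivAt_comp_real_mul (f := fun z => cauchyKer p z w) (z := z) (r := 1)
      (by simpa using hp.differentiableAt_cauchyKer h)
    simpa using this
  have d2 : HasDerivAt (fun s : ℝ => cauchyKer p (s * w) z)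
      (fderiv ℝ (fun z' => cauchyKer p z' z) w w) 1 := by
    have := hasDerivAt_comp_real_mul (f := fun z' => cauchyKer p z' z) (z := w) (r := 1)
      (by simpa using hp.differentiableAt_cauchyKer h')
    simpa using this
  have d3 := Complex.conjCLE.hasFDerivAt.comp_hasDerivAt (1 : ℝ) d1
  have e : (Complex.conjCLE ∘ fun s : ℝ => cauchyKer p (s * z) w) =
      fun s : ℝ => cauchyKer p (s * w) z := by
    funext s
    simp only [Function.comp_apply, Complex.conjCLE_apply, conj_cauchyKer]
    rw [cauchyKer_real_mul]
  rw [e] at d3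
  have := d3.unique d2
  rw [bergmanKer, bergmanKer, ← this, map_add, map_mul, conj_cauchyKer]
  simp

theorem IsCauchyProfile.continuousOn_bergmanKer (hp : IsCauchyProfile lam p) :
    ContinuousOn (Function.uncurry (bergmanKer lam p)) {q : ℂ × ℂ | ‖q.1‖ * ‖q.2‖ < 1} := by
  have h1 : ContinuousOn (fun q : ℂ × ℂ => fderiv ℝ (fun z => cauchyKer p z q.2) q.1)
      {q : ℂ × ℂ | ‖q.1‖ * ‖q.2‖ < 1} :=
    (contDiffOn_fderiv_section (m := 0) (k := cauchyKer p) isOpen_kernelDomain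
      hp.contDiffOn_cauchyKer (by simp)).continuousOn
  exact (h1.clm_apply continuous_fst.continuousOn).add
    (continuousOn_const.mul hp.contDiffOn_cauchyKer.continuousOn)

/-- By Euler's identity and the signs of the partial derivatives,
`√x |p_x| + √y |p_y| ≤ lam p (1 / √x + 1 / √y)`. -/
theorem IsCauchyProfile.norm_bergmanKer_le (hp : IsCauchyProfile lam p) (hlam : 0 ≤ lam) {z w : ℂ}
    (h : ‖z‖ * ‖w‖ < 1) :
    ‖bergmanKer lam p z w‖ ≤ (4 * lam + 3) * p (‖1 - z * conj w‖ ^ 2) (‖1 - z * w‖ ^ 2) *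
      ‖1 - z * conj w‖⁻¹ * (‖1 - z * conj w‖⁻¹ + ‖1 - z * w‖⁻¹) := by
  have hA := norm_one_sub_mul_conj_pos h
  have hB := norm_one_sub_mul_pos h
  have hP := hp.nonneg _ _ (pow_pos hA 2) (pow_pos hB 2)
  have hE := hp.euler _ _ (pow_pos hA 2) (pow_pos hB 2)
  have hpx := hp.fst_nonpos _ _ (pow_pos hA 2) (pow_pos hB 2)
  have hpy := hp.snd_nonpos _ _ (pow_pos hA 2) (pow_pos hB 2)
  rw [bergmanKer, hp.fderiv_cauchyKer h, cauchyKer]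
  have hD : ∀ s t : ℝ, fderiv ℝ (Function.uncurry p) (‖1 - z * conj w‖ ^ 2, ‖1 - z * w‖ ^ 2) (s, t) =
      fderiv ℝ (Function.uncurry p) (‖1 - z * conj w‖ ^ 2, ‖1 - z * w‖ ^ 2) (1, 0) * s +
      fderiv ℝ (Function.uncurry p) (‖1 - z * conj w‖ ^ 2, ‖1 - z * w‖ ^ 2) (0, 1) * t := by
    intro s t
    have : ((s, t) : ℝ × ℝ) = s • (1, 0) + t • (0, 1) := by simp
    rw [this, map_add, map_smul, map_smul, smul_eq_mul, smul_eq_mul]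
    ring
  rw [hD] at hE
  set px := fderiv ℝ (Function.uncurry p) (‖1 - z * conj w‖ ^ 2, ‖1 - z * w‖ ^ 2) (1, 0)
  set py := fderiv ℝ (Function.uncurry p) (‖1 - z * conj w‖ ^ 2, ‖1 - z * w‖ ^ 2) (0, 1)
  set P := p (‖1 - z * conj w‖ ^ 2) (‖1 - z * w‖ ^ 2)
  have hzw : ‖conj w * z‖ ≤ 1 := by
    rw [norm_mul, RCLike.norm_conj, mul_comm]; exact h.le
  have hzw' : ‖w * z‖ ≤ 1 := by
    rw [norm_mul, mul_comm]; exact h.le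
  have hA2 : ‖1 - z * conj w‖ ≤ 2 := by
    refine (norm_sub_le _ _).trans ?_
    rw [mul_comm z]
    norm_num
    simp only [norm_mul, RCLike.norm_conj] at hzw
    linarith
  have re1 : |(conj (1 - z * conj w) * (conj w * z)).re| ≤ ‖1 - z * conj w‖ := by
    refine (Complex.abs_re_le_norm _).trans ?_
    rw [norm_mul, RCLike.norm_conj]
    exact mul_le_of_le_one_right (norm_nonneg _) hzw
  have re2 : |(conj (1 - z * w) * (w * z)).re| ≤ ‖1 - z * w‖ := by
    refine (Complex.abs_re_le_norm _).trans ?_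
    rw [norm_mul, RCLike.norm_conj]
    exact mul_le_of_le_one_right (norm_nonneg _) hzw'
  set ra := (conj (1 - z * conj w) * (conj w * z)).re
  set rb := (conj (1 - z * w) * (w * z)).re
  set A := ‖1 - z * conj w‖ with hAdef
  set B := ‖1 - z * w‖
  have hN : |px * ra + py * rb| ≤ lam * P * (A⁻¹ + B⁻¹) := by
    have h1 : |px * ra + py * rb| ≤ -px * A + -py * B := by
      refine (abs_add_le _ _).trans ?_
      rw [abs_mul, abs_mul, abs_of_nonpos hpx, abs_of_nonpos hpy]
      have := neg_nonneg.2 hpx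
      have := neg_nonneg.2 hpy
      gcongr
    refine h1.trans ?_
    have h2 : lam * P * (A⁻¹ + B⁻¹) = -px * A + -py * B + (-px * A ^ 2 / B + -py * B ^ 2 / A) := by
      have : lam * P = -px * A ^ 2 + -py * B ^ 2 := by linarith
      rw [this]
      field_simp
      ring
    rw [h2]
    have := neg_nonneg.2 hpx
    have := neg_nonneg.2 hpy
    have : 0 ≤ -px * A ^ 2 / B + -py * B ^ 2 / A := by positivity
    linarith
  have hinv : 1 ≤ 2 * A⁻¹ := by
    rw [← div_eq_mul_inv, one_le_div hA]; exact hA2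
  have n1 : ‖conj w * z * (1 - z * conj w)⁻¹ ^ 2 * (P : ℂ)‖ ≤ A⁻¹ ^ 2 * P := by
    rw [norm_mul, norm_mul, norm_pow, norm_inv, Complex.norm_real, Real.norm_of_nonneg hP, ← hAdef]
    have : ‖conj w * z‖ * A⁻¹ ^ 2 ≤ 1 * A⁻¹ ^ 2 := by gcongr
    rw [one_mul] at this
    gcongr
  have n2 : ‖2 * (1 - z * conj w)⁻¹ * ((px * ra + py * rb : ℝ) : ℂ)‖ ≤
      2 * A⁻¹ * (lam * P * (A⁻¹ + B⁻¹)) := by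
    rw [norm_mul, norm_mul, norm_inv, Complex.norm_real, ← hAdef, Real.norm_eq_abs]
    norm_num only [Complex.norm_ofNat]
    gcongr
  have n3 : ‖(lam + 1 : ℂ) * ((1 - z * conj w)⁻¹ * (P : ℂ))‖ ≤ (lam + 1) * (A⁻¹ * P) * (2 * A⁻¹) := by
    rw [norm_mul, norm_mul, norm_inv, Complex.norm_real, ← hAdef, Real.norm_of_nonneg hP]
    have : ‖(lam + 1 : ℂ)‖ = lam + 1 := by
      rw [show (lam + 1 : ℂ) = ((lam + 1 : ℝ) : ℂ) by push_cast; rfl, Complex.norm_real,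
        Real.norm_of_nonneg (by positivity)]
    rw [this]
    exact le_mul_of_one_le_right (by positivity) hinv
  refine (norm_add_le _ _).trans ((add_le_add (norm_sub_le _ _) le_rfl).trans
    ((add_le_add (add_le_add n1 n2) n3).trans ?_))
  have hB' : 0 < B⁻¹ := inv_pos.2 hB
  have hA' : 0 < A⁻¹ := inv_pos.2 hA
  have : 0 ≤ (2 * lam + 3) * P * A⁻¹ * B⁻¹ := by positivity
  nlinarith

/-- With `A = |1 - z w̄|`, `B = |1 - z w|` and `m = |sin θ|`, the weight `m ^ (2 lam)` compensates
the singularity of the profile, with a loss of `A / B` where `B ≤ A`. -/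
theorem IsCauchyProfile.exists_mul_rpow_le (hp : IsCauchyProfile lam p) (hlam : 0 ≤ lam) :
    ∃ C, 0 < C ∧ ∀ A B m : ℝ, 0 < A → 0 < B → 0 ≤ m → 2 * m ≤ A + B →
      p (A ^ 2) (B ^ 2) * m ^ (2 * lam) ≤ C ∧ A ≤ B ∨
      p (A ^ 2) (B ^ 2) * m ^ (2 * lam) ≤ C * (A / B) ∧ B ≤ A := by
  obtain ⟨C, hC, h1, h2⟩ := hp.bound
  refine ⟨C, hC, fun A B m hA hB hm hAB => ?_⟩
  have hP := hp.nonneg _ _ (pow_pos hA 2) (pow_pos hB 2)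
  have hpow : ∀ M : ℝ, 0 ≤ M → m ≤ M → m ^ (2 * lam) ≤ (M ^ 2) ^ lam := fun M hM hmM => by
    rw [← Real.rpow_natCast M 2, ← Real.rpow_mul hM]
    exact Real.rpow_le_rpow hm hmM (by positivity)
  rcases le_total A B with h | h
  · refine Or.inl ⟨?_, h⟩
    refine le_trans ?_ (h1 (A ^ 2) (B ^ 2) (by positivity) (by gcongr))
    gcongr
    exact hpow B hB.le (by linarith)
  · refine Or.inr ⟨?_, h⟩
    have := h2 (A ^ 2) (B ^ 2) (by positivity) (by gcongr)
    rw [← div_pow, Real.sqrt_sq (by positivity)] at this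
    refine le_trans ?_ this
    gcongr
    exact hpow A hA.le (by linarith)

/-- For `ω = e^{iθ}` this is `|ω - ω̄| ≤ |ω - a| + |ω̄ - a|`. -/
theorem two_mul_abs_sin_le (θ : ℝ) (a : ℂ) :
    2 * |Real.sin θ| ≤ ‖1 - Complex.exp (θ * Complex.I) * conj a‖ +
      ‖1 - Complex.exp (θ * Complex.I) * a‖ := by
  set ω := Complex.exp (θ * Complex.I) with hω
  have hn : ‖ω‖ = 1 := Complex.norm_exp_ofReal_mul_I θ
  have hωc : ω * conj ω = 1 := by
    rw [Complex.mul_conj, Complex.normSq_eq_norm_sq, hn]; simp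
  have e1 : ‖1 - ω * conj a‖ = ‖ω - a‖ := by
    rw [← RCLike.norm_conj]
    calc ‖conj (1 - ω * conj a)‖ = ‖ω‖ * ‖conj (1 - ω * conj a)‖ := by rw [hn, one_mul]
      _ = ‖ω * conj (1 - ω * conj a)‖ := (norm_mul _ _).symm
      _ = ‖ω - a‖ := by
        congr 1
        simp only [map_sub, map_one, map_mul, Complex.conj_conj]
        linear_combination (-a) * hωc
  have e2 : ‖1 - ω * a‖ = ‖conj ω - a‖ := by
    calc ‖1 - ω * a‖ = ‖conj ω‖ * ‖1 - ω * a‖ := by rw [RCLike.norm_conj, hn, one_mul]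
      _ = ‖conj ω * (1 - ω * a)‖ := (norm_mul _ _).symm
      _ = ‖conj ω - a‖ := by
        congr 1
        linear_combination (-a) * hωc
  have e3 : ω - conj ω = 2 * Complex.I * Real.sin θ := by
    rw [Complex.sub_conj, hω, Complex.exp_ofReal_mul_I_im]
    push_cast; ring
  have e4 : ‖ω - conj ω‖ = 2 * |Real.sin θ| := by
    rw [e3, norm_mul, Complex.norm_real]; simp
  rw [e1, e2, ← e4]
  calc ‖ω - conj ω‖ = ‖(ω - a) - (conj ω - a)‖ := by congr 1; ring
    _ ≤ _ := norm_sub_le _ _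

/-- On circles the weighted Bergman kernel is dominated by a sum of two classical Poisson kernels,
with poles in the directions of `w` and `w̄`. -/
theorem IsCauchyProfile.exists_norm_bergmanKer_mul_le (hp : IsCauchyProfile lam p)
    (hlam : 0 ≤ lam) : ∃ C, 0 < C ∧ ∀ (ρ θ : ℝ) (w : ℂ), |ρ| * ‖w‖ < 1 →
      ‖bergmanKer lam p (ρ * Complex.exp (θ * Complex.I)) w‖ * |Real.sin θ| ^ (2 * lam) ≤
        C * ((‖1 - Complex.exp (θ * Complex.I) * (ρ * conj w)‖ ^ 2)⁻¹ +
          (‖1 - Complex.exp (θ * Complex.I) * (ρ * w)‖ ^ 2)⁻¹) := by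
  obtain ⟨C, hC, h⟩ := hp.exists_mul_rpow_le hlam
  refine ⟨(4 * lam + 3) * (2 * C), by positivity, fun ρ θ w hρ => ?_⟩
  set ω := Complex.exp (θ * Complex.I) with hω
  have hn : ‖ω‖ = 1 := Complex.norm_exp_ofReal_mul_I θ
  have hdom : ‖(ρ : ℂ) * ω‖ * ‖w‖ < 1 := by simpa [hn] using hρ
  have e1 : (ρ : ℂ) * ω * conj w = ω * (ρ * conj w) := by ring
  have e2 : (ρ : ℂ) * ω * w = ω * (ρ * w) := by ring
  have hA := norm_one_sub_mul_conj_pos hdom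
  have hB := norm_one_sub_mul_pos hdom
  have hK := hp.norm_bergmanKer_le hlam hdom
  have hP := hp.nonneg _ _ (pow_pos hA 2) (pow_pos hB 2)
  have hs : 2 * |Real.sin θ| ≤ ‖1 - ω * (ρ * conj w)‖ + ‖1 - ω * (ρ * w)‖ := by
    have := two_mul_abs_sin_le θ (ρ * w)
    simpa using this
  rw [e1] at hA hK hP
  rw [e2] at hB hK hP
  set A := ‖1 - ω * (ρ * conj w)‖
  set B := ‖1 - ω * (ρ * w)‖
  set P := p (A ^ 2) (B ^ 2)
  set m := |Real.sin θ|
  have hm : 0 ≤ m := abs_nonneg _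
  have key : P * m ^ (2 * lam) * A⁻¹ * (A⁻¹ + B⁻¹) ≤ 2 * C * ((A ^ 2)⁻¹ + (B ^ 2)⁻¹) := by
    rcases h A B m hA hB hm hs with ⟨h1, h2⟩ | ⟨h1, h2⟩
    · have hBA : B⁻¹ ≤ A⁻¹ := inv_anti₀ hA h2
      calc P * m ^ (2 * lam) * A⁻¹ * (A⁻¹ + B⁻¹) ≤ C * A⁻¹ * (A⁻¹ + A⁻¹) := by gcongr
        _ = 2 * C * (A ^ 2)⁻¹ := by ring
        _ ≤ _ := by gcongr; simp; positivity
    · have hBA : A⁻¹ ≤ B⁻¹ := inv_anti₀ hB h2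
      calc P * m ^ (2 * lam) * A⁻¹ * (A⁻¹ + B⁻¹) ≤ C * (A / B) * A⁻¹ * (B⁻¹ + B⁻¹) := by gcongr
        _ = 2 * C * (B ^ 2)⁻¹ := by field_simp; ring
        _ ≤ _ := by gcongr; simp; positivity
  calc _ ≤ (4 * lam + 3) * P * A⁻¹ * (A⁻¹ + B⁻¹) * m ^ (2 * lam) := by gcongr
    _ = (4 * lam + 3) * (P * m ^ (2 * lam) * A⁻¹ * (A⁻¹ + B⁻¹)) := by ring
    _ ≤ (4 * lam + 3) * (2 * C * ((A ^ 2)⁻¹ + (B ^ 2)⁻¹)) := by gcongr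
    _ = _ := by ring

theorem continuous_norm_one_sub_sq_inv {a : ℂ} (ha : ‖a‖ < 1) :
    Continuous fun θ : ℝ => (‖1 - Complex.exp (θ * Complex.I) * a‖ ^ 2)⁻¹ := by
  refine Continuous.inv₀ (by fun_prop) fun θ => ?_
  exact (pow_pos (norm_one_sub_pos (by rwa [norm_mul, Complex.norm_exp_ofReal_mul_I, one_mul])) 2).ne'

/-- The integral of the classical Poisson kernel, up to its factor `1 - ‖a‖ ^ 2`. -/
theorem integral_norm_one_sub_sq_inv {a : ℂ} (ha : ‖a‖ < 1) :
    ∫ θ in (-Real.pi)..Real.pi, (‖1 - Complex.exp (θ * Complex.I) * a‖ ^ 2)⁻¹ =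
      2 * Real.pi / (1 - ‖a‖ ^ 2) := by
  have ha' : 0 < 1 - ‖a‖ ^ 2 := by nlinarith [norm_nonneg a]
  have h := DiffContOnCl.circleAverage_poissonKernel_smul' (f := fun _ => (1 : ℂ)) (c := 0) (R := 1)
    (w := conj a) diffContOnCl_const (by simpa using ha)
  have hper : Function.Periodic
      (fun θ : ℝ => (‖1 - Complex.exp (θ * Complex.I) * a‖ ^ 2)⁻¹) (2 * Real.pi) := fun θ => by
    have : Complex.exp (((θ + 2 * Real.pi : ℝ) : ℂ) * Complex.I) = Complex.exp (θ * Complex.I) := by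
      push_cast
      rw [add_mul, Complex.exp_periodic]
    simp only [this]
  have h2 := hper.intervalIntegral_add_eq (-Real.pi) 0
  rw [show -Real.pi + 2 * Real.pi = Real.pi by ring, zero_add] at h2
  rw [h2]
  have e : ∀ θ : ℝ, ((‖circleMap 0 1 θ - 0‖ ^ 2 - ‖conj a - 0‖ ^ 2) /
      ‖(circleMap 0 1 θ - 0) - (conj a - 0)‖ ^ 2) • (1 : ℂ) =
      (((1 - ‖a‖ ^ 2) * (‖1 - Complex.exp (θ * Complex.I) * a‖ ^ 2)⁻¹ : ℝ) : ℂ) := fun θ => by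
    have hω : circleMap 0 1 θ = Complex.exp (θ * Complex.I) := by simp [circleMap]
    rw [hω]
    set ω := Complex.exp (θ * Complex.I) with hω
    have hn : ‖ω‖ = 1 := Complex.norm_exp_ofReal_mul_I θ
    have hωc : ω * conj ω = 1 := by
      rw [Complex.mul_conj, Complex.normSq_eq_norm_sq, hn]; simp
    have e1 : ‖1 - ω * a‖ = ‖ω - conj a‖ := by
      rw [← RCLike.norm_conj (ω - conj a)]
      calc ‖1 - ω * a‖ = ‖conj ω‖ * ‖1 - ω * a‖ := by rw [RCLike.norm_conj, hn, one_mul]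
        _ = ‖conj ω * (1 - ω * a)‖ := (norm_mul _ _).symm
        _ = ‖conj (ω - conj a)‖ := by
          congr 1
          simp only [map_sub, Complex.conj_conj]
          linear_combination (-a) * hωc
    simp only [sub_zero, RCLike.norm_conj, hn, e1, one_pow, Complex.real_smul, mul_one,
      div_eq_mul_inv]
  rw [Real.circleAverage_def] at h
  simp only [e] at h
  rw [intervalIntegral.integral_ofReal, intervalIntegral.integral_const_mul, Complex.real_smul] at h
  have h3 : (2 * Real.pi)⁻¹ * ((1 - ‖a‖ ^ 2) *
      ∫ θ in (0 : ℝ)..2 * Real.pi, (‖1 - Complex.exp (θ * Complex.I) * a‖ ^ 2)⁻¹) = 1 := by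
    exact_mod_cast h
  have := Real.pi_pos
  generalize ∫ θ in (0 : ℝ)..2 * Real.pi, (‖1 - Complex.exp (θ * Complex.I) * a‖ ^ 2)⁻¹ = I at *
  field_simp at h3 ⊢
  linarith

end KernelEstimates

/-! ### Orthogonality relations on circles -/

section CircleIdentities

open Set Filter Topology

variable {lam : ℝ}

/-- The point `e^{iθ}` of the unit circle. -/
noncomputable def circlePt (θ : ℝ) : ℂ := Complex.exp (θ * Complex.I)

theorem norm_circlePt (θ : ℝ) : ‖circlePt θ‖ = 1 := Complex.norm_exp_ofReal_mul_I θ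

theorem contDiff_circlePt {n : WithTop ℕ∞} : ContDiff ℝ n circlePt := by
  unfold circlePt
  exact (Complex.ofRealCLM.contDiff.mul contDiff_const).cexp

theorem continuous_circlePt : Continuous circlePt := (contDiff_circlePt (n := 0)).continuous

theorem hasDerivAt_circlePt (θ : ℝ) : HasDerivAt circlePt (Complex.I * circlePt θ) θ := by
  have h := ((Complex.ofRealCLM.hasDerivAt (x := θ)).mul_const Complex.I).cexp
  refine h.congr_deriv ?_
  simp [circlePt, mul_comm]

theorem conj_circlePt (θ : ℝ) : conj (circlePt θ) = circlePt (-θ) := by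
  simp [circlePt, ← Complex.exp_conj]

theorem circlePt_im (θ : ℝ) : (circlePt θ).im = Real.sin θ := Complex.exp_ofReal_mul_I_im θ

theorem circlePt_eq (θ : ℝ) : circlePt θ = Real.cos θ + Real.sin θ * Complex.I := by
  rw [circlePt, Complex.exp_mul_I]; push_cast; rfl

theorem circlePt_add_circlePt_neg (θ : ℝ) : circlePt θ + circlePt (-θ) = 2 * Complex.cos θ := by
  rw [circlePt_eq, circlePt_eq, Real.cos_neg, Real.sin_neg]; push_cast; ring

theorem norm_real_mul_circlePt (r θ : ℝ) : ‖(r : ℂ) * circlePt θ‖ = |r| := by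
  simp [norm_circlePt]

theorem real_mul_circlePt_mem_ball {r : ℝ} (hr : |r| < 1) (θ : ℝ) :
    (r : ℂ) * circlePt θ ∈ Metric.ball (0 : ℂ) 1 := by
  rw [mem_ball_zero_iff, norm_real_mul_circlePt]; exact hr

/-- The weight `|sin θ| ^ (2 lam)` on the circle. -/
noncomputable def circleWeight (lam θ : ℝ) : ℝ := |Real.sin θ| ^ (2 * lam)

theorem continuous_circleWeight (hlam : 0 ≤ lam) : Continuous (circleWeight lam) :=
  (Real.continuous_sin.abs).rpow_const fun _ => Or.inr (by positivity)

theorem circleWeight_nonneg (θ : ℝ) : 0 ≤ circleWeight lam θ := by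
  unfold circleWeight; positivity

theorem circleWeight_neg (θ : ℝ) : circleWeight lam (-θ) = circleWeight lam θ := by
  simp [circleWeight]

theorem hasDerivAt_circleWeight {θ : ℝ} (hθ : θ ∈ Ioo 0 Real.pi) :
    HasDerivAt (circleWeight lam)
      (2 * lam * (Real.cos θ / Real.sin θ) * circleWeight lam θ) θ := by
  have hs : 0 < Real.sin θ := Real.sin_pos_of_mem_Ioo hθ
  have h := (Real.hasDerivAt_sin θ).rpow_const (p := 2 * lam) (Or.inl hs.ne')
  have e : (fun θ => Real.sin θ ^ (2 * lam)) =ᶠ[𝓝 θ] circleWeight lam := by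
    filter_upwards [isOpen_Ioo.mem_nhds hθ] with x hx
    rw [circleWeight, abs_of_pos (Real.sin_pos_of_mem_Ioo hx)]
  refine (h.congr_of_eventuallyEq e.symm).congr_deriv ?_
  rw [circleWeight, abs_of_pos hs, Real.rpow_sub_one hs.ne']
  ring

theorem integral_symm_eq {h : ℝ → ℂ} (hh : Continuous h) :
    ∫ θ in (-Real.pi)..Real.pi, h θ = ∫ θ in (0 : ℝ)..Real.pi, (h θ + h (-θ)) := by
  have hn : Continuous fun θ => h (-θ) := hh.comp continuous_neg
  rw [intervalIntegral.integral_add (hh.intervalIntegrable _ _) (hn.intervalIntegrable _ _),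
    intervalIntegral.integral_comp_neg, add_comm, neg_zero,
    intervalIntegral.integral_add_adjacent_intervals (hh.intervalIntegrable _ _)
      (hh.intervalIntegrable _ _)]

theorem IsLambdaAnalytic.continuous_circle {f : ℂ → ℂ} (hf : IsLambdaAnalytic lam f) {r : ℝ}
    (hr : |r| < 1) : Continuous fun θ => f (r * circlePt θ) :=
  hf.1.continuousOn.comp_continuous (continuous_const.mul continuous_circlePt)
    (real_mul_circlePt_mem_ball hr)

theorem IsLambdaAnalytic.continuousOn_fderiv {f : ℂ → ℂ} (hf : IsLambdaAnalytic lam f) :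
    ContinuousOn (fderiv ℝ f) (Metric.ball 0 1) :=
  hf.1.continuousOn_fderiv_of_isOpen Metric.isOpen_ball (by norm_num)

/-- The Euler (radial) derivative `z ∂_z f + z̄ ∂_{z̄} f`. -/
noncomputable def eulerDeriv (f : ℂ → ℂ) (z : ℂ) : ℂ := fderiv ℝ f z z

theorem IsLambdaAnalytic.continuousOn_eulerDeriv {f : ℂ → ℂ} (hf : IsLambdaAnalytic lam f) :
    ContinuousOn (eulerDeriv f) (Metric.ball 0 1) :=
  hf.continuousOn_fderiv.clm_apply continuousOn_id

theorem IsLambdaAnalytic.continuous_circle_eulerDeriv {f : ℂ → ℂ} (hf : IsLambdaAnalytic lam f)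
    {r : ℝ} (hr : |r| < 1) : Continuous fun θ => eulerDeriv f (r * circlePt θ) :=
  hf.continuousOn_eulerDeriv.comp_continuous (continuous_const.mul continuous_circlePt)
    (real_mul_circlePt_mem_ball hr)

theorem IsLambdaAnalytic.hasDerivAt_circle {f : ℂ → ℂ} (hf : IsLambdaAnalytic lam f)
    {r : ℝ} (hr : |r| < 1) (θ : ℝ) :
    HasDerivAt (fun θ => f (r * circlePt θ))
      (fderiv ℝ f (r * circlePt θ) (Complex.I * (r * circlePt θ))) θ := by
  have h1 : HasDerivAt (fun θ => (r : ℂ) * circlePt θ) (Complex.I * (r * circlePt θ)) θ :=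
    ((hasDerivAt_circlePt θ).const_mul (r : ℂ)).congr_deriv (by ring)
  exact (hf.differentiableAt (real_mul_circlePt_mem_ball hr θ)).hasFDerivAt.comp_hasDerivAt θ h1

/-- The equation `D_{z̄} f = 0` in polar coordinates. -/
theorem IsLambdaAnalytic.eulerDeriv_eq {f : ℂ → ℂ} (hf : IsLambdaAnalytic lam f) {r θ : ℝ}
    (hr : |r| < 1) (hr0 : r ≠ 0) (hθ : Real.sin θ ≠ 0) :
    eulerDeriv f (r * circlePt θ) =
      -Complex.I * fderiv ℝ f (r * circlePt θ) (Complex.I * (r * circlePt θ)) -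
      Complex.I * lam * circlePt (-θ) *
        (f (r * circlePt θ) - f (r * circlePt (-θ))) / Real.sin θ := by
  have h := hf.2 _ (real_mul_circlePt_mem_ball hr θ)
  have him : ((r : ℂ) * circlePt θ).im ≠ 0 := by
    rw [Complex.im_ofReal_mul]
    exact mul_ne_zero hr0 (by rwa [circlePt_im])
  rw [dunklBar, wirtingerBar, reflectionQuotient, if_neg him, Complex.sub_conj,
    Complex.im_ofReal_mul, circlePt_im, map_mul, Complex.conj_ofReal, conj_circlePt] at h
  rw [eulerDeriv]
  have hlin : ∀ a b : ℝ, fderiv ℝ f (r * circlePt θ) (a + b * Complex.I) =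
      a * fderiv ℝ f (r * circlePt θ) 1 + b * fderiv ℝ f (r * circlePt θ) Complex.I := by
    intro a b
    have : (a + b * Complex.I : ℂ) = a • (1 : ℂ) + b • Complex.I := by simp
    rw [this, map_add, map_smul, map_smul, Complex.real_smul, Complex.real_smul]
  set F := fderiv ℝ f (r * circlePt θ)
  have e1 : (r : ℂ) * circlePt θ = (r * Real.cos θ : ℝ) + (r * Real.sin θ : ℝ) * Complex.I := by
    rw [circlePt_eq]; push_cast; ring
  have e2 : Complex.I * ((r : ℂ) * circlePt θ) =
      (-(r * Real.sin θ) : ℝ) + (r * Real.cos θ : ℝ) * Complex.I := by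
    rw [circlePt_eq]
    simp only [Complex.ofReal_neg, Complex.ofReal_mul]
    linear_combination (r * Real.sin θ : ℂ) * Complex.I_sq
  have e3 : circlePt (-θ) = Real.cos θ - Real.sin θ * Complex.I := by
    rw [circlePt_eq]; simp [sub_eq_add_neg]
  have g1 := hlin (r * Real.cos θ) (r * Real.sin θ)
  have g2 := hlin (-(r * Real.sin θ)) (r * Real.cos θ)
  rw [← e1] at g1
  rw [← e2] at g2
  rw [g1, g2]
  have hs : (Real.sin θ : ℂ) ≠ 0 := by exact_mod_cast hθ
  have hrc : (r : ℂ) ≠ 0 := by exact_mod_cast hr0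
  generalize f (r * circlePt θ) - f (r * circlePt (-θ)) = d at *
  rw [e3]
  clear hlin g1 g2 e1 e2 e3 him hθ
  push_cast at h ⊢
  have h' : F 1 + Complex.I * F Complex.I =
      lam * d / (r * Complex.sin θ * Complex.I) := by
    have hs' : Complex.sin θ ≠ 0 := by rwa [← Complex.ofReal_sin]
    field_simp at h ⊢
    linear_combination h
  have hs' : Complex.sin θ ≠ 0 := by rwa [← Complex.ofReal_sin]
  have hI : Complex.I⁻¹ = -Complex.I := Complex.inv_I
  have h2 : F 1 = -Complex.I * F Complex.I - lam * d * Complex.I / (r * Complex.sin θ) := by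
    rw [eq_sub_iff_add_eq.2 h']
    rw [div_eq_mul_inv, mul_inv, hI]
    ring
  rw [h2]
  field_simp
  ring_nf
  simp only [Complex.I_sq]
  ring

/-- The angular part of the polar form of `D_{z̄}` is symmetric for the weight `|sin θ| ^ (2 lam)`;
on `(0, π)` the integrand below, symmetrised, is the derivative of
`-i (f ḡ (θ) - f ḡ (-θ)) sin θ ^ (2 lam)`. -/
theorem integral_eulerDeriv_mul_conj_sub {f g : ℂ → ℂ} (hlam : 0 ≤ lam)
    (hf : IsLambdaAnalytic lam f) (hg : IsLambdaAnalytic lam g) {s t : ℝ} (hs : |s| < 1)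
    (hs0 : s ≠ 0) (ht : |t| < 1) (ht0 : t ≠ 0) :
    ∫ θ in (-Real.pi)..Real.pi, circleWeight lam θ •
      (eulerDeriv f (s * circlePt θ) * conj (g (t * circlePt θ)) -
        f (s * circlePt θ) * conj (eulerDeriv g (t * circlePt θ))) = 0 := by
  have cf := hf.continuous_circle hs
  have cg := Complex.continuous_conj.comp (hg.continuous_circle ht)
  have cEf := hf.continuous_circle_eulerDeriv hs
  have cEg := Complex.continuous_conj.comp (hg.continuous_circle_eulerDeriv ht)
  have cW := continuous_circleWeight hlam
  have ch : Continuous fun θ => circleWeight lam θ •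
      (eulerDeriv f (s * circlePt θ) * conj (g (t * circlePt θ)) -
        f (s * circlePt θ) * conj (eulerDeriv g (t * circlePt θ))) :=
    cW.smul ((cEf.mul cg).sub (cf.mul cEg))
  have cu : Continuous fun θ => f (s * circlePt θ) * conj (g (t * circlePt θ)) := cf.mul cg
  have cB : Continuous fun θ => circleWeight lam θ • (-Complex.I * (f (s * circlePt θ) *
      conj (g (t * circlePt θ)) - f (s * circlePt (-θ)) * conj (g (t * circlePt (-θ))))) :=
    cW.smul (continuous_const.mul (cu.sub (cu.comp continuous_neg)))
  rw [integral_symm_eq ch]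
  refine (intervalIntegral.integral_eq_sub_of_hasDerivAt_of_le Real.pi_pos.le cB.continuousOn ?_
    ?_).trans ?_
  rotate_left
  · exact (ch.add (ch.comp continuous_neg)).intervalIntegrable _ _
  · have : circlePt Real.pi = circlePt (-Real.pi) := by
      rw [circlePt_eq, circlePt_eq]; simp
    simp [this]
  intro θ hθ
  have hsin : Real.sin θ ≠ 0 := (Real.sin_pos_of_mem_Ioo hθ).ne'
  have hsin' : Real.sin (-θ) ≠ 0 := by simpa using hsin
  have df := hf.hasDerivAt_circle hs θ
  have dg := Complex.conjCLE.hasFDerivAt.comp_hasDerivAt θ (hg.hasDerivAt_circle ht θ)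
  have df' := (hf.hasDerivAt_circle hs (-θ)).scomp θ (hasDerivAt_neg θ)
  have dg' := Complex.conjCLE.hasFDerivAt.comp_hasDerivAt θ
    ((hg.hasDerivAt_circle ht (-θ)).scomp θ (hasDerivAt_neg θ))
  have d := (hasDerivAt_circleWeight (lam := lam) hθ).smul
    (((df.mul dg).sub (df'.mul dg')).const_mul (-Complex.I))
  refine d.congr_deriv ?_
  have Ef := hf.eulerDeriv_eq hs hs0 hsin
  have Ef' := hf.eulerDeriv_eq hs hs0 hsin'
  have Eg := congrArg conj (hg.eulerDeriv_eq ht ht0 hsin)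
  have Eg' := congrArg conj (hg.eulerDeriv_eq ht ht0 hsin')
  simp only [map_sub, map_mul, map_neg, map_div₀, Complex.conj_I, Complex.conj_ofReal,
    conj_circlePt, neg_neg] at Eg Eg'
  rw [neg_neg] at Ef'
  rw [Ef, Ef', Eg, Eg', circleWeight_neg]
  simp only [Function.comp_apply, Pi.mul_apply, Pi.sub_apply, Complex.conjCLE_apply,
    ContinuousLinearEquiv.coe_coe, Complex.real_smul, neg_smul, one_smul, map_neg]
  have hc := circlePt_add_circlePt_neg θ
  push_cast [Real.sin_neg]
  linear_combination (Complex.I * lam * circleWeight lam θ / Complex.sin θ *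
    (f (s * circlePt θ) * conj (g (t * circlePt θ)) -
      f (s * circlePt (-θ)) * conj (g (t * circlePt (-θ))))) * hc

/-- The bilinear companion of `integral_eulerDeriv_mul_conj_sub`: multiplication by `e^{iθ}` carries
`lam`-analytic functions to conjugates of functions orthogonal to all `lam`-analytic ones. -/
theorem integral_eulerDeriv_mul_add {f g : ℂ → ℂ} (hlam : 0 ≤ lam)
    (hf : IsLambdaAnalytic lam f) (hg : IsLambdaAnalytic lam g) {s t : ℝ} (hs : |s| < 1)
    (hs0 : s ≠ 0) (ht : |t| < 1) (ht0 : t ≠ 0) :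
    ∫ θ in (-Real.pi)..Real.pi, circleWeight lam θ •
      ((eulerDeriv f (s * circlePt θ) * g (t * circlePt θ) +
        f (s * circlePt θ) * eulerDeriv g (t * circlePt θ) +
        (2 * lam + 1) * (f (s * circlePt θ) * g (t * circlePt θ))) * circlePt θ) = 0 := by
  have cf := hf.continuous_circle hs
  have cg := hg.continuous_circle ht
  have cEf := hf.continuous_circle_eulerDeriv hs
  have cEg := hg.continuous_circle_eulerDeriv ht
  have cW := continuous_circleWeight hlam
  have ch : Continuous fun θ => circleWeight lam θ •
      ((eulerDeriv f (s * circlePt θ) * g (t * circlePt θ) +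
        f (s * circlePt θ) * eulerDeriv g (t * circlePt θ) +
        (2 * lam + 1) * (f (s * circlePt θ) * g (t * circlePt θ))) * circlePt θ) :=
    cW.smul ((((cEf.mul cg).add (cf.mul cEg)).add (continuous_const.mul (cf.mul cg))).mul
      continuous_circlePt)
  have cu : Continuous fun θ => f (s * circlePt θ) * g (t * circlePt θ) * circlePt θ :=
    (cf.mul cg).mul continuous_circlePt
  have cB : Continuous fun θ => circleWeight lam θ • (-Complex.I * (f (s * circlePt θ) *
      g (t * circlePt θ) * circlePt θ -
        f (s * circlePt (-θ)) * g (t * circlePt (-θ)) * circlePt (-θ))) :=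
    cW.smul (continuous_const.mul (cu.sub (cu.comp continuous_neg)))
  rw [integral_symm_eq ch]
  refine (intervalIntegral.integral_eq_sub_of_hasDerivAt_of_le Real.pi_pos.le cB.continuousOn ?_
    ?_).trans ?_
  rotate_left
  · exact (ch.add (ch.comp continuous_neg)).intervalIntegrable _ _
  · have : circlePt Real.pi = circlePt (-Real.pi) := by
      rw [circlePt_eq, circlePt_eq]; simp
    simp [this]
  intro θ hθ
  have hsin : Real.sin θ ≠ 0 := (Real.sin_pos_of_mem_Ioo hθ).ne'
  have hsin' : Real.sin (-θ) ≠ 0 := by simpa using hsin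
  have df := hf.hasDerivAt_circle hs θ
  have dg := hg.hasDerivAt_circle ht θ
  have df' := (hf.hasDerivAt_circle hs (-θ)).scomp θ (hasDerivAt_neg θ)
  have dg' := (hg.hasDerivAt_circle ht (-θ)).scomp θ (hasDerivAt_neg θ)
  have dc := hasDerivAt_circlePt θ
  have dc' := (hasDerivAt_circlePt (-θ)).scomp θ (hasDerivAt_neg θ)
  have d := (hasDerivAt_circleWeight (lam := lam) hθ).smul
    ((((df.mul dg).mul dc).sub ((df'.mul dg').mul dc')).const_mul (-Complex.I))
  refine d.congr_deriv ?_
  have Ef := hf.eulerDeriv_eq hs hs0 hsin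
  have Ef' := hf.eulerDeriv_eq hs hs0 hsin'
  have Eg := hg.eulerDeriv_eq ht ht0 hsin
  have Eg' := hg.eulerDeriv_eq ht ht0 hsin'
  rw [neg_neg] at Ef' Eg'
  rw [Ef, Ef', Eg, Eg', circleWeight_neg]
  simp only [Function.comp_apply, Pi.mul_apply, Pi.sub_apply, Complex.real_smul, neg_smul, one_smul]
  have hc := circlePt_eq θ
  have hc' := circlePt_eq (-θ)
  have hs1 : Complex.sin θ ≠ 0 := by rw [← Complex.ofReal_sin]; exact_mod_cast hsin
  push_cast [Real.sin_neg, Real.cos_neg] at hc hc' ⊢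
  have hone : Complex.cos θ ^ 2 = 1 - Complex.sin θ ^ 2 := by
    linear_combination Complex.sin_sq_add_cos_sq (θ : ℂ)
  generalize f (s * circlePt θ) = f₁ at *
  generalize f (s * circlePt (-θ)) = f₂ at *
  generalize g (t * circlePt θ) = g₁ at *
  generalize g (t * circlePt (-θ)) = g₂ at *
  generalize fderiv ℝ f _ _ = F₁ at *
  generalize fderiv ℝ f _ _ = F₂ at *
  generalize fderiv ℝ g _ _ = G₁ at *
  generalize fderiv ℝ g _ _ = G₂ at *
  rw [hc, hc']
  field_simp
  ring_nf
  simp only [Complex.I_sq, hone, Complex.I_pow_three]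
  ring_nf

end CircleIdentities

/-! ### Functions on circles of varying radius -/

section CauchyFormula

open Set Filter Topology

variable {lam : ℝ}

theorem circleIntegral_eq_setIntegral (F : ℝ → ℂ) :
    ∫ θ in (-Real.pi)..Real.pi, F θ = ∫ θ in Icc (-Real.pi) Real.pi, F θ := by
  rw [intervalIntegral.integral_of_le (by linarith [Real.pi_pos]), integral_Icc_eq_integral_Ioc]

theorem integrableOn_circleWeight (hlam : 0 ≤ lam) :
    IntegrableOn (circleWeight lam) (Icc (-Real.pi) Real.pi) :=
  (continuous_circleWeight hlam).continuousOn.integrableOn_compact isCompact_Icc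

theorem continuousOn_circleIntegral (hlam : 0 ≤ lam) {U : Set ℝ} (hU : IsOpen U) {F : ℝ → ℝ → ℂ}
    (hF : ContinuousOn (Function.uncurry F) (U ×ˢ univ)) :
    ContinuousOn (fun τ => ∫ θ in (-Real.pi)..Real.pi, circleWeight lam θ • F τ θ) U := by
  simp only [circleIntegral_eq_setIntegral]
  exact continuousOn_setIntegral_smul hF hU isCompact_Icc (prod_mono subset_rfl (subset_univ _))
    (integrableOn_circleWeight hlam) (hU.prod isOpen_univ)

theorem hasDerivAt_circleIntegral (hlam : 0 ≤ lam) {U : Set ℝ} (hU : IsOpen U) {F : ℝ → ℝ → ℂ}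
    (hF : ContDiffOn ℝ 1 (Function.uncurry F) (U ×ˢ univ)) {τ : ℝ} (hτ : τ ∈ U) {F' : ℝ → ℂ}
    (hF' : ∀ θ, HasDerivAt (fun τ => F τ θ) (F' θ) τ) :
    HasDerivAt (fun τ => ∫ θ in (-Real.pi)..Real.pi, circleWeight lam θ • F τ θ)
      (∫ θ in (-Real.pi)..Real.pi, circleWeight lam θ • F' θ) τ := by
  simp only [circleIntegral_eq_setIntegral]
  have hsub : U ×ˢ Icc (-Real.pi) Real.pi ⊆ U ×ˢ univ := prod_mono subset_rfl (subset_univ _)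
  have h := (hasFDerivAt_setIntegral_smul (hU.prod isOpen_univ) hF hU isCompact_Icc hsub
    (integrableOn_circleWeight hlam) hτ).hasDerivAt
  have hint := integrableOn_smul_section (contDiffOn_fderiv_section (m := 0)
    (hU.prod isOpen_univ) hF (by simp)).continuousOn hU isCompact_Icc hsub
    (integrableOn_circleWeight hlam) hτ
  rw [ContinuousLinearMap.integral_apply hint] at h
  refine h.congr_deriv (integral_congr_ae (Eventually.of_forall fun θ => ?_))
  simp only [smul_apply]
  rw [(hF' θ).hasFDerivAt.fderiv]
  simp

theorem IsLambdaAnalytic.contDiffOn_comp_circle {f : ℂ → ℂ} (hf : IsLambdaAnalytic lam f)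
    {U : Set ℝ} {a : ℝ → ℝ} (ha : ContDiffOn ℝ 1 a U) (ha1 : ∀ τ ∈ U, |a τ| < 1) :
    ContDiffOn ℝ 1 (fun q : ℝ × ℝ => f (a q.1 * circlePt q.2)) (U ×ˢ univ) := by
  refine (hf.1.of_le (by norm_num)).comp (f := fun q : ℝ × ℝ => (a q.1 : ℂ) * circlePt q.2) ?_
    fun q hq => real_mul_circlePt_mem_ball (ha1 _ hq.1) _
  refine ContDiffOn.mul ?_ (contDiff_circlePt.comp contDiff_snd).contDiffOn
  exact Complex.ofRealCLM.contDiff.comp_contDiffOn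
    (ha.comp contDiff_fst.contDiffOn fun q hq => hq.1)

theorem IsLambdaAnalytic.hasDerivAt_radial {f : ℂ → ℂ} (hf : IsLambdaAnalytic lam f)
    {a : ℝ → ℝ} {a' τ : ℝ} (ha : HasDerivAt a a' τ) (ha1 : |a τ| < 1) (ha0 : a τ ≠ 0) (θ : ℝ) :
    HasDerivAt (fun τ => f (a τ * circlePt θ))
      (a' / a τ * eulerDeriv f (a τ * circlePt θ)) τ := by
  have h := (hasDerivAt_comp_real_mul
    (hf.differentiableAt (real_mul_circlePt_mem_ball ha1 θ))).scomp τ ha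
  refine h.congr_deriv ?_
  rw [eulerDeriv, ← Complex.real_smul (x := a τ), map_smul]
  have : (a τ : ℂ) ≠ 0 := by exact_mod_cast ha0
  simp only [Complex.real_smul]
  field_simp

/-- `∫ f(s e^{iθ}) conj g(t e^{iθ}) |sin θ|^{2 lam} dθ` depends on the product `s t` only. -/
theorem integral_mul_conj_eq_of_mul_eq {f g : ℂ → ℂ} (hlam : 0 ≤ lam)
    (hf : IsLambdaAnalytic lam f) (hg : IsLambdaAnalytic lam g) {s t s' t' : ℝ}
    (hs : s ∈ Ioo (0 : ℝ) 1) (ht : t ∈ Ioo (0 : ℝ) 1) (hs' : s' ∈ Ioo (0 : ℝ) 1)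
    (h : s * t = s' * t') (hle : s ≤ s') :
    ∫ θ in (-Real.pi)..Real.pi, circleWeight lam θ •
      (f (s * circlePt θ) * conj (g (t * circlePt θ))) =
    ∫ θ in (-Real.pi)..Real.pi, circleWeight lam θ •
      (f (s' * circlePt θ) * conj (g (t' * circlePt θ))) := by
  set c := s * t with hc
  have hc0 : 0 < c := mul_pos hs.1 ht.1
  have hU : ∀ τ ∈ Ioo c 1, |τ| < 1 ∧ |c / τ| < 1 := fun τ hτ => by
    have : 0 < τ := hc0.trans hτ.1
    rw [abs_of_pos this, abs_of_pos (by positivity), div_lt_one this]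
    exact ⟨hτ.2, hτ.1⟩
  set F : ℝ → ℝ → ℂ := fun τ θ => f (τ * circlePt θ) * conj (g ((c / τ : ℝ) * circlePt θ)) with hF
  have hFd : ContDiffOn ℝ 1 (Function.uncurry F) (Ioo c 1 ×ˢ univ) := by
    refine ContDiffOn.mul (hf.contDiffOn_comp_circle (a := fun τ => τ) contDiffOn_id
      fun τ hτ => (hU τ hτ).1) ?_
    refine Complex.conjCLE.contDiff.comp_contDiffOn
      (hg.contDiffOn_comp_circle (a := fun τ => c / τ) ?_ fun τ hτ => (hU τ hτ).2)
    exact contDiffOn_const.div contDiffOn_id fun τ hτ => (hc0.trans hτ.1).ne'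
  have hcs : c < s := by
    have := mul_lt_mul_of_pos_left ht.2 hs.1; linarith
  have hder : ∀ τ ∈ Ioo c 1, HasDerivAt
      (fun τ => ∫ θ in (-Real.pi)..Real.pi, circleWeight lam θ • F τ θ) 0 τ := fun τ hτ => by
    have hτ0 : 0 < τ := hc0.trans hτ.1
    have hct0 : c / τ ≠ 0 := by positivity
    have hd := hasDerivAt_circleIntegral hlam isOpen_Ioo hFd hτ
      (F' := fun θ => (1 / τ : ℝ) * (eulerDeriv f (τ * circlePt θ) *
        conj (g ((c / τ : ℝ) * circlePt θ)) - f (τ * circlePt θ) *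
        conj (eulerDeriv g ((c / τ : ℝ) * circlePt θ)))) fun θ => by
        have h1 := hf.hasDerivAt_radial (hasDerivAt_id τ) (hU τ hτ).1 hτ0.ne' θ
        have h2 := Complex.conjCLE.hasFDerivAt.comp_hasDerivAt τ
          (hg.hasDerivAt_radial (a := fun τ => c / τ) (((hasDerivAt_id τ).fun_inv hτ0.ne').const_mul c)
            (hU τ hτ).2 hct0 θ)
        refine (h1.mul h2).congr_deriv ?_
        have hτc : (τ : ℂ) ≠ 0 := by exact_mod_cast hτ0.ne'
        have hcc : (c : ℂ) ≠ 0 := by exact_mod_cast hc0.ne'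
        simp only [Function.comp_apply, Complex.conjCLE_apply, ContinuousLinearEquiv.coe_coe,
          map_mul, map_div₀, Complex.conj_ofReal, id]
        push_cast
        field_simp
        ring
    refine hd.congr_deriv ?_
    have e : ∀ θ, circleWeight lam θ • ((1 / τ : ℝ) * (eulerDeriv f (τ * circlePt θ) *
        conj (g ((c / τ : ℝ) * circlePt θ)) - f (τ * circlePt θ) *
        conj (eulerDeriv g ((c / τ : ℝ) * circlePt θ)))) =
        ((1 / τ : ℝ) : ℂ) * (circleWeight lam θ • (eulerDeriv f (τ * circlePt θ) *
        conj (g ((c / τ : ℝ) * circlePt θ)) - f (τ * circlePt θ) *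
        conj (eulerDeriv g ((c / τ : ℝ) * circlePt θ)))) := fun θ => by
      rw [mul_smul_comm]
    simp only [e]
    rw [intervalIntegral.integral_const_mul,
      integral_eulerDeriv_mul_conj_sub hlam hf hg (hU τ hτ).1 hτ0.ne' (hU τ hτ).2 hct0, mul_zero]
  have hIcc : Icc s s' ⊆ Ioo c 1 := fun τ hτ => ⟨hcs.trans_le hτ.1, hτ.2.trans_lt hs'.2⟩
  have hftc := intervalIntegral.integral_eq_sub_of_hasDerivAt_of_le hle
    (fun τ hτ => (hder τ (hIcc hτ)).continuousAt.continuousWithinAt)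
    (fun τ hτ => hder τ (hIcc (Ioo_subset_Icc_self hτ))) (by simp)
  rw [intervalIntegral.integral_zero] at hftc
  have e1 : c / s = t := by rw [hc]; field_simp [hs.1.ne']
  have e2 : c / s' = t' := by rw [h]; field_simp [hs'.1.ne']
  have := (sub_eq_zero.1 hftc.symm).symm
  simpa only [hF, e1, e2] using this

theorem isLambdaAnalytic_const (c : ℂ) : IsLambdaAnalytic lam fun _ => c := by
  refine ⟨contDiffOn_const, fun z _ => ?_⟩
  simp [dunklBar, wirtingerBar, reflectionQuotient]

theorem eulerDeriv_const (c z : ℂ) : eulerDeriv (fun _ => c) z = 0 := by simp [eulerDeriv]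

/-- The mean value property at the origin. -/
theorem IsLambdaAnalytic.integral_circle {f : ℂ → ℂ} (hlam : 0 ≤ lam)
    (hf : IsLambdaAnalytic lam f) {t : ℝ} (ht : t ∈ Ioo (0 : ℝ) 1) :
    ∫ θ in (-Real.pi)..Real.pi, circleWeight lam θ • f (t * circlePt θ) =
      (∫ θ in (-Real.pi)..Real.pi, circleWeight lam θ : ℝ) * f 0 := by
  have hU : ∀ τ ∈ Ioo (-1 : ℝ) 1, |τ| < 1 := fun τ hτ => abs_lt.2 hτ
  have hFd : ContDiffOn ℝ 1 (Function.uncurry fun τ θ : ℝ => f (τ * circlePt θ))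
      (Ioo (-1 : ℝ) 1 ×ˢ univ) :=
    hf.contDiffOn_comp_circle (a := fun τ => τ) contDiffOn_id hU
  have hcont := continuousOn_circleIntegral hlam isOpen_Ioo hFd.continuousOn
  have hder : ∀ τ ∈ Ioo (0 : ℝ) 1, HasDerivAt
      (fun τ : ℝ => ∫ θ in (-Real.pi)..Real.pi, circleWeight lam θ • f (τ * circlePt θ)) 0 τ :=
    fun τ hτ => by
    have hτ1 : |τ| < 1 := hU τ ⟨by linarith [hτ.1], hτ.2⟩
    have hd := hasDerivAt_circleIntegral hlam isOpen_Ioo hFd (τ := τ) ⟨by linarith [hτ.1], hτ.2⟩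
      (F' := fun θ => (1 / τ : ℝ) * eulerDeriv f (τ * circlePt θ)) fun θ => by
        refine (hf.hasDerivAt_radial (hasDerivAt_id τ) hτ1 hτ.1.ne' θ).congr_deriv ?_
        simp
    refine hd.congr_deriv ?_
    simp only [← mul_smul_comm]
    rw [intervalIntegral.integral_const_mul]
    have := integral_eulerDeriv_mul_conj_sub hlam hf (isLambdaAnalytic_const 1) hτ1 hτ.1.ne' hτ1
      hτ.1.ne'
    simp only [eulerDeriv_const, map_one, map_zero, mul_one, mul_zero, sub_zero] at this
    rw [this, mul_zero]
  have hsub : Icc 0 t ⊆ Ioo (-1 : ℝ) 1 := fun τ hτ => ⟨by linarith [hτ.1], hτ.2.trans_lt ht.2⟩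
  have hftc := intervalIntegral.integral_eq_sub_of_hasDerivAt_of_le ht.1.le
    (hcont.mono hsub) (fun τ hτ => hder τ ⟨hτ.1, hτ.2.trans ht.2⟩) (by simp)
  rw [intervalIntegral.integral_zero] at hftc
  rw [sub_eq_zero.1 hftc.symm]
  simp only [Complex.ofReal_zero, zero_mul, Complex.real_smul]
  rw [intervalIntegral.integral_mul_const, intervalIntegral.integral_ofReal]

/-- The integral `M(τ)` formed with `τ s`, `τ t` satisfies `τ M' = -(2 lam + 1) M` and is continuous
at `0`, so it vanishes. -/
theorem integral_mul_mul_circlePt_eq_zero {f g : ℂ → ℂ} (hlam : 0 ≤ lam)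
    (hf : IsLambdaAnalytic lam f) (hg : IsLambdaAnalytic lam g) {s t : ℝ}
    (hs : s ∈ Ioo (0 : ℝ) 1) (ht : t ∈ Ioo (0 : ℝ) 1) :
    ∫ θ in (-Real.pi)..Real.pi, circleWeight lam θ •
      (f (s * circlePt θ) * g (t * circlePt θ) * circlePt θ) = 0 := by
  set U : Set ℝ := {τ | |τ * s| < 1 ∧ |τ * t| < 1} with hUdef
  have hU : IsOpen U :=
    (isOpen_lt (continuous_id.mul continuous_const).abs continuous_const).inter
      (isOpen_lt (continuous_id.mul continuous_const).abs continuous_const)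
  have hIcc : Icc (0 : ℝ) 1 ⊆ U := fun τ hτ => by
    have := hs.1; have := ht.1; have := hτ.1
    refine ⟨?_, ?_⟩
    · rw [abs_of_nonneg (by positivity)]
      exact (mul_le_of_le_one_left hs.1.le hτ.2).trans_lt hs.2
    · rw [abs_of_nonneg (by positivity)]
      exact (mul_le_of_le_one_left ht.1.le hτ.2).trans_lt ht.2
  set F : ℝ → ℝ → ℂ := fun τ θ =>
    f ((τ * s : ℝ) * circlePt θ) * g ((τ * t : ℝ) * circlePt θ) * circlePt θ with hF
  have hFd : ContDiffOn ℝ 1 (Function.uncurry F) (U ×ˢ univ) := by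
    refine ContDiffOn.mul (ContDiffOn.mul
      (hf.contDiffOn_comp_circle (a := fun τ => τ * s) (by fun_prop) fun τ hτ => hτ.1)
      (hg.contDiffOn_comp_circle (a := fun τ => τ * t) (by fun_prop) fun τ hτ => hτ.2))
      (contDiff_circlePt.comp contDiff_snd).contDiffOn
  set M : ℝ → ℂ := fun τ => ∫ θ in (-Real.pi)..Real.pi, circleWeight lam θ • F τ θ with hM
  have hMc : ContinuousOn M U := continuousOn_circleIntegral hlam hU hFd.continuousOn
  have hMd : ∀ τ ∈ Ioo (0 : ℝ) 1, HasDerivAt M (-((2 * lam + 1) / τ) * M τ) τ := fun τ hτ => by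
    have hτU := hIcc (Ioo_subset_Icc_self hτ)
    have hτ0 := hτ.1
    have hs0 : τ * s ≠ 0 := (mul_pos hτ0 hs.1).ne'
    have ht0 : τ * t ≠ 0 := (mul_pos hτ0 ht.1).ne'
    have hd := hasDerivAt_circleIntegral hlam hU hFd hτU
      (F' := fun θ => (1 / τ : ℝ) * ((eulerDeriv f ((τ * s : ℝ) * circlePt θ) *
          g ((τ * t : ℝ) * circlePt θ) + f ((τ * s : ℝ) * circlePt θ) *
          eulerDeriv g ((τ * t : ℝ) * circlePt θ)) * circlePt θ)) fun θ => by
        have h1 := hf.hasDerivAt_radial (a := fun τ => τ * s) ((hasDerivAt_id τ).mul_const s)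
          hτU.1 hs0 θ
        have h2 := hg.hasDerivAt_radial (a := fun τ => τ * t) ((hasDerivAt_id τ).mul_const t)
          hτU.2 ht0 θ
        refine ((h1.mul h2).mul_const (circlePt θ)).congr_deriv ?_
        have hτc : (τ : ℂ) ≠ 0 := by exact_mod_cast hτ0.ne'
        have hsc : (s : ℂ) ≠ 0 := by exact_mod_cast hs.1.ne'
        have htc : (t : ℂ) ≠ 0 := by exact_mod_cast ht.1.ne'
        push_cast
        field_simp
    refine hd.congr_deriv ?_
    have key := integral_eulerDeriv_mul_add hlam hf hg hτU.1 hs0 hτU.2 ht0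
    have c1 := hf.continuous_circle hτU.1
    have c2 := hg.continuous_circle hτU.2
    have c3 := hf.continuous_circle_eulerDeriv hτU.1
    have c4 := hg.continuous_circle_eulerDeriv hτU.2
    have cW := continuous_circleWeight hlam
    have e : ∀ θ, circleWeight lam θ • ((1 / τ : ℝ) * ((eulerDeriv f ((τ * s : ℝ) * circlePt θ) *
          g ((τ * t : ℝ) * circlePt θ) + f ((τ * s : ℝ) * circlePt θ) *
          eulerDeriv g ((τ * t : ℝ) * circlePt θ)) * circlePt θ)) =
        ((1 / τ : ℝ) : ℂ) * (circleWeight lam θ •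
          ((eulerDeriv f ((τ * s : ℝ) * circlePt θ) * g ((τ * t : ℝ) * circlePt θ) +
          f ((τ * s : ℝ) * circlePt θ) * eulerDeriv g ((τ * t : ℝ) * circlePt θ) +
          (2 * lam + 1) * (f ((τ * s : ℝ) * circlePt θ) * g ((τ * t : ℝ) * circlePt θ))) *
            circlePt θ)) - ((2 * lam + 1) / τ) * (circleWeight lam θ • F τ θ) := fun θ => by
      have hτc : (τ : ℂ) ≠ 0 := by exact_mod_cast hτ0.ne'
      simp only [hF, Complex.real_smul]
      push_cast
      field_simp
      ring
    simp only [e]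
    rw [intervalIntegral.integral_sub, intervalIntegral.integral_const_mul, key,
      intervalIntegral.integral_const_mul, mul_zero, zero_sub, neg_mul]
    · refine Continuous.intervalIntegrable (continuous_const.mul (cW.smul ?_)) _ _
      exact (((c3.mul c2).add (c1.mul c4)).add (continuous_const.mul (c1.mul c2))).mul
        continuous_circlePt
    · refine Continuous.intervalIntegrable (continuous_const.mul (cW.smul ?_)) _ _
      exact (c1.mul c2).mul continuous_circlePt
  -- `τ ^ (2 lam + 1) M(τ)` is constant on `[0, 1]` and vanishes at `0`.
  have hftc := intervalIntegral.integral_eq_sub_of_hasDerivAt_of_le zero_le_one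
    (f := fun τ : ℝ => ((τ ^ (2 * lam + 1) : ℝ) : ℂ) * M τ) (f' := fun _ => 0)
    (by
      refine ContinuousOn.mul ?_ (hMc.mono hIcc)
      exact (Complex.continuous_ofReal.comp
        (Real.continuous_rpow_const (by positivity))).continuousOn)
    (fun τ hτ => by
      have h1 : HasDerivAt (fun τ : ℝ => ((τ ^ (2 * lam + 1) : ℝ) : ℂ))
          (((2 * lam + 1) * τ ^ (2 * lam + 1 - 1) : ℝ) : ℂ) τ :=
        (Real.hasDerivAt_rpow_const (Or.inl hτ.1.ne')).ofReal_comp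
      refine (h1.mul (hMd τ hτ)).congr_deriv ?_
      rw [Real.rpow_sub_one hτ.1.ne']
      push_cast
      ring) (by simp)
  rw [intervalIntegral.integral_zero] at hftc
  have h0 : (2 * lam + 1) ≠ 0 := by positivity
  simp only [Real.one_rpow, Real.zero_rpow h0, Complex.ofReal_one, Complex.ofReal_zero, one_mul,
    zero_mul, sub_zero] at hftc
  have : M 1 = 0 := hftc.symm
  simpa [hM, hF] using this

end CauchyFormula

/-! ### The Poisson kernel and the Cauchy formula -/

section PoissonKernel

open Set Filter Topology

variable {lam : ℝ} {p : ℝ → ℝ → ℝ}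

/-- The total mass of the weight `|sin θ| ^ (2 lam)` on the circle. -/
noncomputable def circleMass (lam : ℝ) : ℝ := ∫ θ in (-Real.pi)..Real.pi, circleWeight lam θ

theorem circleMass_pos (hlam : 0 ≤ lam) : 0 < circleMass lam := by
  refine intervalIntegral.integral_pos (by linarith [Real.pi_pos])
    (continuous_circleWeight hlam).continuousOn (fun θ _ => circleWeight_nonneg θ)
    ⟨Real.pi / 2, ⟨by linarith [Real.pi_pos], by linarith [Real.pi_pos]⟩, ?_⟩
  simp [circleWeight]

/-- The Poisson kernel attached to a Cauchy profile, with pole at the point `e` of the circle. -/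
noncomputable def poissonKer (p : ℝ → ℝ → ℝ) (e : ℂ) (t θ : ℝ) : ℝ :=
  (1 - t ^ 2) * p (‖1 - t * circlePt θ * conj e‖ ^ 2) (‖1 - t * circlePt θ * e‖ ^ 2) *
    (‖1 - t * circlePt θ * conj e‖ ^ 2)⁻¹

theorem conj_cauchyKer_add_eq_poissonKer {e : ℂ} (he : ‖e‖ = 1) {t : ℝ} (ht : t ∈ Ioo (0 : ℝ) 1)
    (θ : ℝ) :
    conj (cauchyKer p (t * circlePt θ) e) +
      conj e * t * (cauchyKer p (t * circlePt θ) e * circlePt θ) = poissonKer p e t θ := by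
  have hA : 1 - t * circlePt θ * conj e ≠ 0 := norm_pos_iff.1 (norm_one_sub_mul_conj_pos
    (by rw [norm_real_mul_circlePt, he, abs_of_pos ht.1, mul_one]; exact ht.2))
  have hA' : 1 - t * conj (circlePt θ) * e ≠ 0 := fun h => hA (by
    have := congrArg conj h
    simpa using this)
  have hn : ((‖1 - t * circlePt θ * conj e‖ ^ 2 : ℝ) : ℂ) =
      (1 - t * circlePt θ * conj e) * (1 - t * conj (circlePt θ) * e) := by
    rw [← Complex.normSq_eq_norm_sq, ← Complex.mul_conj]
    simp
  have hec : conj e * e = 1 := by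
    rw [mul_comm, Complex.mul_conj, Complex.normSq_eq_norm_sq, he]; simp
  have hω : circlePt θ * conj (circlePt θ) = 1 := by
    rw [Complex.mul_conj, Complex.normSq_eq_norm_sq, norm_circlePt]; simp
  rw [poissonKer, cauchyKer]
  rw [Complex.ofReal_mul, Complex.ofReal_mul, Complex.ofReal_inv, hn]
  simp only [map_mul, map_inv₀, map_sub, map_one, Complex.conj_ofReal, Complex.conj_conj]
  generalize p (‖1 - t * circlePt θ * conj e‖ ^ 2) (‖1 - t * circlePt θ * e‖ ^ 2) = P
  push_cast
  have hu := mul_inv_cancel₀ hA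
  have hv := mul_inv_cancel₀ hA'
  rw [mul_inv]
  generalize (1 - t * circlePt θ * conj e)⁻¹ = u at *
  generalize (1 - t * conj (circlePt θ) * e)⁻¹ = v at *
  linear_combination -(P * v) * hu - P * (t * circlePt θ * conj e) * u * hv -
    u * v * P * t ^ 2 * (circlePt θ * conj (circlePt θ)) * hec - u * v * P * t ^ 2 * hω

theorem IsCauchyProfile.continuous_cauchyKer_circle (hp : IsCauchyProfile lam p) {e : ℂ}
    (he : ‖e‖ = 1) {t : ℝ} (ht : t ∈ Ioo (0 : ℝ) 1) :
    Continuous fun θ => cauchyKer p (t * circlePt θ) e :=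
  (hp.isLambdaAnalytic_cauchyKer he.le).continuous_circle (abs_lt.2 ⟨by linarith [ht.1], ht.2⟩)

theorem IsCauchyProfile.continuous_poissonKer (hp : IsCauchyProfile lam p) {e : ℂ}
    (he : ‖e‖ = 1) {t : ℝ} (ht : t ∈ Ioo (0 : ℝ) 1) : Continuous (poissonKer p e t) := by
  have h := hp.continuous_cauchyKer_circle he ht
  have h2 : Continuous fun θ => (poissonKer p e t θ : ℂ) := by
    simp only [← conj_cauchyKer_add_eq_poissonKer he ht]
    exact (Complex.continuous_conj.comp h).add
      (continuous_const.mul (h.mul continuous_circlePt))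
  exact Complex.continuous_re.comp h2

theorem IsCauchyProfile.poissonKer_nonneg (hp : IsCauchyProfile lam p) {e : ℂ}
    (he : ‖e‖ = 1) {t : ℝ} (ht : t ∈ Ioo (0 : ℝ) 1) (θ : ℝ) : 0 ≤ poissonKer p e t θ := by
  have hlt : ‖(t : ℂ) * circlePt θ‖ * ‖e‖ < 1 := by
    rw [norm_real_mul_circlePt, he, abs_of_pos ht.1, mul_one]; exact ht.2
  have h1 : 0 ≤ 1 - t ^ 2 := by nlinarith [ht.1, ht.2]
  have := hp.nonneg _ _ (pow_pos (norm_one_sub_mul_conj_pos hlt) 2)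
    (pow_pos (norm_one_sub_mul_pos hlt) 2)
  unfold poissonKer
  positivity

/-- Against a `lam`-analytic function the conjugate Cauchy kernel may be replaced by the Poisson
kernel, which differs from it by a multiple of `e^{iθ}` times a `lam`-analytic function. -/
theorem IsCauchyProfile.integral_mul_conj_cauchyKer (hp : IsCauchyProfile lam p) (hlam : 0 ≤ lam)
    {f : ℂ → ℂ} (hf : IsLambdaAnalytic lam f) {e : ℂ} (he : ‖e‖ = 1) {s t : ℝ}
    (hs : s ∈ Ioo (0 : ℝ) 1) (ht : t ∈ Ioo (0 : ℝ) 1) :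
    ∫ θ in (-Real.pi)..Real.pi, circleWeight lam θ •
      (f (s * circlePt θ) * conj (cauchyKer p (t * circlePt θ) e)) =
    ∫ θ in (-Real.pi)..Real.pi, circleWeight lam θ •
      (f (s * circlePt θ) * (poissonKer p e t θ : ℂ)) := by
  have h0 := integral_mul_mul_circlePt_eq_zero hlam hf (hp.isLambdaAnalytic_cauchyKer he.le) hs ht
  have ck := hp.continuous_cauchyKer_circle he ht
  have cf := hf.continuous_circle (abs_lt.2 ⟨by linarith [hs.1], hs.2⟩)
  have cW := continuous_circleWeight hlam
  have e1 : ∀ θ, circleWeight lam θ • (f (s * circlePt θ) * (poissonKer p e t θ : ℂ)) =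
      circleWeight lam θ • (f (s * circlePt θ) * conj (cauchyKer p (t * circlePt θ) e)) +
      conj e * t * (circleWeight lam θ •
        (f (s * circlePt θ) * cauchyKer p (t * circlePt θ) e * circlePt θ)) := fun θ => by
    rw [← conj_cauchyKer_add_eq_poissonKer he ht]
    simp only [Complex.real_smul]
    ring
  simp only [e1]
  rw [intervalIntegral.integral_add, intervalIntegral.integral_const_mul, h0, mul_zero, add_zero]
  · exact (cW.smul (cf.mul (Complex.continuous_conj.comp ck))).intervalIntegrable _ _
  · exact (continuous_const.mul (cW.smul ((cf.mul ck).mul continuous_circlePt))).intervalIntegrable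
      _ _

theorem IsCauchyProfile.cauchyKer_zero (hp : IsCauchyProfile lam p) (w : ℂ) :
    cauchyKer p 0 w = 1 := by
  simp [cauchyKer, hp.one_one]

theorem IsCauchyProfile.integral_poissonKer (hp : IsCauchyProfile lam p) (hlam : 0 ≤ lam)
    {e : ℂ} (he : ‖e‖ = 1) {t : ℝ} (ht : t ∈ Ioo (0 : ℝ) 1) :
    ∫ θ in (-Real.pi)..Real.pi, circleWeight lam θ * poissonKer p e t θ = circleMass lam := by
  have h := hp.integral_mul_conj_cauchyKer hlam (isLambdaAnalytic_const 1) he ht ht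
  have h2 := congrArg conj ((hp.isLambdaAnalytic_cauchyKer he.le).integral_circle hlam ht)
  rw [hp.cauchyKer_zero, mul_one, Complex.conj_ofReal,
    intervalIntegral.integral_of_le (by linarith [Real.pi_pos]), ← integral_conj,
    ← intervalIntegral.integral_of_le (by linarith [Real.pi_pos])] at h2
  simp only [one_mul, Complex.real_smul, map_mul, Complex.conj_ofReal] at h h2
  rw [h2] at h
  simp only [← Complex.ofReal_mul] at h
  rw [intervalIntegral.integral_ofReal] at h
  exact_mod_cast h.symm

/-- The Poisson kernel is small away from its pole: where `|1 - t e^{iθ} ē| ≥ δ`, the weighted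
kernel is dominated by functions with small integral, as `t → 1`. -/
theorem IsCauchyProfile.exists_poissonKer_le (hp : IsCauchyProfile lam p) (hlam : 0 ≤ lam) :
    ∃ C, 0 < C ∧ ∀ (e : ℂ), ‖e‖ = 1 → ∀ t ∈ Ioo (0 : ℝ) 1, ∀ δ > 0, ∀ θ : ℝ,
      δ ≤ ‖1 - t * circlePt θ * conj e‖ →
      circleWeight lam θ * poissonKer p e t θ ≤ C * ((1 - t ^ 2) * (δ ^ 2)⁻¹ +
        δ⁻¹ * √(1 - t ^ 2) * ((1 - t ^ 2) * (‖1 - circlePt θ * (t * e)‖ ^ 2)⁻¹ + 1)) := by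
  obtain ⟨C, hC, h⟩ := hp.exists_mul_rpow_le hlam
  refine ⟨C, hC, fun e he t ht δ hδ θ hA => ?_⟩
  have hlt : ‖(t : ℂ) * circlePt θ‖ * ‖e‖ < 1 := by
    rw [norm_real_mul_circlePt, he, abs_of_pos ht.1, mul_one]; exact ht.2
  have hA0 := norm_one_sub_mul_conj_pos hlt
  have hB0 := norm_one_sub_mul_pos hlt
  have h1 : 0 ≤ 1 - t ^ 2 := by nlinarith [ht.1, ht.2]
  have eB : ‖1 - circlePt θ * (t * e)‖ = ‖1 - t * circlePt θ * e‖ := by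
    congr 2; ring
  have hm : 2 * |Real.sin θ| ≤ ‖1 - t * circlePt θ * conj e‖ + ‖1 - t * circlePt θ * e‖ := by
    have := two_mul_abs_sin_le θ (t * e)
    rw [map_mul, Complex.conj_ofReal] at this
    convert this using 4
    · unfold circlePt; ring
    · unfold circlePt; ring
  have hk := h _ _ _ hA0 hB0 (abs_nonneg (Real.sin θ)) hm
  rw [eB]
  set A := ‖1 - t * circlePt θ * conj e‖
  set B := ‖1 - t * circlePt θ * e‖
  set η := √(1 - t ^ 2)
  have hη0 : 0 ≤ η := Real.sqrt_nonneg _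
  have hη : 1 - t ^ 2 = η ^ 2 := (Real.sq_sqrt h1).symm
  have e1 : circleWeight lam θ * poissonKer p e t θ =
      (1 - t ^ 2) * (A ^ 2)⁻¹ * (p (A ^ 2) (B ^ 2) * |Real.sin θ| ^ (2 * lam)) := by
    unfold circleWeight poissonKer; ring
  rw [e1, hη]
  have hA2 : (A ^ 2)⁻¹ ≤ (δ ^ 2)⁻¹ := by gcongr
  have hA1 : A⁻¹ ≤ δ⁻¹ := by gcongr
  have hsec : 0 ≤ δ⁻¹ * η * (η ^ 2 * (B ^ 2)⁻¹ + 1) := by positivity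
  have hP : 0 ≤ p (A ^ 2) (B ^ 2) * |Real.sin θ| ^ (2 * lam) :=
    mul_nonneg (hp.nonneg _ _ (pow_pos hA0 2) (pow_pos hB0 2)) (by positivity)
  rcases hk with ⟨hk, -⟩ | ⟨hk, -⟩
  · calc η ^ 2 * (A ^ 2)⁻¹ * (p (A ^ 2) (B ^ 2) * |Real.sin θ| ^ (2 * lam))
        ≤ η ^ 2 * (δ ^ 2)⁻¹ * C := by gcongr
      _ ≤ _ := by nlinarith
  · have hB : η ^ 2 * B⁻¹ ≤ η * (η ^ 2 * (B ^ 2)⁻¹ + 1) := by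
      have e2 : (B ^ 2)⁻¹ = B⁻¹ ^ 2 := by rw [inv_pow]
      rw [e2]
      nlinarith [mul_nonneg hη0 (sq_nonneg (η * B⁻¹ - 1)),
        mul_nonneg hη0 (mul_nonneg hη0 (inv_nonneg.2 hB0.le))]
    calc η ^ 2 * (A ^ 2)⁻¹ * (p (A ^ 2) (B ^ 2) * |Real.sin θ| ^ (2 * lam))
        ≤ η ^ 2 * (A ^ 2)⁻¹ * (C * (A / B)) := by gcongr
      _ = C * (A⁻¹ * (η ^ 2 * B⁻¹)) := by field_simp
      _ ≤ C * (δ⁻¹ * (η * (η ^ 2 * (B ^ 2)⁻¹ + 1))) := by gcongr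
      _ ≤ _ := by
        have : 0 ≤ C * (η ^ 2 * (δ ^ 2)⁻¹) := by positivity
        nlinarith

/-- The Cauchy formula. The left side depends only on `c = s t`; for `t → 1` the Poisson kernel is
an approximate identity. -/
theorem IsCauchyProfile.cauchy_formula (hp : IsCauchyProfile lam p) (hlam : 0 ≤ lam)
    {f : ℂ → ℂ} (hf : IsLambdaAnalytic lam f) {e : ℂ} (he : ‖e‖ = 1) {s t : ℝ}
    (hs : s ∈ Ioo (0 : ℝ) 1) (ht : t ∈ Ioo (0 : ℝ) 1) :
    ∫ θ in (-Real.pi)..Real.pi, circleWeight lam θ •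
      (f (s * circlePt θ) * conj (cauchyKer p (t * circlePt θ) e)) =
    circleMass lam * f ((s * t : ℝ) * e) := by
  set J := ∫ θ in (-Real.pi)..Real.pi, circleWeight lam θ •
      (f (s * circlePt θ) * conj (cauchyKer p (t * circlePt θ) e)) with hJ
  set c := s * t with hc
  have hc0 : 0 < c := mul_pos hs.1 ht.1
  have hct : c < t := mul_lt_of_lt_one_left ht.1 hs.2
  have hball : Metric.closedBall (0 : ℂ) s ⊆ Metric.ball 0 1 :=
    Metric.closedBall_subset_ball hs.2
  have hfc : ContinuousOn f (Metric.closedBall 0 s) := hf.1.continuousOn.mono hball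
  have hK := isCompact_closedBall (0 : ℂ) s
  obtain ⟨M, hM⟩ := hK.exists_bound_of_continuousOn hfc
  have hM0 : 0 ≤ M := (norm_nonneg _).trans (hM 0 (by simp [hs.1.le]))
  have huc := hK.uniformContinuousOn_of_continuous hfc
  obtain ⟨C, hC, hPC⟩ := hp.exists_poissonKer_le hlam
  have hcball : (c : ℂ) * e ∈ Metric.closedBall (0 : ℂ) s := by
    rw [mem_closedBall_zero_iff, norm_mul, he, mul_one, Complex.norm_real, Real.norm_eq_abs,
      abs_of_pos hc0]
    exact mul_le_of_le_one_right hs.1.le ht.2.le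
  -- Within distance `δ` of the pole `f` varies by less than `ε`; the rest of the Poisson integral
  -- is controlled by `hPC` and tends to `0` as `τ → 1`.
  have main : ∀ ε > 0, ‖J - circleMass lam * f (c * e)‖ ≤ ε * circleMass lam := fun ε hε => by
    obtain ⟨δ, hδ, hfδ⟩ := Metric.uniformContinuousOn_iff.1 huc ε hε
    have hev : ∀ᶠ τ in 𝓝[<] (1 : ℝ), ‖J - circleMass lam * f (c * e)‖ ≤ ε * circleMass lam +
        2 * M * C * (2 * Real.pi) * ((1 - τ ^ 2) * (δ ^ 2)⁻¹ + 2 * δ⁻¹ * √(1 - τ ^ 2)) := by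
      filter_upwards [Ioo_mem_nhdsLT ht.2] with τ hτ
      have hτ0 : 0 < τ := ht.1.trans hτ.1
      have hτ1 : τ ∈ Ioo (0 : ℝ) 1 := ⟨hτ0, hτ.2⟩
      have hσs : c / τ ≤ s := by
        rw [div_le_iff₀ hτ0, hc]; exact mul_le_mul_of_nonneg_left hτ.1.le hs.1.le
      set σ := c / τ with hσ
      have hσ0 : 0 < σ := by positivity
      have hσ1 : σ ∈ Ioo (0 : ℝ) 1 := ⟨hσ0, hσs.trans_lt hs.2⟩
      have hστ : σ * τ = c := by rw [hσ]; field_simp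
      have cW := continuous_circleWeight hlam
      have cP := hp.continuous_poissonKer he hτ1
      have cf := hf.continuous_circle (abs_lt.2 ⟨by linarith, hσ1.2⟩ : |σ| < 1)
      have hJ2 : J = ∫ θ in (-Real.pi)..Real.pi, circleWeight lam θ •
          (f (σ * circlePt θ) * (poissonKer p e τ θ : ℂ)) := by
        rw [hJ, ← hp.integral_mul_conj_cauchyKer hlam hf he hσ1 hτ1]
        exact (integral_mul_conj_eq_of_mul_eq hlam hf (hp.isLambdaAnalytic_cauchyKer he.le) hσ1 hτ1
          hs (by rw [hστ]) hσs).symm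
      have hm : (circleMass lam : ℂ) * f (c * e) = ∫ θ in (-Real.pi)..Real.pi,
          circleWeight lam θ • (f (c * e) * (poissonKer p e τ θ : ℂ)) := by
        rw [← hp.integral_poissonKer hlam he hτ1, ← intervalIntegral.integral_ofReal,
          ← intervalIntegral.integral_mul_const]
        refine intervalIntegral.integral_congr fun θ _ => ?_
        simp only [Complex.real_smul]
        push_cast
        ring
      have hlt : ‖(τ : ℂ) * e‖ < 1 := by
        rw [norm_mul, he, mul_one, Complex.norm_real, Real.norm_eq_abs, abs_of_pos hτ0]; exact hτ.2
      have cB : Continuous fun θ : ℝ => (‖1 - circlePt θ * (τ * e)‖ ^ 2)⁻¹ :=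
        continuous_norm_one_sub_sq_inv hlt
      have hBint : ∫ θ in (-Real.pi)..Real.pi, (‖1 - circlePt θ * (τ * e)‖ ^ 2)⁻¹ =
          2 * Real.pi / (1 - τ ^ 2) := by
        have := integral_norm_one_sub_sq_inv hlt
        rw [norm_mul, he, mul_one, Complex.norm_real, Real.norm_eq_abs, sq_abs] at this
        exact this
      have h1τ : 0 < 1 - τ ^ 2 := by nlinarith [hτ.2]
      have cB1 : Continuous fun θ : ℝ => (1 - τ ^ 2) * (‖1 - circlePt θ * (τ * e)‖ ^ 2)⁻¹ :=
        continuous_const.mul cB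
      have cPc : Continuous fun θ => (poissonKer p e τ θ : ℂ) := Complex.continuous_ofReal.comp cP
      have c1 : Continuous fun θ =>
          circleWeight lam θ • (f (σ * circlePt θ) * (poissonKer p e τ θ : ℂ)) :=
        cW.smul (cf.mul cPc)
      have c2 : Continuous fun θ =>
          circleWeight lam θ • (f (c * e) * (poissonKer p e τ θ : ℂ)) :=
        cW.smul (continuous_const.mul cPc)
      rw [hJ2, hm, ← intervalIntegral.integral_sub (c1.intervalIntegrable _ _)
        (c2.intervalIntegrable _ _)]
      set G : ℝ → ℝ := fun θ => ε * (circleWeight lam θ * poissonKer p e τ θ) + 2 * M * (C *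
        ((1 - τ ^ 2) * (δ ^ 2)⁻¹ + δ⁻¹ * √(1 - τ ^ 2) *
          ((1 - τ ^ 2) * (‖1 - circlePt θ * (τ * e)‖ ^ 2)⁻¹ + 1))) with hG
      have cG1 : Continuous fun θ => ε * (circleWeight lam θ * poissonKer p e τ θ) :=
        continuous_const.mul (cW.mul cP)
      have cG2 : Continuous fun θ => 2 * M * (C * ((1 - τ ^ 2) * (δ ^ 2)⁻¹ + δ⁻¹ * √(1 - τ ^ 2) *
          ((1 - τ ^ 2) * (‖1 - circlePt θ * (τ * e)‖ ^ 2)⁻¹ + 1))) := by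
        have := cB
        fun_prop
      have hle : ∀ θ, ‖circleWeight lam θ • (f (σ * circlePt θ) * (poissonKer p e τ θ : ℂ)) -
          circleWeight lam θ • (f (c * e) * (poissonKer p e τ θ : ℂ))‖ ≤ G θ := fun θ => by
        have hW := circleWeight_nonneg (lam := lam) θ
        have hP := hp.poissonKer_nonneg he hτ1 θ
        have h1 : 0 ≤ (1 - τ ^ 2) := h1τ.le
        have e1 : ‖circleWeight lam θ • (f (σ * circlePt θ) * (poissonKer p e τ θ : ℂ)) -
            circleWeight lam θ • (f (c * e) * (poissonKer p e τ θ : ℂ))‖ =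
            ‖f (σ * circlePt θ) - f (c * e)‖ * (circleWeight lam θ * poissonKer p e τ θ) := by
          rw [← smul_sub, ← sub_mul, norm_smul, norm_mul, Complex.norm_real, Real.norm_of_nonneg hW,
            Real.norm_of_nonneg hP]
          ring
        have hmem : (σ : ℂ) * circlePt θ ∈ Metric.closedBall (0 : ℂ) s := by
          rw [mem_closedBall_zero_iff, norm_real_mul_circlePt, abs_of_pos hσ0]; exact hσs
        have hdist : dist ((σ : ℂ) * circlePt θ) (c * e) ≤ ‖1 - τ * circlePt θ * conj e‖ := by
          have hω : circlePt θ * conj (circlePt θ) = 1 := by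
            rw [Complex.mul_conj, Complex.normSq_eq_norm_sq, norm_circlePt]; simp
          have e3 : ‖circlePt θ - τ * e‖ = ‖1 - τ * circlePt θ * conj e‖ := by
            have : circlePt θ - τ * e = circlePt θ * conj (1 - τ * circlePt θ * conj e) := by
              simp only [map_sub, map_one, map_mul, Complex.conj_ofReal, Complex.conj_conj]
              linear_combination τ * e * hω
            rw [this, norm_mul, norm_circlePt, one_mul, RCLike.norm_conj]
          rw [dist_eq_norm, show (σ : ℂ) * circlePt θ - c * e = σ * (circlePt θ - τ * e) by
            rw [← hστ]; push_cast; ring, norm_mul, e3, Complex.norm_real, Real.norm_of_nonneg hσ0.le]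
          exact mul_le_of_le_one_left (norm_nonneg _) hσ1.2.le
        rw [e1]
        by_cases hA : δ ≤ ‖1 - τ * circlePt θ * conj e‖
        · have hb : ‖f (σ * circlePt θ) - f (c * e)‖ ≤ 2 * M :=
            (norm_sub_le _ _).trans (by linarith [hM _ hmem, hM _ hcball])
          refine (mul_le_mul hb (hPC e he τ hτ1 δ hδ θ hA) (by positivity) (by positivity)).trans ?_
          exact le_add_of_nonneg_left (by positivity)
        · have hb : ‖f (σ * circlePt θ) - f (c * e)‖ ≤ ε := by
            rw [← dist_eq_norm]
            exact (hfδ _ hmem _ hcball (hdist.trans_lt (not_le.1 hA))).le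
          refine (mul_le_mul_of_nonneg_right hb (by positivity)).trans ?_
          exact le_add_of_nonneg_right (by positivity)
      refine (intervalIntegral.norm_integral_le_of_norm_le (by linarith [Real.pi_pos])
        (Eventually.of_forall fun θ _ => hle θ) ((cG1.add cG2).intervalIntegrable _ _)).trans
        (le_of_eq ?_)
      rw [hG, intervalIntegral.integral_add (cG1.intervalIntegrable _ _)
        (cG2.intervalIntegrable _ _), intervalIntegral.integral_const_mul,
        hp.integral_poissonKer hlam he hτ1, intervalIntegral.integral_const_mul,
        intervalIntegral.integral_const_mul, intervalIntegral.integral_add (by simp)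
          (Continuous.intervalIntegrable (by fun_prop) _ _),
        intervalIntegral.integral_const_mul, intervalIntegral.integral_const_mul,
        intervalIntegral.integral_add (cB1.intervalIntegrable _ _) (by simp),
        intervalIntegral.integral_const_mul, hBint, mul_div_cancel₀ _ h1τ.ne']
      simp only [intervalIntegral.integral_const, smul_eq_mul]
      ring
    have hcont : Continuous fun τ : ℝ => ε * circleMass lam + 2 * M * C * (2 * Real.pi) *
        ((1 - τ ^ 2) * (δ ^ 2)⁻¹ + 2 * δ⁻¹ * √(1 - τ ^ 2)) := by fun_prop
    have hlim := (hcont.tendsto 1).mono_left (nhdsWithin_le_nhds (s := Iio 1))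
    simpa using ge_of_tendsto hlim hev
  have hz : ‖J - circleMass lam * f (c * e)‖ ≤ 0 := by
    refine le_of_forall_pos_le_add fun ε hε => ?_
    have h := main (ε / circleMass lam) (div_pos hε (circleMass_pos hlam))
    rw [div_mul_cancel₀ _ (circleMass_pos hlam).ne'] at h
    simpa using h
  exact sub_eq_zero.1 (norm_le_zero_iff.1 hz)

end PoissonKernel

/-! ### Polar coordinates and the reproducing property -/

section PolarCoordinates

open Set Filter Topology

variable {lam : ℝ} {p : ℝ → ℝ → ℝ}

theorem diskConst_pos (hlam : 0 ≤ lam) : 0 < diskConst lam := by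
  unfold diskConst
  have h1 := Real.Gamma_pos_of_pos (s := lam + 2) (by linarith)
  have h2 := Real.Gamma_pos_of_pos (s := lam + 1 / 2) (by linarith)
  have h3 := Real.Gamma_pos_of_pos (s := 1 / 2) (by norm_num)
  positivity

/-- The radial factor of `diskMeasure` in polar coordinates. -/
noncomputable def radialMeasure (lam : ℝ) : Measure ℝ :=
  (volume.restrict (Ioo 0 1)).withDensity
    fun ρ => ENNReal.ofReal (diskConst lam * ρ ^ (2 * lam + 1))

/-- The angular factor of `diskMeasure` in polar coordinates. -/
noncomputable def circleMeasure (lam : ℝ) : Measure ℝ :=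
  (volume.restrict (Ioo (-Real.pi) Real.pi)).withDensity
    fun θ => ENNReal.ofReal (circleWeight lam θ)

theorem measurable_circleWeight : Measurable (circleWeight lam) := by
  unfold circleWeight; fun_prop

instance : SFinite (radialMeasure lam) := by unfold radialMeasure; infer_instance

instance : SFinite (circleMeasure lam) := by unfold circleMeasure; infer_instance

theorem measurable_polar : Measurable fun q : ℝ × ℝ => (q.1 : ℂ) * circlePt q.2 :=
  (Complex.measurable_ofReal.comp measurable_fst).mul
    (continuous_circlePt.measurable.comp measurable_snd)

/-- The measure `diskMeasure` in polar coordinates. -/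
theorem diskMeasure_eq_map (hlam : 0 ≤ lam) : diskMeasure lam =
    ((radialMeasure lam).prod (circleMeasure lam)).map fun q => (q.1 : ℂ) * circlePt q.2 := by
  refine Measure.ext fun s hs => ?_
  rw [Measure.map_apply measurable_polar hs, diskMeasure, withDensity_apply _ hs,
    Measure.restrict_restrict hs, ← lintegral_indicator (hs.inter Metric.isOpen_ball.measurableSet),
    ← Complex.lintegral_comp_polarCoord_symm, radialMeasure, circleMeasure,
    prod_withDensity (by fun_prop) measurable_circleWeight.ennreal_ofReal,
    withDensity_apply _ (measurable_polar hs), Measure.prod_restrict,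
    ← Measure.volume_eq_prod, Measure.restrict_restrict (measurable_polar hs),
    ← lintegral_indicator ((measurable_polar hs).inter
      (measurableSet_Ioo.prod measurableSet_Ioo)), ← lintegral_indicator
      polarCoord.open_target.measurableSet]
  refine lintegral_congr fun q => ?_
  obtain ⟨ρ, θ⟩ := q
  have hpt : Complex.polarCoord.symm (ρ, θ) = ρ * circlePt θ := by
    rw [Complex.polarCoord_symm_apply, circlePt_eq]
  have hmem : (ρ, θ) ∈ polarCoord.target ↔ 0 < ρ ∧ θ ∈ Ioo (-Real.pi) Real.pi := Iff.rfl
  by_cases h1 : (ρ, θ) ∈ (fun q : ℝ × ℝ => (q.1 : ℂ) * circlePt q.2) ⁻¹' s ∩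
      Ioo 0 1 ×ˢ Ioo (-Real.pi) Real.pi
  · have h0 := h1.2.1.1
    have hb : (ρ : ℂ) * circlePt θ ∈ s ∩ Metric.ball 0 1 :=
      ⟨h1.1, real_mul_circlePt_mem_ball (abs_lt.2 ⟨by linarith, h1.2.1.2⟩) θ⟩
    rw [indicator_of_mem h1, indicator_of_mem (hmem.2 ⟨h1.2.1.1, h1.2.2⟩), hpt,
      indicator_of_mem hb, smul_eq_mul, ← ENNReal.ofReal_mul h0.le,
      ← ENNReal.ofReal_mul (mul_nonneg (diskConst_pos hlam).le (by positivity)), Complex.im_ofReal_mul,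
      circlePt_im, abs_mul, abs_of_pos h0, Real.mul_rpow h0.le (abs_nonneg _), circleWeight,
      Real.rpow_add_one h0.ne']
    congr 1
    ring
  · rw [indicator_of_notMem h1]
    by_cases h2 : (ρ, θ) ∈ polarCoord.target
    · rw [indicator_of_mem h2, hpt, indicator_of_notMem, smul_zero]
      rintro ⟨h3, h4⟩
      rw [mem_ball_zero_iff, norm_real_mul_circlePt, abs_of_pos (hmem.1 h2).1] at h4
      exact h1 ⟨h3, ⟨(hmem.1 h2).1, h4⟩, (hmem.1 h2).2⟩
    · rw [indicator_of_notMem h2]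

theorem integral_circleMeasure (F : ℝ → ℂ) :
    ∫ θ, F θ ∂circleMeasure lam = ∫ θ in (-Real.pi)..Real.pi, circleWeight lam θ • F θ := by
  rw [circleMeasure, integral_withDensity_eq_integral_toReal_smul
    measurable_circleWeight.ennreal_ofReal (by simp), intervalIntegral.integral_of_le
    (by linarith [Real.pi_pos]), integral_Ioc_eq_integral_Ioo]
  simp only [ENNReal.toReal_ofReal (circleWeight_nonneg _)]

theorem ae_radialMeasure_mem : ∀ᵐ ρ ∂radialMeasure lam, ρ ∈ Ioo (0 : ℝ) 1 :=
  (withDensity_absolutelyContinuous _ _).ae_le (ae_restrict_mem measurableSet_Ioo)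

theorem integral_radialMeasure (hlam : 0 ≤ lam) (F : ℝ → ℂ) :
    ∫ ρ, F ρ ∂radialMeasure lam =
      ∫ ρ in (0 : ℝ)..1, (diskConst lam * ρ ^ (2 * lam + 1)) • F ρ := by
  rw [radialMeasure, integral_withDensity_eq_integral_toReal_smul (by fun_prop) (by simp),
    intervalIntegral.integral_of_le zero_le_one, integral_Ioc_eq_integral_Ioo]
  refine setIntegral_congr_fun measurableSet_Ioo fun ρ hρ => ?_
  rw [ENNReal.toReal_ofReal (mul_nonneg (diskConst_pos hlam).le (Real.rpow_nonneg hρ.1.le _))]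

theorem ae_diskMeasure_mem : ∀ᵐ z ∂diskMeasure lam, z ∈ Metric.ball (0 : ℂ) 1 :=
  (withDensity_absolutelyContinuous _ _).ae_le (ae_restrict_mem Metric.isOpen_ball.measurableSet)

theorem ae_diskMeasure_ne_zero : ∀ᵐ z ∂diskMeasure lam, z ≠ 0 :=
  ((withDensity_absolutelyContinuous _ _).trans Measure.restrict_le_self.absolutelyContinuous).ae_le
    (compl_mem_ae_iff.2 (measure_singleton 0))

theorem isFiniteMeasure_diskMeasure (hlam : 0 ≤ lam) : IsFiniteMeasure (diskMeasure lam) := by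
  have : IsFiniteMeasure ((volume : Measure ℂ).restrict (Metric.ball 0 1)) :=
    isFiniteMeasure_restrict.2 measure_ball_lt_top.ne
  refine isFiniteMeasure_withDensity_ofReal ?_
  refine HasFiniteIntegral.of_bounded (C := diskConst lam) ?_
  filter_upwards [ae_restrict_mem Metric.isOpen_ball.measurableSet] with z hz
  rw [mem_ball_zero_iff] at hz
  rw [Real.norm_of_nonneg (mul_nonneg (diskConst_pos hlam).le (by positivity))]
  refine mul_le_of_le_one_right (diskConst_pos hlam).le ?_
  exact Real.rpow_le_one (abs_nonneg _) ((Complex.abs_im_le_norm z).trans hz.le) (by positivity)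

theorem aestronglyMeasurable_diskMeasure {f : ℂ → ℂ} (hf : ContinuousOn f (Metric.ball 0 1)) :
    AEStronglyMeasurable f (diskMeasure lam) :=
  (hf.aestronglyMeasurable Metric.isOpen_ball.measurableSet).mono_ac
    (withDensity_absolutelyContinuous _ _)

/-- Integration in polar coordinates. -/
theorem integral_diskMeasure (hlam : 0 ≤ lam) {f : ℂ → ℂ} (hf : Integrable f (diskMeasure lam)) :
    ∫ z, f z ∂diskMeasure lam = ∫ ρ, ∫ θ, f (ρ * circlePt θ) ∂circleMeasure lam
      ∂radialMeasure lam := by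
  rw [diskMeasure_eq_map hlam] at hf ⊢
  rw [integral_map measurable_polar.aemeasurable hf.aestronglyMeasurable, integral_prod]
  exact (integrable_map_measure hf.aestronglyMeasurable measurable_polar.aemeasurable).1 hf

theorem lintegral_diskMeasure (hlam : 0 ≤ lam) {f : ℂ → ℝ≥0∞} (hf : Measurable f) :
    ∫⁻ z, f z ∂diskMeasure lam = ∫⁻ ρ, ∫⁻ θ, f (ρ * circlePt θ) ∂circleMeasure lam
      ∂radialMeasure lam := by
  rw [diskMeasure_eq_map hlam, lintegral_map hf measurable_polar,
    lintegral_prod (fun q : ℝ × ℝ => f (q.1 * circlePt q.2)) (hf.comp measurable_polar).aemeasurable]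

end PolarCoordinates

section Reproducing

open Set Filter Topology

variable {lam : ℝ} {p : ℝ → ℝ → ℝ}

theorem bergmanKer_eq (z w : ℂ) : bergmanKer lam p z w =
    eulerDeriv (fun z => cauchyKer p z w) z + (lam + 1) * cauchyKer p z w := rfl

/-- The derivative of the Cauchy formula along the radii. -/
theorem IsCauchyProfile.integral_mul_conj_bergmanKer_circle (hp : IsCauchyProfile lam p)
    (hlam : 0 ≤ lam) {f : ℂ → ℂ} (hf : IsLambdaAnalytic lam f) {z : ℂ} (hz : ‖z‖ < 1) (hz0 : z ≠ 0)
    {ρ : ℝ} (hρ : ρ ∈ Ioo (0 : ℝ) 1) :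
    ∫ θ in (-Real.pi)..Real.pi, circleWeight lam θ •
      (f (ρ * circlePt θ) * conj (bergmanKer lam p (ρ * circlePt θ) z)) =
    circleMass lam * (eulerDeriv f ((ρ ^ 2 : ℝ) * z) + (lam + 1) * f ((ρ ^ 2 : ℝ) * z)) := by
  have hr0 : 0 < ‖z‖ := norm_pos_iff.2 hz0
  obtain ⟨e, he, hze⟩ : ∃ e : ℂ, ‖e‖ = 1 ∧ z = ‖z‖ * e := by
    refine ⟨(‖z‖ : ℂ)⁻¹ * z, ?_, ?_⟩
    · rw [norm_mul, norm_inv, Complex.norm_real, norm_norm, inv_mul_cancel₀ hr0.ne']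
    · rw [mul_inv_cancel_left₀]; exact_mod_cast hr0.ne'
  have hg : IsLambdaAnalytic lam fun w => cauchyKer p w z := hp.isLambdaAnalytic_cauchyKer hz.le
  have hρ1 : |ρ| < 1 := abs_lt.2 ⟨by linarith [hρ.1], hρ.2⟩
  have cf := hf.continuous_circle hρ1
  have cg := hg.continuous_circle hρ1
  have cEg := hg.continuous_circle_eulerDeriv hρ1
  have cW := continuous_circleWeight hlam
  have formula : ∀ τ : ℝ, 0 < τ → τ * ρ < 1 →
      ∫ θ in (-Real.pi)..Real.pi, circleWeight lam θ •
        (f (ρ * circlePt θ) * conj (cauchyKer p ((τ * ρ : ℝ) * circlePt θ) z)) =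
      circleMass lam * f (τ * ((ρ ^ 2 : ℝ) * z)) := fun τ hτ hτρ => by
    have hpos : 0 < τ * ρ := mul_pos hτ hρ.1
    have h := hp.cauchy_formula hlam hf he hρ (t := τ * ρ * ‖z‖)
      ⟨by positivity, mul_lt_one_of_nonneg_of_lt_one_left hpos.le hτρ hz.le⟩
    have e1 : ∀ θ, cauchyKer p ((τ * ρ : ℝ) * circlePt θ) z =
        cauchyKer p ((τ * ρ * ‖z‖ : ℝ) * circlePt θ) e := fun θ => by
      nth_rw 1 [hze]
      rw [← cauchyKer_real_mul, ← mul_assoc, ← Complex.ofReal_mul, mul_comm ‖z‖]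
    have e2 : (τ : ℂ) * ((ρ ^ 2 : ℝ) * z) = (ρ * (τ * ρ * ‖z‖) : ℝ) * e := by
      nth_rw 1 [hze]; push_cast; ring
    simp only [e1, e2]
    exact h
  have hU : IsOpen {τ : ℝ | |τ * ρ| < 1} :=
    isOpen_lt (continuous_id.mul continuous_const).abs continuous_const
  have hFd : ContDiffOn ℝ 1 (Function.uncurry fun τ θ : ℝ =>
      f (ρ * circlePt θ) * conj (cauchyKer p ((τ * ρ : ℝ) * circlePt θ) z))
      ({τ : ℝ | |τ * ρ| < 1} ×ˢ univ) := by
    refine ContDiffOn.mul (hf.contDiffOn_comp_circle (a := fun _ => ρ) contDiffOn_const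
      fun _ _ => hρ1) ?_
    exact Complex.conjCLE.contDiff.comp_contDiffOn (hg.contDiffOn_comp_circle
      (a := fun τ => τ * ρ) (by fun_prop) fun τ hτ => hτ)
  have hd := hasDerivAt_circleIntegral hlam hU hFd (τ := 1) (by simpa using hρ1)
    (F' := fun θ => f (ρ * circlePt θ) * conj (eulerDeriv (fun w => cauchyKer p w z)
      (ρ * circlePt θ))) fun θ => by
      have h := Complex.conjCLE.hasFDerivAt.comp_hasDerivAt 1
        (hg.hasDerivAt_radial (a := fun τ => τ * ρ) ((hasDerivAt_id (1 : ℝ)).mul_const ρ)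
          (by simpa using hρ1) (by simpa using hρ.1.ne') θ)
      refine (h.const_mul (f (ρ * circlePt θ))).congr_deriv ?_
      have : (ρ : ℂ) ≠ 0 := by exact_mod_cast hρ.1.ne'
      simp [this]
  have hz2 : (ρ ^ 2 : ℝ) * z ∈ Metric.ball (0 : ℂ) 1 := by
    rw [mem_ball_zero_iff, norm_mul, Complex.norm_real, Real.norm_of_nonneg (by positivity)]
    exact mul_lt_one_of_nonneg_of_lt_one_left (by positivity)
      (pow_lt_one₀ hρ.1.le hρ.2 (by norm_num)) hz.le
  have hd2 : HasDerivAt (fun τ : ℝ => circleMass lam * f (τ * ((ρ ^ 2 : ℝ) * z)))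
      (circleMass lam * eulerDeriv f ((ρ ^ 2 : ℝ) * z)) 1 := by
    have h := hasDerivAt_comp_real_mul (f := f) (z := (ρ ^ 2 : ℝ) * z) (r := 1)
      (by simpa using hf.differentiableAt hz2)
    rw [Complex.ofReal_one, one_mul] at h
    exact h.const_mul _
  have hev : (fun τ : ℝ => ∫ θ in (-Real.pi)..Real.pi, circleWeight lam θ •
        (f (ρ * circlePt θ) * conj (cauchyKer p ((τ * ρ : ℝ) * circlePt θ) z))) =ᶠ[𝓝 1]
      fun τ => circleMass lam * f (τ * ((ρ ^ 2 : ℝ) * z)) := by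
    have h1 : ∀ᶠ τ : ℝ in 𝓝 1, 0 < τ := lt_mem_nhds one_pos
    have h2 : ∀ᶠ τ : ℝ in 𝓝 1, τ * ρ < 1 :=
      (continuous_id.mul continuous_const).continuousAt.eventually_lt continuousAt_const
        (by simpa using hρ.2)
    filter_upwards [h1, h2] with τ h1 h2 using formula τ h1 h2
  have hE := (hd.congr_of_eventuallyEq hev.symm).unique hd2
  have hC := formula 1 one_pos (by simpa using hρ.2)
  simp only [one_mul, Complex.ofReal_one] at hC
  rw [mul_add, ← hE, mul_left_comm, ← hC, ← intervalIntegral.integral_const_mul,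
    ← intervalIntegral.integral_add]
  · refine intervalIntegral.integral_congr fun θ _ => ?_
    simp only [bergmanKer_eq, Complex.real_smul, map_add, map_mul, Complex.conj_ofReal, map_one]
    ring
  · exact (cW.smul (cf.mul (Complex.continuous_conj.comp cEg))).intervalIntegrable _ _
  · exact (continuous_const.mul
      (cW.smul (cf.mul (Complex.continuous_conj.comp cg)))).intervalIntegrable _ _

theorem IsCauchyProfile.continuousOn_bergmanKer_left (hp : IsCauchyProfile lam p) {z : ℂ}
    (hz : ‖z‖ < 1) : ContinuousOn (bergmanKer lam p z) (Metric.closedBall 0 1) :=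
  hp.continuousOn_bergmanKer.comp (f := fun w => (z, w)) (by fun_prop) fun w hw => by
    rw [mem_closedBall_zero_iff] at hw
    exact (mul_le_of_le_one_right (norm_nonneg _) hw).trans_lt hz

theorem IsCauchyProfile.integrable_bergmanKer_mul (hp : IsCauchyProfile lam p) {z : ℂ}
    (hz : ‖z‖ < 1) {f : ℂ → ℂ} (hf : Integrable f (diskMeasure lam)) :
    Integrable (fun w => bergmanKer lam p z w * f w) (diskMeasure lam) := by
  have hc := hp.continuousOn_bergmanKer_left hz
  obtain ⟨M, hM⟩ := (isCompact_closedBall (0 : ℂ) 1).exists_bound_of_continuousOn hc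
  refine hf.bdd_mul (c := M)
    (aestronglyMeasurable_diskMeasure (hc.mono Metric.ball_subset_closedBall)) ?_
  filter_upwards [ae_diskMeasure_mem] with w hw using hM w (Metric.ball_subset_closedBall hw)

/-- The reproducing property. -/
theorem IsCauchyProfile.integral_bergmanKer_mul (hp : IsCauchyProfile lam p) (hlam : 0 ≤ lam)
    {f : ℂ → ℂ} (hf : IsLambdaAnalytic lam f) (hfi : Integrable f (diskMeasure lam)) {z : ℂ}
    (hz : ‖z‖ < 1) (hz0 : z ≠ 0) :
    ∫ w, bergmanKer lam p z w * f w ∂diskMeasure lam =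
      (diskConst lam * circleMass lam / 2 : ℝ) * f z := by
  rw [integral_diskMeasure hlam (hp.integrable_bergmanKer_mul hz hfi)]
  have h1 : ∀ᵐ ρ : ℝ ∂radialMeasure lam,
      ∫ θ, bergmanKer lam p z (ρ * circlePt θ) * f (ρ * circlePt θ) ∂circleMeasure lam =
      circleMass lam * (eulerDeriv f ((ρ ^ 2 : ℝ) * z) + (lam + 1) * f ((ρ ^ 2 : ℝ) * z)) := by
    filter_upwards [ae_radialMeasure_mem] with ρ hρ
    rw [integral_circleMeasure, ← hp.integral_mul_conj_bergmanKer_circle hlam hf hz hz0 hρ]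
    refine intervalIntegral.integral_congr fun θ _ => ?_
    have : ‖(ρ : ℂ) * circlePt θ‖ * ‖z‖ < 1 := by
      rw [norm_real_mul_circlePt, abs_of_pos hρ.1]
      exact mul_lt_one_of_nonneg_of_lt_one_left hρ.1.le hρ.2 hz.le
    rw [hp.conj_bergmanKer this, mul_comm (f _)]
  rw [integral_congr_ae h1, integral_radialMeasure hlam]
  -- `2 ρ ^ (2 lam + 1) (E f + (lam + 1) f)(ρ² z)` is the derivative of `ρ ^ (2 lam + 2) f (ρ² z)`.
  have hmem : ∀ ρ ∈ Icc (0 : ℝ) 1, (ρ ^ 2 : ℝ) * z ∈ Metric.ball (0 : ℂ) 1 := fun ρ hρ => by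
    rw [mem_ball_zero_iff, norm_mul, Complex.norm_real, Real.norm_of_nonneg (by positivity)]
    exact (mul_le_of_le_one_left (norm_nonneg _) (pow_le_one₀ hρ.1 hρ.2)).trans_lt hz
  have cpt : ContinuousOn (fun ρ : ℝ => ((ρ ^ 2 : ℝ) : ℂ) * z) (Icc 0 1) := by fun_prop
  have cf : ContinuousOn (fun ρ : ℝ => f ((ρ ^ 2 : ℝ) * z)) (Icc 0 1) :=
    hf.1.continuousOn.comp cpt hmem
  have cE : ContinuousOn (fun ρ : ℝ => eulerDeriv f ((ρ ^ 2 : ℝ) * z)) (Icc 0 1) :=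
    hf.continuousOn_eulerDeriv.comp cpt hmem
  have cpow : ∀ a : ℝ, 0 ≤ a → ContinuousOn (fun ρ : ℝ => ((ρ ^ a : ℝ) : ℂ)) (Icc 0 1) :=
    fun a ha => (Complex.continuous_ofReal.comp (Real.continuous_rpow_const ha)).continuousOn
  have hftc := intervalIntegral.integral_eq_sub_of_hasDerivAt_of_le zero_le_one
    (f := fun ρ : ℝ => ((ρ ^ (2 * lam + 2) : ℝ) : ℂ) * f ((ρ ^ 2 : ℝ) * z))
    (f' := fun ρ : ℝ => 2 * ((ρ ^ (2 * lam + 1) : ℝ) : ℂ) *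
      (eulerDeriv f ((ρ ^ 2 : ℝ) * z) + (lam + 1) * f ((ρ ^ 2 : ℝ) * z)))
    ((cpow _ (by positivity)).mul cf)
    (fun ρ hρ => by
      have hρ0 := hρ.1.ne'
      have d1 : HasDerivAt (fun ρ : ℝ => ((ρ ^ (2 * lam + 2) : ℝ) : ℂ))
          (((2 * lam + 2) * ρ ^ (2 * lam + 2 - 1) : ℝ) : ℂ) ρ :=
        (Real.hasDerivAt_rpow_const (Or.inl hρ0)).ofReal_comp
      have d2 := HasDerivAt.scomp (h := fun ρ : ℝ => ρ ^ 2) ρ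
        (hasDerivAt_comp_real_mul (f := f) (z := z)
          (hf.differentiableAt (hmem ρ (Ioo_subset_Icc_self hρ)))) (hasDerivAt_pow 2 ρ)
      refine (d1.mul d2).congr_deriv ?_
      have e1 : eulerDeriv f ((ρ ^ 2 : ℝ) * z) =
          (ρ ^ 2 : ℝ) * fderiv ℝ f ((ρ ^ 2 : ℝ) * z) z := by
        rw [eulerDeriv, ← Complex.real_smul (x := ρ ^ 2), map_smul, Complex.real_smul,
          Complex.real_smul]
      have e2 : ρ ^ (2 * lam + 2) = ρ ^ (2 * lam + 1) * ρ := by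
        rw [← Real.rpow_add_one hρ0]; ring_nf
      rw [e1, e2, show 2 * lam + 2 - 1 = 2 * lam + 1 by ring]
      simp only [Complex.real_smul, Function.comp_apply]
      push_cast
      ring)
    (ContinuousOn.intervalIntegrable (by
      rw [uIcc_of_le zero_le_one]
      exact (continuousOn_const.mul (cpow _ (by positivity))).mul
        (cE.add (continuousOn_const.mul cf))))
  have e : ∀ ρ : ℝ, (diskConst lam * ρ ^ (2 * lam + 1)) • (circleMass lam *
      (eulerDeriv f ((ρ ^ 2 : ℝ) * z) + (lam + 1) * f ((ρ ^ 2 : ℝ) * z))) =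
      (diskConst lam * circleMass lam / 2 : ℝ) * (2 * ((ρ ^ (2 * lam + 1) : ℝ) : ℂ) *
      (eulerDeriv f ((ρ ^ 2 : ℝ) * z) + (lam + 1) * f ((ρ ^ 2 : ℝ) * z))) := fun ρ => by
    rw [Complex.real_smul]; push_cast; ring
  simp only [e]
  rw [intervalIntegral.integral_const_mul, hftc, Real.zero_rpow (by positivity)]
  simp

end Reproducing

/-! ### Schur's test for the Bergman kernel -/

section SchurEstimate

open Set Filter Topology

variable {lam : ℝ} {p : ℝ → ℝ → ℝ}

theorem lintegral_Ioc_rpow {b s : ℝ} (hb1 : b < 1) (hs : 0 < s) :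
    ∫⁻ u in Ioc 0 s, ENNReal.ofReal (u ^ (-b)) = ENNReal.ofReal (s ^ (1 - b) / (1 - b)) := by
  have hint := intervalIntegral.intervalIntegrable_rpow' (a := 0) (b := s) (r := -b) (by linarith)
  rw [intervalIntegrable_iff_integrableOn_Ioc_of_le hs.le] at hint
  rw [← ofReal_integral_eq_lintegral_ofReal hint, ← intervalIntegral.integral_of_le hs.le,
    integral_rpow (Or.inl (by linarith)), Real.zero_rpow (by linarith), sub_zero,
    show -b + 1 = 1 - b by ring]
  filter_upwards [ae_restrict_mem measurableSet_Ioc] with u hu using Real.rpow_nonneg hu.1.le _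

theorem lintegral_Ioi_rpow {b s : ℝ} (hb : 0 < b) (hs : 0 < s) :
    ∫⁻ u in Ioi s, ENNReal.ofReal (u ^ (-b - 1)) = ENNReal.ofReal (s ^ (-b) / b) := by
  rw [← ofReal_integral_eq_lintegral_ofReal (integrableOn_Ioi_rpow_of_lt (by linarith) hs),
    integral_Ioi_rpow_of_lt (by linarith) hs]
  · congr 1
    rw [show -b - 1 + 1 = -b by ring, div_neg, neg_div, neg_neg]
  · filter_upwards [ae_restrict_mem measurableSet_Ioi] with u hu
      using Real.rpow_nonneg (hs.trans hu).le _

/-- The radial integral in Schur's test; the integrand is split at `1 - ρ = 1 - r`. -/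
theorem lintegral_one_sub_rpow_div_le {b r : ℝ} (hb : 0 < b) (hb1 : b < 1) (hr : 0 ≤ r)
    (hr1 : r < 1) :
    ∫⁻ ρ in Ioo 0 1, ENNReal.ofReal ((1 - ρ) ^ (-b) / (1 - ρ * r)) ≤
      ENNReal.ofReal ((1 / (1 - b) + 1 / b) * (1 - r) ^ (-b)) := by
  set s := 1 - r with hs
  have hs0 : 0 < s := by linarith
  have hb1' : 0 < 1 - b := by linarith
  have hsub : ∫⁻ ρ in Ioo (0 : ℝ) 1, ENNReal.ofReal ((1 - ρ) ^ (-b) / (1 - ρ * r)) =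
      ∫⁻ u in Ioo (0 : ℝ) 1, ENNReal.ofReal (u ^ (-b) / (1 - (1 - u) * r)) := by
    have h := (Measure.measurePreserving_sub_left (volume : Measure ℝ) 1).setLIntegral_comp_preimage
      (s := Ioo 0 1) measurableSet_Ioo
      (f := fun u => ENNReal.ofReal (u ^ (-b) / (1 - (1 - u) * r))) (by fun_prop)
    rw [← h]
    have hpre : (fun x : ℝ => 1 - x) ⁻¹' Ioo 0 1 = Ioo 0 1 := by
      ext x; simp only [mem_preimage, mem_Ioo]; constructor <;> rintro ⟨h1, h2⟩ <;>
        constructor <;> linarith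
    rw [hpre]
    simp
  rw [hsub]
  calc ∫⁻ u in Ioo (0 : ℝ) 1, ENNReal.ofReal (u ^ (-b) / (1 - (1 - u) * r))
      ≤ ∫⁻ u in Ioc 0 s ∪ Ioo s 1, ENNReal.ofReal (u ^ (-b) / (1 - (1 - u) * r)) :=
        lintegral_mono_set fun u hu => (le_or_gt u s).imp (fun h => ⟨hu.1, h⟩) fun h => ⟨h, hu.2⟩
    _ ≤ (∫⁻ u in Ioc 0 s, ENNReal.ofReal (u ^ (-b) / (1 - (1 - u) * r))) +
        ∫⁻ u in Ioo s 1, ENNReal.ofReal (u ^ (-b) / (1 - (1 - u) * r)) :=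
        lintegral_union_le _ _ _
    _ ≤ (∫⁻ u in Ioc 0 s, ENNReal.ofReal s⁻¹ * ENNReal.ofReal (u ^ (-b))) +
        ∫⁻ u in Ioi s, ENNReal.ofReal (u ^ (-b - 1)) := by
        refine add_le_add (setLIntegral_mono' measurableSet_Ioc fun u hu => ?_)
          ((setLIntegral_mono' measurableSet_Ioo fun u hu => ?_).trans
            (lintegral_mono_set Ioo_subset_Ioi_self))
        · rw [← ENNReal.ofReal_mul (by positivity)]
          refine ENNReal.ofReal_le_ofReal ?_
          rw [div_eq_inv_mul]
          refine mul_le_mul_of_nonneg_right (inv_anti₀ hs0 ?_) (Real.rpow_nonneg hu.1.le _)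
          nlinarith [hu.1]
        · have hu0 : 0 < u := hs0.trans hu.1
          refine ENNReal.ofReal_le_ofReal ?_
          rw [Real.rpow_sub_one hu0.ne']
          refine div_le_div_of_nonneg_left (Real.rpow_nonneg hu0.le _) hu0 ?_
          nlinarith [mul_nonneg hs0.le (sub_nonneg.2 hu.2.le)]
    _ = ENNReal.ofReal ((1 / (1 - b) + 1 / b) * s ^ (-b)) := by
        rw [lintegral_const_mul _ (by fun_prop), lintegral_Ioc_rpow hb1 hs0,
          lintegral_Ioi_rpow hb hs0, ← ENNReal.ofReal_mul (by positivity),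
          ← ENNReal.ofReal_add (by positivity) (by positivity)]
        congr 1
        rw [show (1 - b : ℝ) = -b + 1 by ring, Real.rpow_add_one hs0.ne']
        rw [show -b + 1 = 1 - b by ring]
        field_simp

/-- The Bergman kernel cut off to the bidisk. -/
noncomputable def diskKer (lam : ℝ) (p : ℝ → ℝ → ℝ) (z w : ℂ) : ℂ :=
  (Metric.ball (0 : ℂ) 1 ×ˢ Metric.ball (0 : ℂ) 1).indicator
    (Function.uncurry (bergmanKer lam p)) (z, w)

theorem diskKer_eq {z w : ℂ} (hz : z ∈ Metric.ball (0 : ℂ) 1) (hw : w ∈ Metric.ball (0 : ℂ) 1) :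
    diskKer lam p z w = bergmanKer lam p z w :=
  indicator_of_mem (s := Metric.ball (0 : ℂ) 1 ×ˢ Metric.ball (0 : ℂ) 1) ⟨hz, hw⟩ _

theorem diskKer_eq_zero {z w : ℂ}
    (h : ¬(z ∈ Metric.ball (0 : ℂ) 1 ∧ w ∈ Metric.ball (0 : ℂ) 1)) : diskKer lam p z w = 0 :=
  indicator_of_notMem (s := Metric.ball (0 : ℂ) 1 ×ˢ Metric.ball (0 : ℂ) 1) h _

theorem norm_mul_norm_lt_one {z w : ℂ} (hz : z ∈ Metric.ball (0 : ℂ) 1)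
    (hw : w ∈ Metric.ball (0 : ℂ) 1) : ‖z‖ * ‖w‖ < 1 := by
  rw [mem_ball_zero_iff] at hz hw
  exact mul_lt_one_of_nonneg_of_lt_one_left (norm_nonneg _) hz hw.le

theorem IsCauchyProfile.conj_diskKer (hp : IsCauchyProfile lam p) (z w : ℂ) :
    conj (diskKer lam p z w) = diskKer lam p w z := by
  by_cases h : z ∈ Metric.ball (0 : ℂ) 1 ∧ w ∈ Metric.ball (0 : ℂ) 1
  · rw [diskKer_eq h.1 h.2, diskKer_eq h.2 h.1, hp.conj_bergmanKer (norm_mul_norm_lt_one h.1 h.2)]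
  · rw [diskKer_eq_zero h, diskKer_eq_zero (fun h' => h h'.symm), map_zero]

theorem IsCauchyProfile.measurable_diskKer (hp : IsCauchyProfile lam p) :
    Measurable (Function.uncurry (diskKer lam p)) := by
  classical
  have h : Function.uncurry (diskKer lam p) =
      (Metric.ball (0 : ℂ) 1 ×ˢ Metric.ball (0 : ℂ) 1).piecewise
        (Function.uncurry (bergmanKer lam p)) 0 := by
    rw [piecewise_eq_indicator]; rfl
  rw [h]
  refine ContinuousOn.measurable_piecewise (hp.continuousOn_bergmanKer.mono fun q hq =>
    norm_mul_norm_lt_one hq.1 hq.2) continuousOn_const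
    (Metric.isOpen_ball.measurableSet.prod Metric.isOpen_ball.measurableSet)

theorem IsCauchyProfile.measurable_diskKer_left (hp : IsCauchyProfile lam p) (z : ℂ) :
    Measurable (diskKer lam p z) :=
  hp.measurable_diskKer.of_uncurry_left

theorem IsCauchyProfile.exists_lintegral_circle_le (hp : IsCauchyProfile lam p) (hlam : 0 ≤ lam) :
    ∃ C, 0 < C ∧ ∀ z ∈ Metric.ball (0 : ℂ) 1, ∀ ρ ∈ Ioo (0 : ℝ) 1,
      ∫⁻ θ, ‖diskKer lam p z (ρ * circlePt θ)‖ₑ ∂circleMeasure lam ≤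
        ENNReal.ofReal (C / (1 - ρ * ‖z‖)) := by
  obtain ⟨C, hC, h⟩ := hp.exists_norm_bergmanKer_mul_le hlam
  refine ⟨C * (4 * Real.pi), by positivity, fun z hz ρ hρ => ?_⟩
  have hz1 : ‖z‖ < 1 := by simpa using hz
  have hρz : ρ * ‖z‖ < 1 := mul_lt_one_of_nonneg_of_lt_one_left hρ.1.le hρ.2 hz1.le
  have hn1 : ‖(ρ : ℂ) * conj z‖ = ρ * ‖z‖ := by
    rw [norm_mul, RCLike.norm_conj, Complex.norm_real, Real.norm_of_nonneg hρ.1.le]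
  have hn2 : ‖(ρ : ℂ) * z‖ = ρ * ‖z‖ := by
    rw [norm_mul, Complex.norm_real, Real.norm_of_nonneg hρ.1.le]
  have c1 : Continuous fun θ : ℝ => (‖1 - circlePt θ * (ρ * conj z)‖ ^ 2)⁻¹ :=
    continuous_norm_one_sub_sq_inv (hn1.trans_lt hρz)
  have c2 : Continuous fun θ : ℝ => (‖1 - circlePt θ * (ρ * z)‖ ^ 2)⁻¹ :=
    continuous_norm_one_sub_sq_inv (hn2.trans_lt hρz)
  have i1 : ∫ θ in (-Real.pi)..Real.pi, (‖1 - circlePt θ * (ρ * conj z)‖ ^ 2)⁻¹ =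
      2 * Real.pi / (1 - ‖(ρ : ℂ) * conj z‖ ^ 2) :=
    integral_norm_one_sub_sq_inv (hn1.trans_lt hρz)
  have i2 : ∫ θ in (-Real.pi)..Real.pi, (‖1 - circlePt θ * (ρ * z)‖ ^ 2)⁻¹ =
      2 * Real.pi / (1 - ‖(ρ : ℂ) * z‖ ^ 2) :=
    integral_norm_one_sub_sq_inv (hn2.trans_lt hρz)
  have cG : Continuous fun θ : ℝ => C * ((‖1 - circlePt θ * (ρ * conj z)‖ ^ 2)⁻¹ +
      (‖1 - circlePt θ * (ρ * z)‖ ^ 2)⁻¹) := continuous_const.mul (c1.add c2)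
  have hmeas : Measurable fun θ => ‖diskKer lam p z (ρ * circlePt θ)‖ₑ :=
    ((hp.measurable_diskKer_left z).comp
      (measurable_const.mul continuous_circlePt.measurable)).enorm
  rw [circleMeasure, lintegral_withDensity_eq_lintegral_mul _
    measurable_circleWeight.ennreal_ofReal hmeas]
  calc ∫⁻ θ in Ioo (-Real.pi) Real.pi, ((fun θ => ENNReal.ofReal (circleWeight lam θ)) *
        fun θ => ‖diskKer lam p z (ρ * circlePt θ)‖ₑ) θ
      ≤ ∫⁻ θ in Ioc (-Real.pi) Real.pi, ENNReal.ofReal (C * (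
        (‖1 - circlePt θ * (ρ * conj z)‖ ^ 2)⁻¹ + (‖1 - circlePt θ * (ρ * z)‖ ^ 2)⁻¹)) := by
        refine (lintegral_mono_set Ioo_subset_Ioc_self).trans (lintegral_mono fun θ => ?_)
        have hw : (ρ : ℂ) * circlePt θ ∈ Metric.ball (0 : ℂ) 1 :=
          real_mul_circlePt_mem_ball (abs_lt.2 ⟨by linarith [hρ.1], hρ.2⟩) θ
        rw [Pi.mul_apply, diskKer_eq hz hw, ← hp.conj_bergmanKer (norm_mul_norm_lt_one hw hz),
          RCLike.enorm_conj, ← ofReal_norm, ← ENNReal.ofReal_mul (circleWeight_nonneg _)]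
        refine ENNReal.ofReal_le_ofReal ?_
        rw [mul_comm]
        exact h ρ θ z (by rwa [abs_of_pos hρ.1])
    _ = ENNReal.ofReal (∫ θ in (-Real.pi)..Real.pi, C * (
        (‖1 - circlePt θ * (ρ * conj z)‖ ^ 2)⁻¹ + (‖1 - circlePt θ * (ρ * z)‖ ^ 2)⁻¹)) := by
        rw [intervalIntegral.integral_of_le (by linarith [Real.pi_pos]),
          ofReal_integral_eq_lintegral_ofReal]
        · exact (cG.intervalIntegrable _ _).1
        · exact Eventually.of_forall fun θ => by positivity
    _ ≤ _ := by
        refine ENNReal.ofReal_le_ofReal ?_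
        rw [intervalIntegral.integral_const_mul, intervalIntegral.integral_add
          (c1.intervalIntegrable _ _) (c2.intervalIntegrable _ _), i1, i2, hn1, hn2]
        have h0 : 0 ≤ ρ * ‖z‖ := mul_nonneg hρ.1.le (norm_nonneg _)
        have h1 : 0 < 1 - ρ * ‖z‖ := by linarith
        have h2 : 2 * Real.pi / (1 - (ρ * ‖z‖) ^ 2) ≤ 2 * Real.pi / (1 - ρ * ‖z‖) := by
          refine div_le_div_of_nonneg_left (by positivity) h1 ?_
          nlinarith
        calc C * (2 * Real.pi / (1 - (ρ * ‖z‖) ^ 2) + 2 * Real.pi / (1 - (ρ * ‖z‖) ^ 2))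
            ≤ C * (2 * Real.pi / (1 - ρ * ‖z‖) + 2 * Real.pi / (1 - ρ * ‖z‖)) := by gcongr
          _ = _ := by ring

/-- The powers `(1 - ‖z‖) ^ (-b)`, `0 < b < 1`, are test functions for Schur's test. -/
theorem IsCauchyProfile.exists_lintegral_diskKer_mul_rpow_le (hp : IsCauchyProfile lam p)
    (hlam : 0 ≤ lam) {b : ℝ} (hb : 0 < b) (hb1 : b < 1) :
    ∃ A : ℝ≥0∞, A ≠ ∞ ∧ ∀ z ∈ Metric.ball (0 : ℂ) 1,
      ∫⁻ w, ‖diskKer lam p z w‖ₑ * ENNReal.ofReal ((1 - ‖w‖) ^ (-b)) ∂diskMeasure lam ≤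
        A * ENNReal.ofReal ((1 - ‖z‖) ^ (-b)) := by
  obtain ⟨C, hC, h⟩ := hp.exists_lintegral_circle_le hlam
  have hb1' : 0 < 1 - b := by linarith
  refine ⟨ENNReal.ofReal (diskConst lam * C * (1 / (1 - b) + 1 / b)), ENNReal.ofReal_ne_top,
    fun z hz => ?_⟩
  have hd := diskConst_pos hlam
  have hz1 : ‖z‖ < 1 := by simpa using hz
  have hm : Measurable fun w => ‖diskKer lam p z w‖ₑ * ENNReal.ofReal ((1 - ‖w‖) ^ (-b)) :=
    (hp.measurable_diskKer_left z).enorm.mul (by fun_prop)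
  rw [lintegral_diskMeasure hlam hm]
  calc ∫⁻ ρ, ∫⁻ θ, ‖diskKer lam p z (ρ * circlePt θ)‖ₑ *
        ENNReal.ofReal ((1 - ‖(ρ : ℂ) * circlePt θ‖) ^ (-b)) ∂circleMeasure lam ∂radialMeasure lam
      ≤ ∫⁻ ρ, ENNReal.ofReal (C * ((1 - ρ) ^ (-b) / (1 - ρ * ‖z‖))) ∂radialMeasure lam := by
        refine lintegral_mono_ae ?_
        filter_upwards [ae_radialMeasure_mem] with ρ hρ
        simp only [norm_real_mul_circlePt, abs_of_pos hρ.1]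
        have hmθ : Measurable fun θ => ‖diskKer lam p z (ρ * circlePt θ)‖ₑ :=
          ((hp.measurable_diskKer_left z).comp
            (measurable_const.mul continuous_circlePt.measurable)).enorm
        rw [lintegral_mul_const _ hmθ]
        refine (mul_le_mul_left (h z hz ρ hρ) _).trans (le_of_eq ?_)
        have h1 : 0 < 1 - ρ * ‖z‖ := by
          have := mul_lt_one_of_nonneg_of_lt_one_left hρ.1.le hρ.2 hz1.le
          linarith
        rw [← ENNReal.ofReal_mul (by positivity)]
        congr 1
        ring
    _ ≤ ∫⁻ ρ in Ioo 0 1, ENNReal.ofReal (diskConst lam * C) *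
          ENNReal.ofReal ((1 - ρ) ^ (-b) / (1 - ρ * ‖z‖)) := by
        rw [radialMeasure, lintegral_withDensity_eq_lintegral_mul _ (by fun_prop) (by fun_prop)]
        refine setLIntegral_mono' measurableSet_Ioo fun ρ hρ => ?_
        have hpow : ρ ^ (2 * lam + 1) ≤ 1 := Real.rpow_le_one hρ.1.le hρ.2.le (by positivity)
        have hpow0 : 0 ≤ ρ ^ (2 * lam + 1) := Real.rpow_nonneg hρ.1.le _
        have h1 : 0 < 1 - ρ * ‖z‖ := by
          have := mul_lt_one_of_nonneg_of_lt_one_left hρ.1.le hρ.2 hz1.le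
          linarith
        have h2 : 0 ≤ (1 - ρ) ^ (-b) / (1 - ρ * ‖z‖) :=
          div_nonneg (Real.rpow_nonneg (by linarith [hρ.2]) _) h1.le
        rw [Pi.mul_apply, ← ENNReal.ofReal_mul (by positivity), ← ENNReal.ofReal_mul (by positivity),
          mul_assoc (diskConst lam)]
        refine ENNReal.ofReal_le_ofReal ?_
        rw [mul_assoc]
        exact mul_le_mul_of_nonneg_left (mul_le_of_le_one_left (by positivity) hpow) hd.le
    _ ≤ ENNReal.ofReal (diskConst lam * C) *
          ENNReal.ofReal ((1 / (1 - b) + 1 / b) * (1 - ‖z‖) ^ (-b)) := by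
        rw [lintegral_const_mul _ (by fun_prop)]
        exact mul_le_mul_right (lintegral_one_sub_rpow_div_le hb hb1 (norm_nonneg _) hz1) _
    _ = _ := by
        rw [← ENNReal.ofReal_mul (by positivity), ← ENNReal.ofReal_mul (by positivity)]
        congr 1
        ring

/-- The maximal Bergman operator is bounded on `L^r` for `1 < r < ∞`; Schur's test with the function
`(1 - ‖z‖) ^ (-1 / (r s))`. -/
theorem IsCauchyProfile.exists_lintegral_rpow_diskKer_le (hp : IsCauchyProfile lam p)
    (hlam : 0 ≤ lam) {r s : ℝ} (hrs : r.HolderConjugate s) :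
    ∃ A : ℝ≥0∞, A ≠ ∞ ∧ ∀ f : ℂ → ℝ≥0∞, AEMeasurable f (diskMeasure lam) →
      ∫⁻ z, (∫⁻ w, ‖diskKer lam p z w‖ₑ * f w ∂diskMeasure lam) ^ r ∂diskMeasure lam ≤
        A ^ r * ∫⁻ z, f z ^ r ∂diskMeasure lam := by
  have := isFiniteMeasure_diskMeasure hlam
  have hr0 := hrs.pos
  have hs0 := hrs.symm.pos
  obtain ⟨A₁, hA₁, h₁⟩ := hp.exists_lintegral_diskKer_mul_rpow_le hlam (b := 1 / r) (by positivity)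
    ((div_lt_one hr0).2 hrs.lt)
  obtain ⟨A₂, hA₂, h₂⟩ := hp.exists_lintegral_diskKer_mul_rpow_le hlam (b := 1 / s) (by positivity)
    ((div_lt_one hs0).2 hrs.symm.lt)
  refine ⟨max A₁ A₂, (max_lt hA₁.lt_top hA₂.lt_top).ne, fun f hf => ?_⟩
  set h : ℂ → ℝ≥0∞ := fun z => ENNReal.ofReal ((1 - ‖z‖) ^ (-(1 / (r * s)))) with hh
  have hpow : ∀ t u : ℝ, 0 ≤ t → 1 / (r * s) * t = 1 / u → ∀ z ∈ Metric.ball (0 : ℂ) 1,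
      h z ^ t = ENNReal.ofReal ((1 - ‖z‖) ^ (-(1 / u))) := fun t u ht htu z hz => by
    have hz1 : 0 < 1 - ‖z‖ := by have : ‖z‖ < 1 := by simpa using hz
                                 linarith
    rw [hh, ENNReal.ofReal_rpow_of_nonneg (by positivity) ht, ← Real.rpow_mul hz1.le, neg_mul, htu]
  have e1 : 1 / (r * s) * s = 1 / r := by field_simp
  have e2 : 1 / (r * s) * r = 1 / s := by field_simp
  refine lintegral_rpow_lintegral_mul_le_of_schur hrs (k := fun z w => ‖diskKer lam p z w‖ₑ)
    (h := h) hp.measurable_diskKer.enorm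
    (fun z w => by rw [← hp.conj_diskKer z w, RCLike.enorm_conj]) (by rw [hh]; fun_prop) ?_
    (Eventually.of_forall fun z => ENNReal.ofReal_ne_top) ?_ ?_ hf
  · filter_upwards [ae_diskMeasure_mem] with z hz
    have hz1 : 0 < 1 - ‖z‖ := by have : ‖z‖ < 1 := by simpa using hz
                                 linarith
    exact (ENNReal.ofReal_pos.2 (Real.rpow_pos_of_pos hz1 _)).ne'
  · filter_upwards [ae_diskMeasure_mem] with z hz
    rw [hpow s r hs0.le e1 z hz]
    refine le_trans (le_of_eq (lintegral_congr_ae ?_)) ((h₁ z hz).trans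
      (mul_le_mul_left (le_max_left _ _) _))
    filter_upwards [ae_diskMeasure_mem] with w hw
    rw [hpow s r hs0.le e1 w hw]
  · filter_upwards [ae_diskMeasure_mem] with z hz
    rw [hpow r s hr0.le e2 z hz]
    refine le_trans (le_of_eq (lintegral_congr_ae ?_)) ((h₂ z hz).trans
      (mul_le_mul_left (le_max_right _ _) _))
    filter_upwards [ae_diskMeasure_mem] with w hw
    rw [hpow r s hr0.le e2 w hw]

end SchurEstimate

/-! ### The Bergman projection -/

section BergmanProjection

open Set Filter Topology

variable {lam : ℝ} {p : ℝ → ℝ → ℝ}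

/-- The Euler derivative preserves `lam`-analyticity: `D_{z̄}` is homogeneous of degree `-1`, so
that `D_{z̄} E F` is the derivative of `s ↦ D_{z̄} (F (s ·))` at `s = 1`. -/
theorem IsLambdaAnalytic.eulerDeriv {F : ℂ → ℂ} (hF : IsLambdaAnalytic lam F)
    (hF3 : ContDiffOn ℝ 3 F (Metric.ball 0 1)) : IsLambdaAnalytic lam (eulerDeriv F) := by
  have hG : ContDiffOn ℝ 2 (fderiv ℝ F) (Metric.ball 0 1) :=
    hF3.fderiv_of_isOpen Metric.isOpen_ball (by norm_num)
  refine isLambdaAnalytic_of_im_ne_zero (hG.clm_apply contDiffOn_id) fun z hz him => ?_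
  have hzc : conj z ∈ Metric.ball (0 : ℂ) 1 := by simpa using hz
  have hGd : DifferentiableAt ℝ (fderiv ℝ F) z :=
    (hG.differentiableOn (by norm_num)).differentiableAt (Metric.isOpen_ball.mem_nhds hz)
  have hsymm : IsSymmSndFDerivAt ℝ F z :=
    (hF3.contDiffAt (Metric.isOpen_ball.mem_nhds hz)).isSymmSndFDerivAt (by
      rw [minSmoothness_of_isRCLikeNormedField]; norm_num)
  have hder : ∀ v : ℂ, fderiv ℝ (_root_.eulerDeriv F) z v =
      fderiv ℝ (fderiv ℝ F) z z v + fderiv ℝ F z v := fun v => by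
    have h := hGd.hasFDerivAt.clm_apply (hasFDerivAt_id (𝕜 := ℝ) z)
    have h2 : fderiv ℝ (_root_.eulerDeriv F) z = _ := h.fderiv
    rw [h2]
    simp [hsymm v z, add_comm]
  have hd : ∀ v : ℂ, HasDerivAt (fun s : ℝ => (s : ℂ) * fderiv ℝ F (s * z) v)
      (fderiv ℝ (_root_.eulerDeriv F) z v) 1 := fun v => by
    have hGv : HasFDerivAt (fun w => fderiv ℝ F w v) ((fderiv ℝ (fderiv ℝ F) z).flip v) z := by
      have h := hGd.hasFDerivAt.clm_apply (hasFDerivAt_const (𝕜 := ℝ) v z)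
      simpa using h
    have h1 := hasDerivAt_comp_real_mul (f := fun w => fderiv ℝ F w v) (z := z) (r := 1)
      (by simpa using hGv.differentiableAt)
    have h2 : HasDerivAt (fun s : ℝ => (s : ℂ)) 1 1 := Complex.ofRealCLM.hasDerivAt
    refine (h2.mul h1).congr_deriv ?_
    simp only [Complex.ofReal_one, one_mul]
    rw [hGv.fderiv, hder]
    simp [add_comm]
  have hf : ∀ w ∈ Metric.ball (0 : ℂ) 1,
      HasDerivAt (fun s : ℝ => F (s * w)) (_root_.eulerDeriv F w) 1 := fun w hw => by
    have h := hasDerivAt_comp_real_mul (f := F) (z := w) (r := 1)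
      (by simpa using hF.differentiableAt hw)
    simpa [_root_.eulerDeriv] using h
  have hQ := ((((hd 1).add ((hd Complex.I).const_mul Complex.I)).div_const 2).sub
    ((((hf z hz).sub (hf _ hzc)).div_const (z - conj z)).const_mul (lam : ℂ)))
  rw [dunklBar, wirtingerBar, reflectionQuotient, if_neg him]
  refine hQ.unique (((hasDerivAt_const (1 : ℝ) (0 : ℂ))).congr_of_eventuallyEq ?_)
  have hev : ∀ᶠ s : ℝ in 𝓝 1, (s : ℂ) * z ∈ Metric.ball (0 : ℂ) 1 := by
    have hc : ContinuousAt (fun s : ℝ => (s : ℂ) * z) 1 := by fun_prop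
    exact hc.eventually_mem (by simpa using Metric.isOpen_ball.mem_nhds hz)
  filter_upwards [hev, lt_mem_nhds one_pos] with s hs hs0
  have him' : ((s : ℂ) * z).im ≠ 0 := by
    rw [Complex.im_ofReal_mul]; exact mul_ne_zero hs0.ne' him
  have h := hF.2 _ hs
  rw [dunklBar, wirtingerBar, reflectionQuotient, if_neg him', map_mul, Complex.conj_ofReal,
    ← mul_sub] at h
  have hsc : (s : ℂ) ≠ 0 := by exact_mod_cast hs0.ne'
  have hzz : z - conj z ≠ 0 := by
    rw [Complex.sub_conj]; simp [him]
  have h' := congrArg (fun x => (s : ℂ) * x) h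
  simp only [mul_zero, mul_sub] at h'
  rw [← h']
  simp only [Pi.add_apply, Pi.sub_apply]
  field_simp

/-- The Cauchy transform of a density on the disk. -/
noncomputable def cauchyTransform (lam : ℝ) (p : ℝ → ℝ → ℝ) (f : ℂ → ℂ) (z : ℂ) : ℂ :=
  ∫ w in Metric.closedBall 0 1, f w • cauchyKer p z w ∂diskMeasure lam

theorem restrict_closedBall_diskMeasure :
    (diskMeasure lam).restrict (Metric.closedBall 0 1) = diskMeasure lam :=
  Measure.restrict_eq_self_of_ae_mem (ae_diskMeasure_mem.mono fun _ hz =>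
    Metric.ball_subset_closedBall hz)

theorem ball_prod_closedBall_subset : Metric.ball (0 : ℂ) 1 ×ˢ Metric.closedBall (0 : ℂ) 1 ⊆
    {q : ℂ × ℂ | ‖q.1‖ * ‖q.2‖ < 1} := fun q hq => by
  have h1 : ‖q.1‖ < 1 := by simpa using hq.1
  have h2 : ‖q.2‖ ≤ 1 := by simpa using hq.2
  exact (mul_le_of_le_one_right (norm_nonneg _) h2).trans_lt h1

theorem IsCauchyProfile.integrable_cauchyKer (hp : IsCauchyProfile lam p) {f : ℂ → ℂ}
    (hf : Integrable f (diskMeasure lam)) {z : ℂ} (hz : z ∈ Metric.ball (0 : ℂ) 1) :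
    IntegrableOn (fun w => f w • cauchyKer p z w) (Metric.closedBall 0 1) (diskMeasure lam) :=
  integrableOn_smul_section hp.contDiffOn_cauchyKer.continuousOn Metric.isOpen_ball
    (isCompact_closedBall 0 1) ball_prod_closedBall_subset hf.integrableOn hz

theorem IsCauchyProfile.integrable_fderiv_cauchyKer (hp : IsCauchyProfile lam p) {f : ℂ → ℂ}
    (hf : Integrable f (diskMeasure lam)) {z : ℂ} (hz : z ∈ Metric.ball (0 : ℂ) 1) :
    IntegrableOn (fun w => f w • fderiv ℝ (fun z => cauchyKer p z w) z) (Metric.closedBall 0 1)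
      (diskMeasure lam) :=
  integrableOn_smul_section (contDiffOn_fderiv_section (m := 0) isOpen_kernelDomain
    (hp.contDiffOn_cauchyKer) (by norm_num)).continuousOn Metric.isOpen_ball
    (isCompact_closedBall 0 1) ball_prod_closedBall_subset hf.integrableOn hz

theorem IsCauchyProfile.contDiffOn_cauchyTransform (hp : IsCauchyProfile lam p) {f : ℂ → ℂ}
    (hf : Integrable f (diskMeasure lam)) :
    ContDiffOn ℝ 3 (cauchyTransform lam p f) (Metric.ball 0 1) :=
  contDiffOn_setIntegral_smul 3 isOpen_kernelDomain hp.contDiffOn_cauchyKer Metric.isOpen_ball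
    (isCompact_closedBall 0 1) ball_prod_closedBall_subset hf.integrableOn

theorem IsCauchyProfile.fderiv_cauchyTransform (hp : IsCauchyProfile lam p) {f : ℂ → ℂ}
    (hf : Integrable f (diskMeasure lam)) {z : ℂ} (hz : z ∈ Metric.ball (0 : ℂ) 1) (v : ℂ) :
    fderiv ℝ (cauchyTransform lam p f) z v = ∫ w in Metric.closedBall 0 1,
      f w * fderiv ℝ (fun z => cauchyKer p z w) z v ∂diskMeasure lam := by
  have h := hasFDerivAt_setIntegral_smul (f := f) (μ := diskMeasure lam) isOpen_kernelDomain
    (hp.contDiffOn_cauchyKer.of_le (by norm_num)) Metric.isOpen_ball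
    (isCompact_closedBall 0 1) ball_prod_closedBall_subset hf.integrableOn hz
  have h2 : fderiv ℝ (cauchyTransform lam p f) z = _ := h.fderiv
  rw [h2, ContinuousLinearMap.integral_apply (hp.integrable_fderiv_cauchyKer hf hz)]
  rfl

theorem IsCauchyProfile.isLambdaAnalytic_cauchyTransform (hp : IsCauchyProfile lam p)
    {f : ℂ → ℂ} (hf : Integrable f (diskMeasure lam)) :
    IsLambdaAnalytic lam (cauchyTransform lam p f) := by
  refine isLambdaAnalytic_of_im_ne_zero ((hp.contDiffOn_cauchyTransform hf).of_le (by norm_num))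
    fun z hz him => ?_
  have hzc : conj z ∈ Metric.ball (0 : ℂ) 1 := by simpa using hz
  have hi : ∀ v : ℂ, IntegrableOn (fun w => f w * fderiv ℝ (fun z => cauchyKer p z w) z v)
      (Metric.closedBall 0 1) (diskMeasure lam) := fun v =>
    (hp.integrable_fderiv_cauchyKer hf hz).apply_continuousLinearMap v
  have i1 : IntegrableOn (fun w => (f w * fderiv ℝ (fun z => cauchyKer p z w) z 1 +
      Complex.I * (f w * fderiv ℝ (fun z => cauchyKer p z w) z Complex.I)) / 2)
      (Metric.closedBall 0 1) (diskMeasure lam) :=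
    ((hi 1).add ((hi Complex.I).const_mul _)).div_const 2
  have i2 : IntegrableOn (fun w => (lam : ℂ) * ((f w • cauchyKer p z w -
      f w • cauchyKer p (conj z) w) / (z - conj z))) (Metric.closedBall 0 1) (diskMeasure lam) :=
    (((hp.integrable_cauchyKer hf hz).sub (hp.integrable_cauchyKer hf hzc)).div_const _).const_mul _
  rw [dunklBar, wirtingerBar, reflectionQuotient, if_neg him, hp.fderiv_cauchyTransform hf hz,
    hp.fderiv_cauchyTransform hf hz, cauchyTransform, cauchyTransform, ← integral_const_mul,
    ← integral_add (hi 1) ((hi Complex.I).const_mul _), ← integral_sub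
      (hp.integrable_cauchyKer hf hz) (hp.integrable_cauchyKer hf hzc), ← integral_div,
    ← integral_div, ← integral_const_mul, ← integral_sub i1 i2]
  refine setIntegral_eq_zero_of_forall_eq_zero fun w hw => ?_
  have h := (hp.isLambdaAnalytic_cauchyKer (by simpa using hw)).2 z hz
  rw [dunklBar, wirtingerBar, reflectionQuotient, if_neg him] at h
  simp only [smul_eq_mul]
  linear_combination f w * h

/-- The Bergman projection, the integral operator with the normalised Bergman kernel. -/
noncomputable def bergmanProj (lam : ℝ) (p : ℝ → ℝ → ℝ) (f : ℂ → ℂ) (z : ℂ) : ℂ :=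
  ((diskConst lam * circleMass lam / 2 : ℝ) : ℂ)⁻¹ * ∫ w, diskKer lam p z w * f w ∂diskMeasure lam

theorem integral_diskKer_mul {z : ℂ} (hz : z ∈ Metric.ball (0 : ℂ) 1) (f : ℂ → ℂ) :
    ∫ w, diskKer lam p z w * f w ∂diskMeasure lam =
      ∫ w, bergmanKer lam p z w * f w ∂diskMeasure lam := by
  refine integral_congr_ae ?_
  filter_upwards [ae_diskMeasure_mem] with w hw
  rw [diskKer_eq hz hw]

theorem bergmanProj_congr {f g : ℂ → ℂ} (h : f =ᵐ[diskMeasure lam] g) :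
    bergmanProj lam p f = bergmanProj lam p g := by
  funext z
  have : (fun w => diskKer lam p z w * f w) =ᵐ[diskMeasure lam] fun w => diskKer lam p z w * g w :=
    h.mono fun w hw => by simp only [hw]
  rw [bergmanProj, bergmanProj, integral_congr_ae this]

/-- The Bergman projection takes values in the `lam`-analytic functions. -/
theorem IsCauchyProfile.exists_isLambdaAnalytic_bergmanProj (hp : IsCauchyProfile lam p)
    {f : ℂ → ℂ} (hf : Integrable f (diskMeasure lam)) :
    ∃ G, IsLambdaAnalytic lam G ∧ bergmanProj lam p f =ᵐ[diskMeasure lam] G := by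
  have hC := hp.isLambdaAnalytic_cauchyTransform hf
  refine ⟨((diskConst lam * circleMass lam / 2 : ℝ) : ℂ)⁻¹ •
    (eulerDeriv (cauchyTransform lam p f) + ((lam : ℂ) + 1) • cauchyTransform lam p f),
    ((hC.eulerDeriv (hp.contDiffOn_cauchyTransform hf)).add (hC.smul _)).smul _, ?_⟩
  filter_upwards [ae_diskMeasure_mem] with z hz
  rw [bergmanProj, integral_diskKer_mul hz, Pi.smul_apply, Pi.add_apply, Pi.smul_apply, smul_eq_mul,
    smul_eq_mul, eulerDeriv, hp.fderiv_cauchyTransform hf hz, cauchyTransform]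
  congr 1
  have i1 : IntegrableOn (fun w => f w * fderiv ℝ (fun z => cauchyKer p z w) z z)
      (Metric.closedBall 0 1) (diskMeasure lam) :=
    (hp.integrable_fderiv_cauchyKer hf hz).apply_continuousLinearMap z
  rw [← integral_const_mul, ← integral_add i1 ((hp.integrable_cauchyKer hf hz).const_mul _),
    restrict_closedBall_diskMeasure]
  refine integral_congr_ae (Eventually.of_forall fun w => ?_)
  simp only [bergmanKer, smul_eq_mul]
  ring

theorem IsCauchyProfile.bergmanProj_eq (hp : IsCauchyProfile lam p) (hlam : 0 ≤ lam)
    {f : ℂ → ℂ} (hf : IsLambdaAnalytic lam f) (hfi : Integrable f (diskMeasure lam)) :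
    bergmanProj lam p f =ᵐ[diskMeasure lam] f := by
  filter_upwards [ae_diskMeasure_mem, ae_diskMeasure_ne_zero] with z hz hz0
  have hc : ((diskConst lam * circleMass lam / 2 : ℝ) : ℂ) ≠ 0 := by
    have := diskConst_pos hlam
    have := circleMass_pos hlam
    exact_mod_cast (by positivity : (0 : ℝ) < diskConst lam * circleMass lam / 2).ne'
  rw [bergmanProj, integral_diskKer_mul hz, hp.integral_bergmanKer_mul hlam hf hfi (by simpa using hz)
    hz0, inv_mul_cancel_left₀ hc]

theorem IsCauchyProfile.aestronglyMeasurable_bergmanProj (hp : IsCauchyProfile lam p) {f : ℂ → ℂ}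
    (hf : Integrable f (diskMeasure lam)) :
    AEStronglyMeasurable (bergmanProj lam p f) (diskMeasure lam) := by
  obtain ⟨G, hG, h⟩ := hp.exists_isLambdaAnalytic_bergmanProj hf
  exact (aestronglyMeasurable_diskMeasure hG.1.continuousOn).congr h.symm

/-- The Bergman projection is bounded on `L^r` for `1 < r < ∞`. -/
theorem IsCauchyProfile.exists_eLpNorm_bergmanProj_le (hp : IsCauchyProfile lam p) (hlam : 0 ≤ lam)
    {r s : ℝ≥0∞} [r.HolderConjugate s] (hr : r ≠ ∞) (hs : s ≠ ∞) :
    ∃ A : ℝ≥0∞, A ≠ ∞ ∧ ∀ f : ℂ → ℂ, AEStronglyMeasurable f (diskMeasure lam) →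
      eLpNorm (bergmanProj lam p f) r (diskMeasure lam) ≤ A * eLpNorm f r (diskMeasure lam) := by
  have hrs : r.toReal.HolderConjugate s.toReal := ENNReal.HolderConjugate.toReal_of_ne_top hr hs
  obtain ⟨A, hA, h⟩ := hp.exists_lintegral_rpow_diskKer_le hlam hrs
  have hr0 : r ≠ 0 := fun h0 => by simpa [h0] using hrs.pos
  have hpos := hrs.pos
  set κ : ℂ := ((diskConst lam * circleMass lam / 2 : ℝ) : ℂ)⁻¹ with hκ
  refine ⟨‖κ‖ₑ * A, ENNReal.mul_ne_top enorm_ne_top hA, fun f hf => ?_⟩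
  rw [eLpNorm_eq_lintegral_rpow_enorm_toReal hr0 hr, eLpNorm_eq_lintegral_rpow_enorm_toReal hr0 hr]
  have hle : ∫⁻ z, ‖bergmanProj lam p f z‖ₑ ^ r.toReal ∂diskMeasure lam ≤
      (‖κ‖ₑ * A) ^ r.toReal * ∫⁻ z, ‖f z‖ₑ ^ r.toReal ∂diskMeasure lam := by
    calc ∫⁻ z, ‖bergmanProj lam p f z‖ₑ ^ r.toReal ∂diskMeasure lam
        ≤ ∫⁻ z, ‖κ‖ₑ ^ r.toReal * (∫⁻ w, ‖diskKer lam p z w‖ₑ * ‖f w‖ₑ ∂diskMeasure lam) ^ r.toReal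
            ∂diskMeasure lam := by
          refine lintegral_mono fun z => ?_
          rw [← ENNReal.mul_rpow_of_nonneg _ _ hpos.le, bergmanProj, enorm_mul]
          gcongr
          refine (enorm_integral_le_lintegral_enorm _).trans (le_of_eq ?_)
          simp only [enorm_mul]
      _ ≤ _ := by
          rw [lintegral_const_mul' _ _ (ENNReal.rpow_ne_top_of_nonneg hpos.le enorm_ne_top),
            ENNReal.mul_rpow_of_nonneg _ _ hpos.le, mul_assoc]
          gcongr
          exact h _ hf.enorm
  calc _ ≤ ((‖κ‖ₑ * A) ^ r.toReal * ∫⁻ z, ‖f z‖ₑ ^ r.toReal ∂diskMeasure lam) ^ (1 / r.toReal) := by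
        gcongr
    _ = _ := by
        rw [ENNReal.mul_rpow_of_nonneg _ _ (by positivity), ← ENNReal.rpow_mul,
          mul_one_div_cancel hpos.ne', ENNReal.rpow_one]

end BergmanProjection

/-! ### Duality of the Bergman spaces -/

section Duality

open Set Filter Topology

variable {lam : ℝ} {P : ℝ → ℝ → ℝ}

theorem bergmanProj_add (hP : IsCauchyProfile lam P) {f g : ℂ → ℂ}
    (hf : Integrable f (diskMeasure lam)) (hg : Integrable g (diskMeasure lam)) :
    bergmanProj lam P (f + g) =ᵐ[diskMeasure lam] bergmanProj lam P f + bergmanProj lam P g := by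
  filter_upwards [ae_diskMeasure_mem] with z hz
  have hz1 : ‖z‖ < 1 := by simpa using hz
  simp only [bergmanProj, Pi.add_apply, integral_diskKer_mul hz]
  rw [← mul_add, ← integral_add (hP.integrable_bergmanKer_mul hz1 hf)
    (hP.integrable_bergmanKer_mul hz1 hg)]
  simp only [mul_add]

theorem bergmanProj_smul (c : ℂ) (f : ℂ → ℂ) :
    bergmanProj lam P (c • f) = c • bergmanProj lam P f := by
  funext z
  simp only [bergmanProj, Pi.smul_apply, smul_eq_mul, mul_left_comm _ c, integral_const_mul]

theorem integrable_coe {r : ℝ≥0∞} [Fact (1 ≤ r)] (hlam : 0 ≤ lam)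
    (f : Lp ℂ r (diskMeasure lam)) : Integrable f (diskMeasure lam) := by
  have := isFiniteMeasure_diskMeasure hlam
  exact (Lp.memLp f).integrable Fact.out

theorem bergmanProj_coe (hP : IsCauchyProfile lam P) (hlam : 0 ≤ lam) {r : ℝ≥0∞} [Fact (1 ≤ r)]
    (f : bergmanSpace lam r) : bergmanProj lam P f.1 =ᵐ[diskMeasure lam] f.1 := by
  obtain ⟨F, hF, hf⟩ := f.2
  rw [bergmanProj_congr hf]
  exact (hP.bergmanProj_eq hlam hF ((integrable_coe hlam f.1).congr hf)).trans hf.symm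

/-- The Bergman projection as a bounded operator from `L^r` to the Bergman space. -/
theorem exists_bergmanProjection (hP : IsCauchyProfile lam P) (hlam : 0 ≤ lam) {r s : ℝ≥0∞}
    [Fact (1 ≤ r)] [r.HolderConjugate s] (hr : r ≠ ∞) (hs : s ≠ ∞) :
    ∃ (A : ℝ) (T : Lp ℂ r (diskMeasure lam) → bergmanSpace lam r), 0 < A ∧
      (∀ f, (T f).1 =ᵐ[diskMeasure lam] bergmanProj lam P f) ∧ (∀ f, ‖T f‖ ≤ A * ‖f‖) := by
  obtain ⟨A, hA, h⟩ := hP.exists_eLpNorm_bergmanProj_le hlam hr hs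
  have hmem : ∀ f : Lp ℂ r (diskMeasure lam), MemLp (bergmanProj lam P f) r (diskMeasure lam) :=
    fun f => ⟨hP.aestronglyMeasurable_bergmanProj (integrable_coe hlam f),
      (h f (Lp.aestronglyMeasurable f)).trans_lt
        (ENNReal.mul_lt_top hA.lt_top (Lp.memLp f).2)⟩
  refine ⟨A.toReal + 1, fun f => ⟨(hmem f).toLp _, ?_⟩, by positivity, fun f => (hmem f).coeFn_toLp,
    fun f => ?_⟩
  · obtain ⟨G, hG, hGf⟩ := hP.exists_isLambdaAnalytic_bergmanProj (integrable_coe hlam f)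
    exact ⟨G, hG, (hmem f).coeFn_toLp.trans hGf⟩
  · change ‖(hmem f).toLp _‖ ≤ _
    rw [Lp.norm_toLp, Lp.norm_def]
    have h1 := ENNReal.toReal_mono (ENNReal.mul_ne_top hA (Lp.memLp f).2.ne)
      (h f (Lp.aestronglyMeasurable f))
    rw [ENNReal.toReal_mul] at h1
    nlinarith [ENNReal.toReal_nonneg (a := eLpNorm f r (diskMeasure lam))]

theorem IsCauchyProfile.integrable_diskKer_mul_mul (hP : IsCauchyProfile lam P) (hlam : 0 ≤ lam)
    {r s : ℝ≥0∞} [r.HolderConjugate s] (hr : r ≠ ∞) (hs : s ≠ ∞) {f g : ℂ → ℂ}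
    (hf : MemLp f r (diskMeasure lam)) (hg : MemLp g s (diskMeasure lam)) :
    Integrable (Function.uncurry fun z w => diskKer lam P z w * f w * g z)
      ((diskMeasure lam).prod (diskMeasure lam)) := by
  have := isFiniteMeasure_diskMeasure hlam
  have hrs : r.toReal.HolderConjugate s.toReal := ENNReal.HolderConjugate.toReal_of_ne_top hr hs
  have hr0 : r ≠ 0 := fun h0 => by simpa [h0] using hrs.pos
  have hs0 : s ≠ 0 := fun h0 => by simpa [h0] using hrs.symm.pos
  obtain ⟨A, hA, h⟩ := hP.exists_lintegral_rpow_diskKer_le hlam hrs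
  have hm1 : AEStronglyMeasurable (fun q : ℂ × ℂ => diskKer lam P q.1 q.2 * f q.2)
      ((diskMeasure lam).prod (diskMeasure lam)) :=
    hP.measurable_diskKer.aestronglyMeasurable.mul hf.1.comp_snd
  have hm : AEStronglyMeasurable (Function.uncurry fun z w => diskKer lam P z w * f w * g z)
      ((diskMeasure lam).prod (diskMeasure lam)) := hm1.mul hg.1.comp_fst
  refine ⟨hm, ?_⟩
  rw [hasFiniteIntegral_iff_enorm, lintegral_prod _ hm.enorm]
  set Tf : ℂ → ℝ≥0∞ := fun z => ∫⁻ w, ‖diskKer lam P z w‖ₑ * ‖f w‖ₑ ∂diskMeasure lam with hTf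
  have hTm : AEMeasurable Tf (diskMeasure lam) := by
    have h2 := hm1.enorm.lintegral_prod_right'
    simp only [enorm_mul] at h2
    exact h2
  have e : ∀ z, ∫⁻ w, ‖Function.uncurry (fun z w => diskKer lam P z w * f w * g z) (z, w)‖ₑ
      ∂diskMeasure lam = (Tf * fun z => ‖g z‖ₑ) z := fun z => by
    simp only [Function.uncurry_apply_pair, enorm_mul, Pi.mul_apply, hTf]
    rw [lintegral_mul_const' _ _ enorm_ne_top]
  simp only [e]
  refine (ENNReal.lintegral_mul_le_Lp_mul_Lq _ hrs hTm hg.1.enorm).trans_lt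
    (ENNReal.mul_lt_top ?_ ?_)
  · refine ENNReal.rpow_lt_top_of_nonneg (by have := hrs.pos; positivity) ?_
    refine ((h _ hf.1.enorm).trans_lt (ENNReal.mul_lt_top
      (ENNReal.rpow_lt_top_of_nonneg hrs.pos.le hA) ?_)).ne
    exact lintegral_rpow_enorm_lt_top_of_eLpNorm_lt_top hr0 hr hf.2
  · refine ENNReal.rpow_lt_top_of_nonneg (by have := hrs.symm.pos; positivity) ?_
    exact (lintegral_rpow_enorm_lt_top_of_eLpNorm_lt_top hs0 hs hg.2).ne

/-- The Bergman projection is symmetric for the pairing of `L^r` with `L^s`. -/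
theorem IsCauchyProfile.integral_bergmanProj_mul_conj (hP : IsCauchyProfile lam P)
    (hlam : 0 ≤ lam) {r s : ℝ≥0∞} [r.HolderConjugate s] (hr : r ≠ ∞) (hs : s ≠ ∞) {f g : ℂ → ℂ}
    (hf : MemLp f r (diskMeasure lam)) (hg : MemLp g s (diskMeasure lam)) :
    ∫ z, bergmanProj lam P f z * conj (g z) ∂diskMeasure lam =
      ∫ z, f z * conj (bergmanProj lam P g z) ∂diskMeasure lam := by
  have := isFiniteMeasure_diskMeasure hlam
  have hgc : MemLp (fun z => conj (g z)) s (diskMeasure lam) := hg.star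
  have hint := hP.integrable_diskKer_mul_mul hlam hr hs hf hgc
  set κ : ℂ := ((diskConst lam * circleMass lam / 2 : ℝ) : ℂ)⁻¹ with hκ
  have e1 : ∀ z, bergmanProj lam P f z * conj (g z) =
      κ * ∫ w, diskKer lam P z w * f w * conj (g z) ∂diskMeasure lam := fun z => by
    rw [bergmanProj, integral_mul_const, mul_assoc]
  have e2 : ∀ w, f w * conj (bergmanProj lam P g w) =
      κ * ∫ z, diskKer lam P z w * f w * conj (g z) ∂diskMeasure lam := fun w => by
    rw [bergmanProj, map_mul, ← integral_conj, mul_left_comm, ← integral_const_mul, hκ, map_inv₀,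
      Complex.conj_ofReal]
    congr 1
    refine integral_congr_ae (Eventually.of_forall fun z => ?_)
    simp only [map_mul, hP.conj_diskKer]
    ring
  simp only [e1, e2]
  rw [integral_const_mul, integral_const_mul, integral_integral_swap hint]

theorem norm_integral_mul_le {α : Type*} {m : MeasurableSpace α} {μ : Measure α} {r s : ℝ≥0∞}
    [r.HolderConjugate s] {f g : α → ℂ} (hf : MemLp f r μ) (hg : MemLp g s μ) :
    Integrable (fun z => f z * conj (g z)) μ ∧
      ‖∫ z, f z * conj (g z) ∂μ‖ ≤ (eLpNorm f r μ).toReal * (eLpNorm g s μ).toReal := by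
  have hgc : MemLp (fun z => conj (g z)) s μ := hg.star
  have hgn : eLpNorm (fun z => conj (g z)) s μ = eLpNorm g s μ := eLpNorm_star
  refine ⟨hf.integrable_mul hgc, ?_⟩
  have h := eLpNorm_smul_le_mul_eLpNorm (p := r) (q := s) (r := 1) hgc.1 hf.1
  rw [hgn] at h
  have hfin : eLpNorm f r μ * eLpNorm g s μ ≠ ∞ := ENNReal.mul_ne_top hf.2.ne hg.2.ne
  rw [← ENNReal.toReal_mul, ← ENNReal.ofReal_le_iff_le_toReal hfin, ofReal_norm]
  refine (enorm_integral_le_lintegral_enorm _).trans ?_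
  rw [eLpNorm_one_eq_lintegral_enorm] at h
  exact h

/-- The functional `f ↦ ∫ f ḡ` on the Bergman space. -/
noncomputable def bergmanPairing {r s : ℝ≥0∞} [Fact (1 ≤ r)] [Fact (1 ≤ s)]
    [r.HolderConjugate s] (g : bergmanSpace lam s) : StrongDual ℂ (bergmanSpace lam r) :=
  LinearMap.mkContinuous
    { toFun := fun f => ∫ z, f.1 z * conj (g.1 z) ∂diskMeasure lam
      map_add' := fun f₁ f₂ => by
        rw [← integral_add (norm_integral_mul_le (Lp.memLp f₁.1) (Lp.memLp g.1)).1
          (norm_integral_mul_le (Lp.memLp f₂.1) (Lp.memLp g.1)).1]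
        refine integral_congr_ae ((Lp.coeFn_add f₁.1 f₂.1).mono fun z hz => ?_)
        rw [Pi.add_apply] at hz
        simp only [Submodule.coe_add, hz, add_mul]
      map_smul' := fun c f => by
        rw [RingHom.id_apply, smul_eq_mul, ← integral_const_mul]
        refine integral_congr_ae ((Lp.coeFn_smul c f.1).mono fun z hz => ?_)
        rw [Pi.smul_apply, smul_eq_mul] at hz
        simp only [Submodule.coe_smul, hz, mul_assoc] } ‖g‖ fun f => by
    rw [mul_comm, ← Submodule.norm_coe, ← Submodule.norm_coe, Lp.norm_def, Lp.norm_def]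
    exact (norm_integral_mul_le (Lp.memLp f.1) (Lp.memLp g.1)).2

theorem bergmanPairing_apply {r s : ℝ≥0∞} [Fact (1 ≤ r)] [Fact (1 ≤ s)]
    [r.HolderConjugate s] (g : bergmanSpace lam s) (f : bergmanSpace lam r) :
    bergmanPairing g f = ∫ z, f.1 z * conj (g.1 z) ∂diskMeasure lam := rfl

theorem norm_bergmanPairing_le {r s : ℝ≥0∞} [Fact (1 ≤ r)] [Fact (1 ≤ s)]
    [r.HolderConjugate s] (g : bergmanSpace lam s) :
    ‖(bergmanPairing g : StrongDual ℂ (bergmanSpace lam r))‖ ≤ ‖g‖ :=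
  LinearMap.mkContinuous_norm_le _ (norm_nonneg _) _

/-- The lower bound for the norm of `f ↦ ∫ f ḡ`: for arbitrary `φ ∈ L^r`, the integral `∫ φ ḡ`
equals `∫ (Pφ) ḡ`, where `P` is the Bergman projection, since `Pg = g`. -/
theorem exists_mul_norm_le_norm_bergmanPairing (hlam : 0 ≤ lam) {r s : ℝ≥0∞} [Fact (1 ≤ r)]
    [Fact (1 ≤ s)] [r.HolderConjugate s] (hr : r ≠ ∞) (hs : s ≠ ∞) :
    ∃ C : ℝ, 0 < C ∧ ∀ g : bergmanSpace lam s,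
      C * ‖g‖ ≤ ‖(bergmanPairing g : StrongDual ℂ (bergmanSpace lam r))‖ := by
  obtain ⟨P, hP⟩ := exists_isCauchyProfile hlam
  obtain ⟨A, T, hA, hT, hTA⟩ := exists_bergmanProjection hP hlam hr hs
  refine ⟨A⁻¹, inv_pos.2 hA, fun g => ?_⟩
  rw [inv_mul_le_iff₀ hA]
  set L : StrongDual ℂ (bergmanSpace lam r) := bergmanPairing g with hL
  have hgm := Lp.memLp g.1
  have hgc : MemLp (fun z => conj (g.1 z)) s (diskMeasure lam) := hgm.star
  have hgn : eLpNorm (fun z => conj (g.1 z)) s (diskMeasure lam) =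
    eLpNorm g.1 s (diskMeasure lam) := eLpNorm_star
  rw [← Submodule.norm_coe, Lp.norm_def, ← hgn]
  refine toReal_eLpNorm_le_of_forall_integral_mul_le (p := r) hr hs hgc (by positivity) fun φ hφ => ?_
  have e : ∫ z, φ z * conj (g.1 z) ∂diskMeasure lam = L (T (hφ.toLp φ)) := by
    rw [hL, bergmanPairing_apply]
    have h1 : ∫ z, φ z * conj (g.1 z) ∂diskMeasure lam =
        ∫ z, φ z * conj (bergmanProj lam P g.1 z) ∂diskMeasure lam :=
      integral_congr_ae ((bergmanProj_coe hP hlam g).mono fun z hz => by simp only [hz])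
    rw [h1, ← hP.integral_bergmanProj_mul_conj hlam hr hs hφ hgm]
    refine integral_congr_ae ((hT (hφ.toLp φ)).mono fun z hz => ?_)
    simp only
    rw [hz, bergmanProj_congr hφ.coeFn_toLp]
  rw [e]
  calc ‖L (T (hφ.toLp φ))‖ ≤ ‖L‖ * ‖T (hφ.toLp φ)‖ := L.le_opNorm _
    _ ≤ ‖L‖ * (A * ‖hφ.toLp φ‖) := by gcongr; exact hTA _
    _ = _ := by rw [Lp.norm_toLp]; ring

/-- Every functional on the Bergman space is composed with the Bergman projection, represented on
`L^r`, and the representing function projected. -/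
theorem exists_eq_bergmanPairing (hlam : 0 ≤ lam) {r s : ℝ≥0∞} [Fact (1 ≤ r)]
    [Fact (1 ≤ s)] [r.HolderConjugate s] (hr : r ≠ ∞) (hs : s ≠ ∞)
    (L : StrongDual ℂ (bergmanSpace lam r)) : ∃ g : bergmanSpace lam s, bergmanPairing g = L := by
  have := isFiniteMeasure_diskMeasure hlam
  obtain ⟨P, hP⟩ := exists_isCauchyProfile hlam
  obtain ⟨A, T, hA, hT, hTA⟩ := exists_bergmanProjection hP hlam hr hs
  obtain ⟨A', T', hA', hT', -⟩ := exists_bergmanProjection (r := s) (s := r) hP hlam hs hr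
  have hTadd : ∀ f₁ f₂, T (f₁ + f₂) = T f₁ + T f₂ := fun f₁ f₂ => by
    refine Subtype.ext (Lp.ext ?_)
    rw [Submodule.coe_add]
    refine (hT _).trans ?_
    rw [bergmanProj_congr (Lp.coeFn_add f₁ f₂)]
    refine (bergmanProj_add hP (integrable_coe hlam f₁) (integrable_coe hlam f₂)).trans ?_
    exact ((hT f₁).symm.add (hT f₂).symm).trans (Lp.coeFn_add _ _).symm
  have hTsmul : ∀ (c : ℂ) f, T (c • f) = c • T f := fun c f => by
    refine Subtype.ext (Lp.ext ?_)
    rw [Submodule.coe_smul]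
    refine (hT _).trans ?_
    rw [bergmanProj_congr (Lp.coeFn_smul c f), bergmanProj_smul]
    exact ((hT f).symm.const_smul c).trans (Lp.coeFn_smul _ _).symm
  let T₀ : Lp ℂ r (diskMeasure lam) →ₗ[ℂ] bergmanSpace lam r :=
    { toFun := T, map_add' := hTadd, map_smul' := hTsmul }
  let Λ : StrongDual ℂ (Lp ℂ r (diskMeasure lam)) := L.comp (T₀.mkContinuous A hTA)
  obtain ⟨h, hh, hΛ⟩ := exists_memLp_forall_eq_integral_mul hr hs Λ
  have hhc : MemLp (fun z => conj (h z)) s (diskMeasure lam) := hh.star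
  refine ⟨T' (hhc.toLp _), ContinuousLinearMap.ext fun f => ?_⟩
  have hTf : T f.1 = f := Subtype.ext (Lp.ext ((hT f.1).trans (bergmanProj_coe hP hlam f)))
  have h1 : L f = ∫ z, f.1 z * h z ∂diskMeasure lam := by
    have := hΛ _ (Lp.memLp f.1)
    rw [Lp.toLp_coeFn] at this
    rw [← this]
    exact congrArg L hTf.symm
  have h2 : ∫ z, f.1 z * h z ∂diskMeasure lam =
      ∫ z, bergmanProj lam P f.1 z * conj (conj (h z)) ∂diskMeasure lam :=
    integral_congr_ae ((bergmanProj_coe hP hlam f).mono fun z hz => by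
      simp only [hz, Complex.conj_conj])
  rw [h1, h2, hP.integral_bergmanProj_mul_conj hlam hr hs (Lp.memLp f.1) hhc, bergmanPairing_apply]
  refine integral_congr_ae ((hT' (hhc.toLp _)).mono fun z hz => ?_)
  simp only
  rw [hz, bergmanProj_congr hhc.coeFn_toLp]

theorem bergmanPairing_add {r s : ℝ≥0∞} [Fact (1 ≤ r)] [Fact (1 ≤ s)] [r.HolderConjugate s]
    (g₁ g₂ : bergmanSpace lam s) :
    (bergmanPairing (g₁ + g₂) : StrongDual ℂ (bergmanSpace lam r)) =
      bergmanPairing g₁ + bergmanPairing g₂ := by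
  refine ContinuousLinearMap.ext fun f => ?_
  rw [add_apply, bergmanPairing_apply, bergmanPairing_apply, bergmanPairing_apply,
    ← integral_add (norm_integral_mul_le (Lp.memLp f.1) (Lp.memLp g₁.1)).1
      (norm_integral_mul_le (Lp.memLp f.1) (Lp.memLp g₂.1)).1]
  refine integral_congr_ae ((Lp.coeFn_add g₁.1 g₂.1).mono fun z hz => ?_)
  rw [Pi.add_apply] at hz
  simp only [Submodule.coe_add, hz, map_add, mul_add]

theorem bergmanPairing_smul {r s : ℝ≥0∞} [Fact (1 ≤ r)] [Fact (1 ≤ s)] [r.HolderConjugate s]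
    (c : ℂ) (g : bergmanSpace lam s) :
    (bergmanPairing (c • g) : StrongDual ℂ (bergmanSpace lam r)) = conj c • bergmanPairing g := by
  refine ContinuousLinearMap.ext fun f => ?_
  rw [smul_apply, bergmanPairing_apply, bergmanPairing_apply, smul_eq_mul,
    ← integral_const_mul]
  refine integral_congr_ae ((Lp.coeFn_smul c g.1).mono fun z hz => ?_)
  rw [Pi.smul_apply, smul_eq_mul] at hz
  simp only [Submodule.coe_smul, hz, map_mul]
  ring

end Duality

theorem mainTheorem10 (lam : ℝ) (hlam : 0 ≤ lam) (p p' : ℝ≥0∞) [Fact (1 ≤ p)] [Fact (1 ≤ p')]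
    (hp_one : 1 < p) (hp_top : p < ∞) (hpp' : p⁻¹ + p'⁻¹ = 1) :
    ∃ C : ℝ, 0 < C ∧
      ∃ Φ : bergmanSpace lam p' ≃L⋆[ℂ] StrongDual ℂ (bergmanSpace lam p),
        (∀ (g : bergmanSpace lam p') (f : bergmanSpace lam p),
          Integrable (fun z => f.1 z * conj (g.1 z)) (diskMeasure lam) ∧
          Φ g f = ∫ z, f.1 z * conj (g.1 z) ∂(diskMeasure lam)) ∧
        (∀ L : StrongDual ℂ (bergmanSpace lam p), ∃! g : bergmanSpace lam p',
          ∀ f : bergmanSpace lam p,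
            L f = ∫ z, f.1 z * conj (g.1 z) ∂(diskMeasure lam)) ∧
        (∀ (L : StrongDual ℂ (bergmanSpace lam p)) (g : bergmanSpace lam p'),
          (∀ f : bergmanSpace lam p,
            L f = ∫ z, f.1 z * conj (g.1 z) ∂(diskMeasure lam)) →
          C * ‖g‖ ≤ ‖L‖ ∧ ‖L‖ ≤ ‖g‖) := by
  have hconj : p.HolderConjugate p' := ENNReal.holderConjugate_iff.2 hpp'
  have hp' : p' ≠ ∞ := by
    rintro rfl
    rw [ENNReal.inv_top, add_zero, ENNReal.inv_eq_one] at hpp'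
    exact hp_one.ne' hpp'
  obtain ⟨C, hC, hlow⟩ := exists_mul_norm_le_norm_bergmanPairing (r := p) (s := p') hlam hp_top.ne hp'
  let e₀ : bergmanSpace lam p' →ₗ⋆[ℂ] StrongDual ℂ (bergmanSpace lam p) :=
    { toFun := bergmanPairing
      map_add' := bergmanPairing_add
      map_smul' := bergmanPairing_smul }
  have hinj : Function.Injective e₀ := (injective_iff_map_eq_zero e₀).2 fun g hg => by
    have h := hlow g
    rw [show bergmanPairing g = (0 : StrongDual ℂ (bergmanSpace lam p)) from hg,
      ContinuousLinearMap.opNorm_zero] at h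
    exact norm_le_zero_iff.1 (nonpos_of_mul_nonpos_right h hC)
  have hsurj : Function.Surjective e₀ := exists_eq_bergmanPairing hlam hp_top.ne hp'
  have heq : ∀ (L : StrongDual ℂ (bergmanSpace lam p)) (g : bergmanSpace lam p'),
      (∀ f : bergmanSpace lam p, L f = ∫ z, f.1 z * conj (g.1 z) ∂(diskMeasure lam)) → e₀ g = L :=
    fun L g h => ContinuousLinearMap.ext fun f => (h f).symm
  let e : bergmanSpace lam p' ≃ₗ⋆[ℂ] StrongDual ℂ (bergmanSpace lam p) :=
    LinearEquiv.ofBijective e₀ ⟨hinj, hsurj⟩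
  have hto : ∀ g, ‖e g‖ ≤ 1 * ‖g‖ := fun g => by
    rw [one_mul]
    exact norm_bergmanPairing_le g
  have hinv : ∀ L, ‖e.symm L‖ ≤ C⁻¹ * ‖L‖ := fun L => by
    obtain ⟨g, rfl⟩ := e.surjective L
    rw [LinearEquiv.symm_apply_apply, le_inv_mul_iff₀ hC]
    exact hlow g
  let Φ : bergmanSpace lam p' ≃L⋆[ℂ] StrongDual ℂ (bergmanSpace lam p) :=
    { e with
      continuous_toFun := AddMonoidHomClass.continuous_of_bound e 1 hto
      continuous_invFun := AddMonoidHomClass.continuous_of_bound e.symm C⁻¹ hinv }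
  refine ⟨C, hC, Φ, fun g f =>
    ⟨(norm_integral_mul_le (Lp.memLp f.1) (Lp.memLp g.1)).1, bergmanPairing_apply g f⟩,
    fun L => ?_, fun L g h => ?_⟩
  · obtain ⟨g, hg⟩ := hsurj L
    refine ⟨g, fun f => by rw [← hg]; rfl, fun g' hg' => hinj ?_⟩
    rw [hg, heq L g' hg']
  · rw [← heq L g h]
    exact ⟨hlow g, norm_bergmanPairing_le g⟩
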